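/- **Theorem (Finite-Field Compute–Forward).** Let $\mathbb F_q$ be a finite field and consider a two-user memoryless multiple-access channel $P_{Y|X_1,X_2}$ whose input alphabets $\mathcal X_1,\mathcal X_2$ and output alphabet $\mathcal Y$ are each a finite set or $\mathbb R$ (or, more generally, a standard Borel space). Let $\boldsymbol a=(a_1,a_2)\in\mathbb F_q^2$. *Codes.* For rates $R_1,R_2\ge 0$, a code of block length $n$ consists of message sets with $\lceil 2^{nR_k}\rceil$ elements, encoders $m_k\mapsto (u_k^n(m_k),x_k^n(m_k))\in\mathbb F_q^n\times\mathcal X_k^n$, $k=1,2$, with $m_k\mapsto u_k^n(m_k)$ one-to-one, and a measurable decoder $\hat w^n:\mathcal Y^n\to\mathbb F_q^n$. Its error probability $P_e^{(n)}$ is the probability, for independent uniform messages $M_1,M_2$, that $\hat w^n(Y^n)\ne a_1u_1^n(M_1)\oplus a_2u_2^n(M_2)$. The pair $(R_1,R_2)$ is *achievable* if there is a sequence of such codes with $P_e^{(n)}\to 0$ as $n\to\infty$. *Regions.* Let $p_{U_1},p_{U_2}$ be pmfs on $\mathbb F_q$ and $x_k:\mathbb F_q\to\mathcal X_k$ symbol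 maps. Let $(U_1,U_2)\sim p_{U_1}p_{U_2}$, $X_k=x_k(U_k)$, let $Y$ be the channel output for the input $(X_1,X_2)$, and for $\boldsymbol b\in\mathbb F_q^2$ put $W_{\boldsymbol b}=b_1U_1\oplus b_2U_2$ and $I_{\mathsf{CF},k}(\boldsymbol b)=H(U_k)-H(W_{\boldsymbol b}|Y)$, $k=1,2$ (all logarithms to base 2). Let $$\mathcal R_{\mathsf{CF}}(\boldsymbol a)=\{(R_1,R_2): R_1<I_{\mathsf{CF},1}(\boldsymbol a),\ R_2<I_{\mathsf{CF},2}(\boldsymbol a)\}$$ and $\mathcal R_{\mathsf{LMAC}}=\mathcal R_{\mathsf{LMAC},1}\cup\mathcal R_{\mathsf{LMAC},2}$, where $\mathcal R_{\mathsf{LMAC},1}$ is the set of $(R_1,R_2)$ with $$R_1<\max_{\boldsymbol b\in\mathbb F_q^2\setminus\{\boldsymbol 0\}}\min\{I_{\mathsf{CF},1}(\boldsymbol b),\,I(X_1,X_2;Y)-I_{\mathsf{CF},2}(\boldsymbol b)\},\quad R_2<I(X_2;Y|X_1),\quad R_1+R_2<I(X_1,X_2;Y),$$ and $\mathcal R_{\mathsf{LMAC},2}$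 is the set of $(R_1,R_2)$ with $$R_1<I(X_1;Y|X_2),\quad R_2<\max_{\boldsymbol b\in\mathbb F_q^2\setminus\{\boldsymbol 0\}}\min\{I_{\mathsf{CF},2}(\boldsymbol b),\,I(X_1,X_2;Y)-I_{\mathsf{CF},1}(\boldsymbol b)\},\quad R_1+R_2<I(X_1,X_2;Y).$$ *Claim.* If $R_1,R_2\ge 0$ and $(R_1,R_2)\in\mathcal R_{\mathsf{CF}}(\boldsymbol a)\cup\mathcal R_{\mathsf{LMAC}}$ for some pmfs $p_{U_1},p_{U_2}$ and symbol maps $x_1,x_2$, then $(R_1,R_2)$ is achievable. Moreover it is achieved by nested linear codes with multicoding: there are auxiliary rates $\hat R_1,\hat R_2\ge 0$, an $\epsilon\in(0,1)$, and a sequence of codes with $P_e^{(n)}\to0$ such that, with $s_k=\lceil nR_k/\log_2 q\rceil$, $t_k=\lceil n\hat R_k/\log_2 q\rceil$ and $\kappa=\max_k(s_k+t_k)$, for all sufficiently large $n$ there are a matrix $\mathsf G\in\mathbb F_q^{\kappa\times n}$ common to both encoders, vectors $d_k^n\in\mathbb F_q^n$, one-to-one labellings $\boldsymbol\nu_k$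 of the messages by elements of $\mathbb F_q^{s_k}$ and choices $\boldsymbol l_k(m_k)\in\mathbb F_q^{t_k}$ with $$u_k^n(m_k)=[\boldsymbol\nu_k(m_k)\ \ \boldsymbol l_k(m_k)\ \ \boldsymbol 0]\,\mathsf G\oplus d_k^n,\qquad x_{ki}(m_k)=x_k(u_{ki}(m_k)),\quad i=1,\dots,n,$$ where $u_k^n(m_k)$ is $\epsilon$-typical for $p_{U_k}$ whenever some $\boldsymbol l\in\mathbb F_q^{t_k}$ makes $[\boldsymbol\nu_k(m_k)\ \boldsymbol l\ \boldsymbol 0]\mathsf G\oplus d_k^n$ $\epsilon$-typical for $p_{U_k}$. Here $u^n$ is $\epsilon$-typical for $p$ if $\bigl|\tfrac1n|\{i:u_i=v\}|-p(v)\bigr|\le\epsilon\,p(v)$ for all $v\in\mathbb F_q$. -/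

import Mathlib

open MeasureTheory ProbabilityTheory Filter Topology
open scoped ENNReal Matrix

noncomputable section

namespace ComputeForward

/-! ### Entropy and mutual information, in bits

`X` is a random variable with finitely many values, while the conditioning variable `Z` may take
values in any measurable space (for instance `ℝ`). -/

section Information

variable {Ω S T T' : Type*} [MeasurableSpace Ω] [MeasurableSpace T] [MeasurableSpace T']

/-- The entropy `H(X) = -∑ₓ P(X = x) log₂ P(X = x)`. -/
def entropy (μ : Measure Ω) (X : Ω → S) : ℝ :=
  (∑' x, Real.negMulLog (μ.real (X ⁻¹' {x}))) / Real.log 2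

/-- The conditional entropy `H(X | Z) = E[-∑ₓ P(X = x | Z) log₂ P(X = x | Z)]`. -/
def condEntropy (μ : Measure Ω) (X : Ω → S) (Z : Ω → T) : ℝ :=
  (∑' x, ∫ ω, Real.negMulLog ((μ⟦X ⁻¹' {x} | MeasurableSpace.comap Z inferInstance⟧) ω) ∂μ) /
    Real.log 2

/-- The mutual information `I(X; Z) = H(X) - H(X | Z)`. -/
def mutualInfo (μ : Measure Ω) (X : Ω → S) (Z : Ω → T) : ℝ :=
  entropy μ X - condEntropy μ X Z

/-- The conditional mutual information `I(X; Z | Z') = H(X | Z') - H(X | Z, Z')`. -/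
def condMutualInfo (μ : Measure Ω) (X : Ω → S) (Z : Ω → T) (Z' : Ω → T') : ℝ :=
  condEntropy μ X Z' - condEntropy μ X (fun ω => (Z ω, Z' ω))

end Information

/-! ### Codes for computing a linear combination over a two-user memoryless channel -/

section Codes

variable {F X₁ X₂ Y : Type*} [Field F] [MeasurableSpace F]
  [MeasurableSpace X₁] [MeasurableSpace X₂] [MeasurableSpace Y]

/-- The linear combination `a₁ u₁ ⊕ a₂ u₂` over `F`. -/
def linComb (a : Fin 2 → F) (u₁ u₂ : F) : F := a 0 * u₁ + a 1 * u₂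

/-- The number of messages in the message set `[2^{nR}]`. -/
def numMessages (R : ℝ) (n : ℕ) : ℕ := ⌈(2 : ℝ) ^ ((n : ℝ) * R)⌉₊

variable (F X₁ X₂ Y) in
/-- A compute-forward code of block length `n` with message sets of sizes `M₁`, `M₂`: encoder `k`
maps a message to a pair of sequences, the first one through a one-to-one map into `Fⁿ`; the decoder
estimates a sequence in `Fⁿ` from the received sequence. -/
structure Code (n M₁ M₂ : ℕ) where
  u₁ : Fin M₁ → Fin n → F
  u₂ : Fin M₂ → Fin n → F
  x₁ : Fin M₁ → Fin n → X₁
  x₂ : Fin M₂ → Fin n → X₂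
  dec : (Fin n → Y) → Fin n → F
  u₁_injective : Function.Injective u₁
  u₂_injective : Function.Injective u₂
  measurable_dec : Measurable dec

/-- The average probability, over independent uniform messages and `n` uses of the memoryless
channel `P`, that the decoder misses `a₁ u₁ⁿ(M₁) ⊕ a₂ u₂ⁿ(M₂)`. -/
def Code.errorProb {n M₁ M₂ : ℕ} (c : Code F X₁ X₂ Y n M₁ M₂) (P : Kernel (X₁ × X₂) Y)
    (a : Fin 2 → F) : ℝ :=
  (∑ m₁, ∑ m₂, (Measure.pi fun i => P (c.x₁ m₁ i, c.x₂ m₂ i)).real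
    {y | c.dec y ≠ fun i => linComb a (c.u₁ m₁ i) (c.u₂ m₂ i)}) / ((M₁ : ℝ) * (M₂ : ℝ))

/-- `(R₁, R₂)` is achievable for recovering the linear combination with coefficients `a`. -/
def Achievable (P : Kernel (X₁ × X₂) Y) (a : Fin 2 → F) (R₁ R₂ : ℝ) : Prop :=
  ∃ c : ∀ n : ℕ, Code F X₁ X₂ Y n (numMessages R₁ n) (numMessages R₂ n),
    Tendsto (fun n => (c n).errorProb P a) atTop (𝓝 0)

end Codes

/-! ### Nested linear codes with multicoding -/

section Nested

variable {F : Type*} [Field F] [Fintype F] [DecidableEq F]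

/-- The set of `ε`-typical sequences: `|π(v | u) - p(v)| ≤ ε p(v)` for all `v`, where `π(· | u)` is
the empirical distribution of `u`. -/
def typicalSet (p : PMF F) (ε : ℝ) (n : ℕ) : Set (Fin n → F) :=
  {u | ∀ v, |((Finset.univ.filter fun i => u i = v).card : ℝ) / n - (p v).toReal| ≤
    ε * (p v).toReal}

variable (F) in
/-- The length `⌈nR / log₂ q⌉` of the `q`-ary expansion of an index in `[2^{nR}]`. -/
def expansionLength (R : ℝ) (n : ℕ) : ℕ := ⌈(n : ℝ) * R / Real.logb 2 (Fintype.card F)⌉₊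

/-- The concatenation `[v, l, 0]`, of length `κ`. -/
def padConcat {s t : ℕ} (κ : ℕ) (v : Fin s → F) (l : Fin t → F) : Fin κ → F := fun i =>
  if h : (i : ℕ) < s then v ⟨i, h⟩
  else if h' : (i : ℕ) - s < t then l ⟨(i : ℕ) - s, h'⟩
  else 0

/-- The linear codeword `[v, l, 0] G ⊕ d`. -/
def codeword {s t κ n : ℕ} (G : Matrix (Fin κ) (Fin n) F) (d : Fin n → F)
    (v : Fin s → F) (l : Fin t → F) : Fin n → F :=
  padConcat κ v l ᵥ* G + d

/-- `u` arises from the generator matrix `G` and a dither `d` by multicoding with target pmf `p`: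
messages are labelled by vectors of length `s`, auxiliary indices are the vectors of length `t`, and
each message is encoded by a codeword `[ν(m), l(m), 0] G ⊕ d` that is `ε`-typical for `p` whenever
some auxiliary index yields an `ε`-typical codeword. -/
def IsMulticoded {n M κ : ℕ} (s t : ℕ) (p : PMF F) (ε : ℝ) (G : Matrix (Fin κ) (Fin n) F)
    (u : Fin M → Fin n → F) : Prop :=
  ∃ (d : Fin n → F) (ν : Fin M → Fin s → F) (l : Fin M → Fin t → F),
    Function.Injective ν ∧
    (∀ m, u m = codeword G d (ν m) (l m)) ∧
    ∀ m, (∃ l', codeword G d (ν m) (l' : Fin t → F) ∈ typicalSet p ε n) → u m ∈ typicalSet p ε n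

variable {X₁ X₂ Y : Type*} [MeasurableSpace F] [MeasurableSpace Y]

/-- The code is a nested linear code with rates `R₁, R₂`, auxiliary rates `Q₁, Q₂`, one generator
matrix shared by the two encoders, multicoding towards the pmfs `p₁, p₂` with typicality parameter
`ε`, and symbol maps `x₁, x₂`. -/
def Code.IsNestedLinear {n M₁ M₂ : ℕ} (c : Code F X₁ X₂ Y n M₁ M₂) (R₁ R₂ Q₁ Q₂ ε : ℝ)
    (p₁ p₂ : PMF F) (x₁ : F → X₁) (x₂ : F → X₂) : Prop :=
  (∃ G : Matrix
      (Fin (max (expansionLength F R₁ n + expansionLength F Q₁ n)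
        (expansionLength F R₂ n + expansionLength F Q₂ n))) (Fin n) F,
    IsMulticoded (expansionLength F R₁ n) (expansionLength F Q₁ n) p₁ ε G c.u₁ ∧
    IsMulticoded (expansionLength F R₂ n) (expansionLength F Q₂ n) p₂ ε G c.u₂) ∧
  (∀ m i, c.x₁ m i = x₁ (c.u₁ m i)) ∧
  (∀ m i, c.x₂ m i = x₂ (c.u₂ m i))

/-- `(R₁, R₂)` is achieved by a sequence of codes which are, from some block length on, nested
linear codes with fixed auxiliary rates and typicality parameter. -/
def AchievableByNestedLinear [MeasurableSpace X₁] [MeasurableSpace X₂]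
    (P : Kernel (X₁ × X₂) Y) (a : Fin 2 → F) (p₁ p₂ : PMF F) (x₁ : F → X₁) (x₂ : F → X₂)
    (R₁ R₂ : ℝ) : Prop :=
  ∃ Q₁ Q₂ ε : ℝ, 0 ≤ Q₁ ∧ 0 ≤ Q₂ ∧ 0 < ε ∧ ε < 1 ∧
    ∃ c : ∀ n : ℕ, Code F X₁ X₂ Y n (numMessages R₁ n) (numMessages R₂ n),
      (∀ᶠ n in atTop, (c n).IsNestedLinear R₁ R₂ Q₁ Q₂ ε p₁ p₂ x₁ x₂) ∧
      Tendsto (fun n => (c n).errorProb P a) atTop (𝓝 0)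

end Nested

/-! ### The rate regions -/

section Regions

variable {F X₁ X₂ Y : Type*} [Field F] [Finite F] [MeasurableSpace F] [DiscreteMeasurableSpace F]
  [MeasurableSpace X₁] [MeasurableSpace X₂] [MeasurableSpace Y]

/-- The joint law of `((U₁, U₂), Y)`, where `(U₁, U₂) ∼ p₁ × p₂` and `Y` is the output of the
channel `P` for the inputs `x₁(U₁)`, `x₂(U₂)`. -/
def jointLaw (P : Kernel (X₁ × X₂) Y) (p₁ p₂ : PMF F) (x₁ : F → X₁) (x₂ : F → X₂) :
    Measure ((F × F) × Y) :=
  (p₁.toMeasure.prod p₂.toMeasure) ⊗ₘ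
    (P.comap (fun u : F × F => (x₁ u.1, x₂ u.2)) Measurable.of_discrete)

/-- `I_{CF,1}(a) = H(U₁) - H(W_a | Y)`, for a joint law `μ` of `((U₁, U₂), Y)`. -/
def iCF₁ (μ : Measure ((F × F) × Y)) (a : Fin 2 → F) : ℝ :=
  entropy μ (fun ω => ω.1.1) - condEntropy μ (fun ω => linComb a ω.1.1 ω.1.2) (fun ω => ω.2)

/-- `I_{CF,2}(a) = H(U₂) - H(W_a | Y)`, for a joint law `μ` of `((U₁, U₂), Y)`. -/
def iCF₂ (μ : Measure ((F × F) × Y)) (a : Fin 2 → F) : ℝ :=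
  entropy μ (fun ω => ω.1.2) - condEntropy μ (fun ω => linComb a ω.1.1 ω.1.2) (fun ω => ω.2)

/-- The region for decoding the linear combination directly. -/
def regionCF (μ : Measure ((F × F) × Y)) (a : Fin 2 → F) : Set (ℝ × ℝ) :=
  {R | R.1 < iCF₁ μ a ∧ R.2 < iCF₂ μ a}

/-- `I(X₁, X₂; Y)` with `X₁ = x₁(U₁)` and `X₂ = x₂(U₂)`. -/
def sumInfo (μ : Measure ((F × F) × Y)) (x₁ : F → X₁) (x₂ : F → X₂) : ℝ :=
  mutualInfo μ (fun ω => (x₁ ω.1.1, x₂ ω.1.2)) (fun ω => ω.2)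

/-- The first part of the region for multiple access with a shared linear codebook. -/
def regionLMAC₁ (μ : Measure ((F × F) × Y)) (x₁ : F → X₁) (x₂ : F → X₂) : Set (ℝ × ℝ) :=
  {R | R.1 < (⨆ b : {b : Fin 2 → F // b ≠ 0}, min (iCF₁ μ b) (sumInfo μ x₁ x₂ - iCF₂ μ b)) ∧
    R.2 < condMutualInfo μ (fun ω => x₂ ω.1.2) (fun ω => ω.2) (fun ω => x₁ ω.1.1) ∧
    R.1 + R.2 < sumInfo μ x₁ x₂}

/-- The second part of the region for multiple access with a shared linear codebook. -/
def regionLMAC₂ (μ : Measure ((F × F) × Y)) (x₁ : F → X₁) (x₂ : F → X₂) : Set (ℝ × ℝ) :=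
  {R | R.1 < condMutualInfo μ (fun ω => x₁ ω.1.1) (fun ω => ω.2) (fun ω => x₂ ω.1.2) ∧
    R.2 < (⨆ b : {b : Fin 2 → F // b ≠ 0}, min (iCF₂ μ b) (sumInfo μ x₁ x₂ - iCF₁ μ b)) ∧
    R.1 + R.2 < sumInfo μ x₁ x₂}

/-- The region for multiple access with a shared linear codebook. -/
def regionLMAC (μ : Measure ((F × F) × Y)) (x₁ : F → X₁) (x₂ : F → X₂) : Set (ℝ × ℝ) :=
  regionLMAC₁ μ x₁ x₂ ∪ regionLMAC₂ μ x₁ x₂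

end Regions

end ComputeForward

end

set_option linter.unusedSectionVars false

/-! The proof is random coding: one uniformly random matrix `G` shared by the users and two
independent uniform dithers. Every codeword is then uniform on `Fⁿ`, and two codewords of one user
with different indices are independent, so a second moment argument
(`card_forall_codeword_notMem_le`) shows that multicoding finds a typical codeword once the
auxiliary rate exceeds `log q - H(U_k)`.

The codeword that is sent depends on the codebook. This is avoided by bounding the error by a sum
over all auxiliary indices (`real_testDecoder_ne_le`): for fixed indices the dithers make the pair
of codewords uniform and independent of `G`, while the competitors differ from the pair by `(δ₁G,
δ₂G)`, which involves `G` only. With auxiliary rates at most `γ` above the threshold the sum costs a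
factor of order `exp(4nγ)`, which is beaten by every error exponent when `γ` is small.

Competitors are counted as follows. When only the combination `W_a` is tested, linearity leaves at
most `q^κ` competing sequences; each is uniform, and about `exp(n H(W_a|Y))` sequences pass the
test. This gives `R_k < I_{CF,k}(a)` (`sum_confusionSet_comb_le`). When the pair is decoded,
linearly independent differences `δ₁, δ₂` give a uniform pair and the sum rate condition. If `b₀δ₁ +
b₁δ₂ = 0` with `b ≠ 0`, the competitor agrees with the truth in `W_b` and is uniform on a line, one
difference determines the other, and about `exp(n H(U₁,U₂|Y,W_b))` points of the line pass
(`sum_confusionSet_pair_le`). The resulting conditions, one for each `b`, are `DecodablePair`. A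
single `b` in the maximum defining the LMAC region suffices for all of them, since `H(U₁,U₂|Y) ≤
H(W_b|Y) + H(W_c|Y)` for non-proportional `b, c` (`classEntropy_id_sub_le`).

To allow continuous outputs, the tests compare posterior probabilities of the auxiliary symbols
given the output. Their logarithms have exponential moments because `E[1 / P(g(U)|Y)]` is at most
the size of the finite alphabet, so Chernoff bounds apply without any density for the channel. -/

noncomputable section

namespace ComputeForward

/-! ### Posterior probabilities and conditional entropy given the output. -/

section Posterior

variable {α Y T T' : Type*} [Fintype α] [Nonempty α] [MeasurableSpace α]
  [DiscreteMeasurableSpace α] [MeasurableSpace Y]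

/-- The conditional distribution of the first coordinate given the second one. -/
def posterior (μ : Measure (α × Y)) [IsFiniteMeasure μ] : Kernel Y α :=
  condDistrib Prod.fst Prod.snd μ

instance (μ : Measure (α × Y)) [IsFiniteMeasure μ] : IsMarkovKernel (posterior μ) := by
  unfold posterior; infer_instance

/-- The posterior probability, given `y`, of the fibre of `g` through `u`. -/
def classProb (μ : Measure (α × Y)) [IsFiniteMeasure μ] (g : α → T) (u : α) (y : Y) : ℝ :=
  (posterior μ y).real (g ⁻¹' {g u})

/-- The conditional entropy in nats of `g` of the first coordinate given the second one. -/
def classEntropy (μ : Measure (α × Y)) [IsFiniteMeasure μ] (g : α → T) : ℝ :=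
  ∫ ω, -Real.log (classProb μ g ω.1 ω.2) ∂μ

variable (μ : Measure (α × Y)) [IsFiniteMeasure μ]

lemma measurable_posterior_real (s : Set α) : Measurable fun y => (posterior μ y).real s :=
  ((posterior μ).measurable_coe (MeasurableSet.of_discrete)).ennreal_toReal

lemma measurable_classProb (g : α → T) (u : α) : Measurable (classProb μ g u) :=
  measurable_posterior_real μ _

lemma classProb_nonneg (g : α → T) (u : α) (y : Y) : 0 ≤ classProb μ g u y := measureReal_nonneg

lemma classProb_le_one (g : α → T) (u : α) (y : Y) : classProb μ g u y ≤ 1 := measureReal_le_one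

lemma posterior_singleton_le_classProb (g : α → T) (u : α) (y : Y) :
    (posterior μ y).real {u} ≤ classProb μ g u y :=
  measureReal_mono (by simp)

lemma classProb_id (u : α) (y : Y) : classProb μ id u y = (posterior μ y).real {u} := rfl

lemma classProb_congr {g : α → T} {k : α → T'} (h : ∀ u v, g u = g v ↔ k u = k v) (u : α) (y : Y) :
    classProb μ g u y = classProb μ k u y := by
  unfold classProb
  congr 1
  ext v
  simpa using h v u

lemma classEntropy_congr {g : α → T} {k : α → T'} (h : ∀ u v, g u = g v ↔ k u = k v) :
    classEntropy μ g = classEntropy μ k := by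
  simp only [classEntropy, classProb_congr μ h]

lemma classProb_le_of_factor {g : α → T} {k : α → T'} (h : ∀ u v, g u = g v → k u = k v) (u : α)
    (y : Y) : classProb μ g u y ≤ classProb μ k u y :=
  measureReal_mono fun v hv => h v u hv

lemma measurable_of_forall_left {β : Type*} [MeasurableSpace β] {f : α × Y → β}
    (hf : ∀ u, Measurable fun y => f (u, y)) : Measurable f :=
  measurable_from_prod_countable_right hf

lemma sum_posterior_mul_comp {g : α → T} [DecidableEq T] (y : Y) (f : T → ℝ) :
    ∑ u, (posterior μ y).real {u} * f (g u) =
      ∑ t ∈ Finset.univ.image g, (posterior μ y).real (g ⁻¹' {t}) * f t := by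
  classical
  rw [← Finset.sum_fiberwise_of_maps_to (s := Finset.univ) (t := Finset.univ.image g) (g := g)
    (fun u _ => Finset.mem_image_of_mem _ (Finset.mem_univ u))]
  refine Finset.sum_congr rfl fun t _ => ?_
  have h : (g ⁻¹' {t} : Set α) = ((Finset.univ.filter fun u => g u = t : Finset α) : Set α) := by
    ext u; simp
  rw [h, ← sum_measureReal_singleton, Finset.sum_mul]
  refine Finset.sum_congr rfl fun u hu => ?_
  rw [(Finset.mem_filter.1 hu).2]

lemma sum_posterior (y : Y) : ∑ u, (posterior μ y).real {u} = 1 := by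
  rw [sum_measureReal_singleton]; simp

/-- Disintegration: given the second coordinate, the first one is averaged under the posterior.
Integrals over the joint law thereby become finite sums for each output. -/
lemma lintegral_eq_lintegral_posterior {f : α → Y → ℝ≥0∞} (hf : ∀ u, Measurable (f u)) :
    ∫⁻ ω, f ω.1 ω.2 ∂μ = ∫⁻ ω, ∑ u, posterior μ ω.2 {u} * f u ω.2 ∂μ := by
  have hF : Measurable fun z : Y × α => f z.2 z.1 :=
    measurable_from_prod_countable_left hf
  have h := compProd_map_condDistrib (mβ := inferInstance) (μ := μ) (X := Prod.snd) (Y := Prod.fst)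
    measurable_fst.aemeasurable
  have h1 : ∫⁻ ω, f ω.1 ω.2 ∂μ =
      ∫⁻ z, f z.2 z.1 ∂(μ.map fun a : α × Y => (Prod.snd a, Prod.fst a)) := by
    rw [lintegral_map hF (by fun_prop)]
  rw [h1, ← h, Measure.lintegral_compProd hF, lintegral_map _ measurable_snd]
  · simp only [lintegral_fintype, posterior, mul_comm]
  · exact hF.lintegral_kernel_prod_right'

lemma integral_eq_integral_posterior {f : α → Y → ℝ}
    (hf : ∀ u, Measurable (f u)) (hi : Integrable (fun ω : α × Y => f ω.1 ω.2) μ) :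
    ∫ ω, f ω.1 ω.2 ∂μ = ∫ ω, ∑ u, (posterior μ ω.2).real {u} * f u ω.2 ∂μ := by
  have hF : Measurable fun z : Y × α => f z.2 z.1 := measurable_from_prod_countable_left hf
  have h := compProd_map_condDistrib (mβ := inferInstance) (μ := μ) (X := Prod.snd) (Y := Prod.fst)
    measurable_fst.aemeasurable
  have hm : Measurable fun a : α × Y => (Prod.snd a, Prod.fst a) := by fun_prop
  have h1 : ∫ ω, f ω.1 ω.2 ∂μ =
      ∫ z, f z.2 z.1 ∂(μ.map fun a : α × Y => (Prod.snd a, Prod.fst a)) := by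
    rw [integral_map hm.aemeasurable hF.aestronglyMeasurable]
  have hi' : Integrable (fun z : Y × α => f z.2 z.1)
      (μ.map fun a : α × Y => (Prod.snd a, Prod.fst a)) := by
    rw [integrable_map_measure hF.aestronglyMeasurable hm.aemeasurable]; exact hi
  rw [h1, ← h, Measure.integral_compProd (h.symm ▸ hi'), integral_map measurable_snd.aemeasurable]
  · refine integral_congr_ae (Eventually.of_forall fun ω => ?_)
    simp only [integral_fintype .of_finite, posterior, smul_eq_mul]
  · simp only [integral_fintype .of_finite, smul_eq_mul]
    refine (Finset.measurable_sum _ fun u _ => ?_).aestronglyMeasurable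
    exact (measurable_posterior_real μ {u}).mul (hf u)

/-- The probability of drawing a symbol of zero posterior is the mean of `∑ u, P(u|y) · 1{P(u|y) =
0}`, which vanishes termwise. Logarithms of posteriors are therefore meaningful almost everywhere.
-/
lemma ae_posterior_singleton_pos : ∀ᵐ ω ∂μ, 0 < (posterior μ ω.2).real {ω.1} := by
  have hm : ∀ u, MeasurableSet {y | (posterior μ y).real {u} = 0} := fun u =>
    (measurable_posterior_real μ {u}) (measurableSet_singleton 0)
  have h := lintegral_eq_lintegral_posterior μ
    (f := fun u y => {y | (posterior μ y).real {u} = 0}.indicator 1 y)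
    (fun u => measurable_one.indicator (hm u))
  have hz : ∀ ω : α × Y, ∑ u, posterior μ ω.2 {u} *
      {y | (posterior μ y).real {u} = 0}.indicator (1 : Y → ℝ≥0∞) ω.2 = 0 := by
    intro ω
    refine Finset.sum_eq_zero fun u _ => ?_
    by_cases hu : (posterior μ ω.2).real {u} = 0
    · have : posterior μ ω.2 {u} = 0 := by
        rwa [measureReal_eq_zero_iff] at hu
      rw [this, zero_mul]
    · rw [Set.indicator_of_notMem (by simpa using hu), mul_zero]
  rw [lintegral_congr hz, lintegral_zero, lintegral_eq_zero_iff] at h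
  · filter_upwards [h] with ω hω
    refine lt_of_le_of_ne measureReal_nonneg fun h0 => ?_
    simp [Set.indicator, ← h0] at hω
  · exact measurable_of_forall_left fun u => measurable_one.indicator (hm u)

lemma ae_classProb_pos (g : α → T) : ∀ᵐ ω ∂μ, 0 < classProb μ g ω.1 ω.2 := by
  filter_upwards [ae_posterior_singleton_pos μ] with ω h
  exact h.trans_le (posterior_singleton_le_classProb μ g ω.1 ω.2)

lemma measurable_classProb_uncurry (g : α → T) :
    Measurable fun ω : α × Y => classProb μ g ω.1 ω.2 :=
  measurable_of_forall_left fun u => measurable_classProb μ g u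

/-- Given `y`, the mean of `1 / P(g(U)|y)` is `∑ u, P(u|y) / P(g(u)|y)`, at most the number of
symbols. This one bound yields both the integrability of the log posteriors and the exponential
moments used in the Chernoff bounds. -/
lemma integrable_inv_classProb (g : α → T) :
    Integrable (fun ω : α × Y => (classProb μ g ω.1 ω.2)⁻¹) μ := by
  refine ⟨(measurable_classProb_uncurry μ g).inv.aestronglyMeasurable, ?_⟩
  have he : ∀ ω : α × Y, ‖(classProb μ g ω.1 ω.2)⁻¹‖ₑ =
      ENNReal.ofReal (classProb μ g ω.1 ω.2)⁻¹ := fun ω =>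
    Real.enorm_of_nonneg (inv_nonneg.2 (classProb_nonneg _ _ _ _))
  rw [HasFiniteIntegral, lintegral_congr he, lintegral_eq_lintegral_posterior μ
    (f := fun u y => ENNReal.ofReal (classProb μ g u y)⁻¹)
    (fun u => (measurable_classProb μ g u).inv.ennreal_ofReal)]
  calc _ ≤ ∫⁻ _ : α × Y, (Fintype.card α : ℝ≥0∞) ∂μ := by
        refine lintegral_mono fun ω => ?_
        calc _ ≤ ∑ _u : α, (1 : ℝ≥0∞) := Finset.sum_le_sum fun u _ => ?_
          _ = _ := by simp
        rw [← ofReal_measureReal, ← ENNReal.ofReal_mul measureReal_nonneg,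
          ← ENNReal.ofReal_one]
        refine ENNReal.ofReal_le_ofReal ?_
        calc _ ≤ classProb μ g u ω.2 * (classProb μ g u ω.2)⁻¹ :=
              mul_le_mul_of_nonneg_right (posterior_singleton_le_classProb μ g u ω.2)
                (inv_nonneg.2 (classProb_nonneg _ _ _ _))
          _ ≤ 1 := mul_inv_le_one
    _ < ∞ := by
      rw [lintegral_const]
      exact ENNReal.mul_lt_top (by simp) (measure_lt_top _ _)

lemma integrable_log_classProb (g : α → T) :
    Integrable (fun ω : α × Y => Real.log (classProb μ g ω.1 ω.2)) μ := by
  refine (integrable_inv_classProb μ g).mono'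
    (measurable_classProb_uncurry μ g).log.aestronglyMeasurable ?_
  filter_upwards [ae_classProb_pos μ g] with ω h
  rw [Real.norm_of_nonpos (Real.log_nonpos h.le (classProb_le_one μ g ω.1 ω.2)), ← Real.log_inv]
  exact (Real.log_le_sub_one_of_pos (inv_pos.2 h)).trans (by linarith)

/-- Given `y`, averaging `-log P(g(U)|y)` over `U` and grouping by fibres produces the sum of
`negMulLog`. The `tsum` reduces to the image of `g`, since all other fibres are empty. -/
lemma condEntropy_snd_mul_log_two [IsProbabilityMeasure μ] (g : α → T) :
    condEntropy μ (fun ω => g ω.1) (fun ω => ω.2) * Real.log 2 = classEntropy μ g := by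
  classical
  rw [condEntropy, div_mul_cancel₀ _ (Real.log_pos one_lt_two).ne', classEntropy]
  have h1 : ∀ t, (∫ ω, Real.negMulLog
      ((μ⟦(fun ω : α × Y => g ω.1) ⁻¹' {t} | MeasurableSpace.comap (fun ω => ω.2) inferInstance⟧) ω) ∂μ) =
      ∫ ω : α × Y, Real.negMulLog ((posterior μ ω.2).real (g ⁻¹' {t})) ∂μ := by
    intro t
    refine integral_congr_ae ?_
    have := condDistrib_ae_eq_condExp (μ := μ) (X := Prod.snd) (Y := Prod.fst) measurable_snd
      measurable_fst (MeasurableSet.of_discrete (s := g ⁻¹' {t}))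
    filter_upwards [this] with ω hω
    exact congrArg Real.negMulLog hω.symm
  simp_rw [h1]
  rw [tsum_eq_sum (s := Finset.univ.image g), ← integral_finsetSum,
    integral_eq_integral_posterior μ (f := fun u y => -Real.log (classProb μ g u y))
      (fun u => (measurable_classProb μ g u).log.neg) (integrable_log_classProb μ g).neg]
  · refine integral_congr_ae (Eventually.of_forall fun ω => ?_)
    have := sum_posterior_mul_comp μ (g := g) ω.2
      (fun t => -Real.log ((posterior μ ω.2).real (g ⁻¹' {t})))
    simp only [classProb]
    rw [this]
    simp [Real.negMulLog]
  · intro t _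
    refine Integrable.mono' (integrable_const (1 : ℝ))
      (Real.continuous_negMulLog.measurable.comp
        ((measurable_posterior_real μ _).comp measurable_snd)).aestronglyMeasurable
      (Eventually.of_forall fun ω => ?_)
    set p := (posterior μ ω.2).real (g ⁻¹' {t})
    have hp0 : 0 ≤ p := measureReal_nonneg
    have hp1 : p ≤ 1 := measureReal_le_one
    rw [Real.norm_of_nonneg (Real.negMulLog_nonneg hp0 hp1)]
    have := Real.negMulLog_le_one_sub_self hp0
    linarith
  · intro t ht
    have : g ⁻¹' {t} = ∅ := by
      ext u
      simp only [Set.mem_preimage, Set.mem_singleton_iff, Set.mem_empty_iff_false, iff_false]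
      rintro rfl
      exact ht (Finset.mem_image_of_mem _ (Finset.mem_univ u))
    simp [this]

end Posterior

/-! ### Chain rule for the conditional entropy. -/

section Chain

variable {α Y T T' : Type*} [Fintype α] [Nonempty α] [MeasurableSpace α]
  [DiscreteMeasurableSpace α] [MeasurableSpace Y]

lemma sum_real_singleton_mul_comp [DecidableEq T] (m : Measure α) [IsFiniteMeasure m] (g : α → T)
    (f : T → ℝ) :
    ∑ u, m.real {u} * f (g u) = ∑ t ∈ Finset.univ.image g, m.real (g ⁻¹' {t}) * f t := by
  classical
  rw [← Finset.sum_fiberwise_of_maps_to (s := Finset.univ) (t := Finset.univ.image g) (g := g)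
    (fun u _ => Finset.mem_image_of_mem _ (Finset.mem_univ u))]
  refine Finset.sum_congr rfl fun t _ => ?_
  have h : (g ⁻¹' {t} : Set α) = ((Finset.univ.filter fun u => g u = t : Finset α) : Set α) := by
    ext u; simp
  rw [h, ← sum_measureReal_singleton, Finset.sum_mul]
  refine Finset.sum_congr rfl fun u hu => ?_
  rw [(Finset.mem_filter.1 hu).2]

lemma sum_real_singleton_mul_ite_comp [DecidableEq T] [DecidableEq T'] (m : Measure α)
    [IsFiniteMeasure m] (g : α → T) (k : α → T') (t : T) (f : T' → ℝ) :
    ∑ u, m.real {u} * ((if g u = t then 1 else 0) * f (k u)) =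
      ∑ r ∈ Finset.univ.image k, m.real (g ⁻¹' {t} ∩ k ⁻¹' {r}) * f r := by
  have h := sum_real_singleton_mul_comp (m.restrict (g ⁻¹' {t})) k f
  simp only [measureReal_restrict_apply (MeasurableSet.of_discrete)] at h
  simp only [Set.inter_comm (g ⁻¹' {t})]
  rw [← h]
  refine Finset.sum_congr rfl fun u _ => ?_
  by_cases hu : g u = t
  · rw [Set.inter_eq_left.2 (by simpa using hu)]; simp [hu]
  · have : ({u} ∩ g ⁻¹' {t} : Set α) = ∅ := by
      ext v
      simp only [Set.mem_inter_iff, Set.mem_singleton_iff, Set.mem_preimage,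
        Set.mem_empty_iff_false, iff_false, not_and]
      rintro rfl; exact hu
    rw [this]; simp [hu]

/-- Both sides equal the sum over `(t, r)` of `-P(t,r) log (P(t,r) / P(r))`; where `P(r) = 0` the
joint mass vanishes too, so the convention for division by zero is harmless. -/
lemma sum_negMulLog_ratio [DecidableEq T] [DecidableEq T'] (m : Measure α) [IsFiniteMeasure m]
    (g : α → T) (k : α → T') :
    ∑ u, m.real {u} * ∑ t ∈ Finset.univ.image g,
        Real.negMulLog (m.real (g ⁻¹' {t} ∩ k ⁻¹' {k u}) / m.real (k ⁻¹' {k u})) =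
      ∑ u, m.real {u} *
        -Real.log (m.real (g ⁻¹' {g u} ∩ k ⁻¹' {k u}) / m.real (k ⁻¹' {k u})) := by
  rw [sum_real_singleton_mul_comp m k (fun r => ∑ t ∈ Finset.univ.image g,
        Real.negMulLog (m.real (g ⁻¹' {t} ∩ k ⁻¹' {r}) / m.real (k ⁻¹' {r})))]
  have h : ∀ u, m.real {u} *
        -Real.log (m.real (g ⁻¹' {g u} ∩ k ⁻¹' {k u}) / m.real (k ⁻¹' {k u})) =
      ∑ t ∈ Finset.univ.image g, m.real {u} * ((if g u = t then 1 else 0) *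
        -Real.log (m.real (g ⁻¹' {t} ∩ k ⁻¹' {k u}) / m.real (k ⁻¹' {k u}))) := by
    intro u
    rw [Finset.sum_eq_single (g u)]
    · simp
    · intro t _ ht; simp [Ne.symm ht]
    · intro hu; exact absurd (Finset.mem_image_of_mem _ (Finset.mem_univ u)) hu
  simp_rw [h]
  rw [Finset.sum_comm]
  simp_rw [fun t => sum_real_singleton_mul_ite_comp m g k t (fun r =>
    -Real.log (m.real (g ⁻¹' {t} ∩ k ⁻¹' {r}) / m.real (k ⁻¹' {r}))), Finset.mul_sum]
  rw [Finset.sum_comm]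
  refine Finset.sum_congr rfl fun t _ => Finset.sum_congr rfl fun r _ => ?_
  have hle : m.real (g ⁻¹' {t} ∩ k ⁻¹' {r}) ≤ m.real (k ⁻¹' {r}) :=
    measureReal_mono Set.inter_subset_right
  rcases eq_or_ne (m.real (k ⁻¹' {r})) 0 with h0 | h0
  · have : m.real (g ⁻¹' {t} ∩ k ⁻¹' {r}) = 0 := le_antisymm (h0 ▸ hle) measureReal_nonneg
    simp [h0, this]
  · rw [Real.negMulLog]; field_simp

variable (μ : Measure (α × Y)) [IsProbabilityMeasure μ]

/-- The conditional probability of `g = t` given `y` and the class of `u` under `k`. -/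
def classRatio (g : α → T) (k : α → T') (t : T) (u : α) (y : Y) : ℝ :=
  (posterior μ y).real (g ⁻¹' {t} ∩ k ⁻¹' {k u}) / classProb μ k u y

lemma measurable_classRatio (g : α → T) (k : α → T') (t : T) (u : α) :
    Measurable (classRatio μ g k t u) :=
  (measurable_posterior_real μ _).div (measurable_classProb μ k u)

lemma classRatio_nonneg (g : α → T) (k : α → T') (t : T) (u : α) (y : Y) :
    0 ≤ classRatio μ g k t u y := div_nonneg measureReal_nonneg measureReal_nonneg

lemma classRatio_le_one (g : α → T) (k : α → T') (t : T) (u : α) (y : Y) :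
    classRatio μ g k t u y ≤ 1 :=
  div_le_one_of_le₀ (measureReal_mono Set.inter_subset_right) measureReal_nonneg

/-- This is Bayes' rule. On an event `(Y, k(U)) ∈ E`, both sides integrate, given `y`, to the sum of
`P(g = t, k = r | y)` over those `r` with `(y, r) ∈ E`. -/
lemma classRatio_ae_eq_condExp [MeasurableSpace T'] [MeasurableSingletonClass T'] (g : α → T)
    (k : α → T') (t : T) :
    (fun ω => classRatio μ g k t ω.1 ω.2) =ᵐ[μ]
      μ⟦(fun ω => g ω.1) ⁻¹' {t} |
        MeasurableSpace.comap (fun ω => (ω.2, k ω.1)) inferInstance⟧ := by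
  classical
  have hZ : Measurable fun ω : α × Y => (ω.2, k ω.1) :=
    measurable_snd.prodMk (Measurable.of_discrete.comp measurable_fst)
  have hg : MeasurableSet ((fun ω : α × Y => g ω.1) ⁻¹' {t}) :=
    measurable_fst (MeasurableSet.of_discrete (s := g ⁻¹' {t}))
  have hR : Measurable fun ω : α × Y => classRatio μ g k t ω.1 ω.2 :=
    measurable_of_forall_left fun u => measurable_classRatio μ g k t u
  have hRi : Integrable (fun ω : α × Y => classRatio μ g k t ω.1 ω.2) μ :=
    Integrable.mono' (integrable_const (1 : ℝ)) hR.aestronglyMeasurable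
      (Eventually.of_forall fun ω => by
        rw [Real.norm_of_nonneg (classRatio_nonneg μ g k t ω.1 ω.2)]
        exact classRatio_le_one μ g k t ω.1 ω.2)
  refine ae_eq_condExp_of_forall_setIntegral_eq hZ.comap_le
    ((integrable_const _).indicator hg) (fun s _ _ => hRi.integrableOn) ?_ ?_
  · rintro _ ⟨E, hE, rfl⟩ _
    have hD := hZ hE
    have hEu : ∀ u, MeasurableSet {y : Y | (y, k u) ∈ E} := fun u =>
      (measurable_id.prodMk measurable_const) hE
    rw [← integral_indicator hD, ← integral_indicator hD]
    have e1 := integral_eq_integral_posterior μ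
      (f := fun u y => {y : Y | (y, k u) ∈ E}.indicator (classRatio μ g k t u) y)
      (fun u => (measurable_classRatio μ g k t u).indicator (hEu u))
      (hRi.indicator hD)
    have e2 := integral_eq_integral_posterior μ
      (f := fun u y => {y : Y | (y, k u) ∈ E}.indicator
        (fun _ => if g u = t then (1 : ℝ) else 0) y)
      (fun u => measurable_const.indicator (hEu u))
      (by
        refine (((integrable_const (1 : ℝ)).indicator hg).indicator hD).congr
          (Eventually.of_forall fun ω => ?_)
        simp only [Set.indicator, Set.mem_preimage, Set.mem_ofPred_eq, Set.mem_singleton_iff])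
    refine Eq.trans ?_ (e1.trans (Eq.trans ?_ (e2.symm.trans ?_)))
    · rfl
    · refine integral_congr_ae (Eventually.of_forall ?_)
      rintro ⟨-, y⟩
      dsimp only
      have h1 := sum_real_singleton_mul_comp (posterior μ y) k (fun r =>
        (if (y, r) ∈ E then (1 : ℝ) else 0) *
        ((posterior μ y).real (g ⁻¹' {t} ∩ k ⁻¹' {r}) / (posterior μ y).real (k ⁻¹' {r})))
      have h2 := sum_real_singleton_mul_ite_comp (posterior μ y) g k t
        (fun r => if (y, r) ∈ E then (1 : ℝ) else 0)
      have h3 : ∀ r, (posterior μ y).real (k ⁻¹' {r}) * ((if (y, r) ∈ E then (1 : ℝ) else 0) *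
          ((posterior μ y).real (g ⁻¹' {t} ∩ k ⁻¹' {r}) / (posterior μ y).real (k ⁻¹' {r}))) =
          (posterior μ y).real (g ⁻¹' {t} ∩ k ⁻¹' {r}) * (if (y, r) ∈ E then (1 : ℝ) else 0) := by
        intro r
        have hle : (posterior μ y).real (g ⁻¹' {t} ∩ k ⁻¹' {r}) ≤ (posterior μ y).real (k ⁻¹' {r}) :=
          measureReal_mono Set.inter_subset_right
        rcases eq_or_ne ((posterior μ y).real (k ⁻¹' {r})) 0 with h0 | h0
        · have : (posterior μ y).real (g ⁻¹' {t} ∩ k ⁻¹' {r}) = 0 :=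
            le_antisymm (h0 ▸ hle) measureReal_nonneg
          simp [h0, this]
        · field_simp
      simp_rw [h3] at h1
      refine Eq.trans (Finset.sum_congr rfl fun u _ => ?_)
        ((h1.trans h2.symm).trans (Finset.sum_congr rfl fun u _ => ?_))
      · simp only [Set.indicator, Set.mem_ofPred_eq, classRatio, classProb]
        split_ifs <;> simp
      · simp only [Set.indicator, Set.mem_ofPred_eq]
        split_ifs <;> simp
    · rfl
  -- The ratio has to be measurable for the σ-algebra of `(y, k u)`. As `k` takes finitely many
  -- values, it is a finite sum over `r` of functions of `y` times indicators of `k u = r`.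
  · have : (fun ω : α × Y => classRatio μ g k t ω.1 ω.2) =
        (fun z : Y × T' => ∑ r ∈ Finset.univ.image k, {z : Y × T' | z.2 = r}.indicator
          (fun z => (posterior μ z.1).real (g ⁻¹' {t} ∩ k ⁻¹' {r}) /
            (posterior μ z.1).real (k ⁻¹' {r})) z) ∘ fun ω => (ω.2, k ω.1) := by
      ext ω
      simp only [Function.comp, Set.indicator, Set.mem_ofPred_eq]
      rw [Finset.sum_ite_eq, if_pos (Finset.mem_image_of_mem _ (Finset.mem_univ _))]
      rfl
    rw [this]
    refine (Measurable.comp ?_ (comap_measurable _)).stronglyMeasurable.aestronglyMeasurable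
    refine Finset.measurable_sum _ fun r _ => Measurable.indicator ?_ ?_
    · exact ((measurable_posterior_real μ _).comp measurable_fst).div
        ((measurable_posterior_real μ _).comp measurable_fst)
    · exact measurable_snd (measurableSet_singleton r)

/-- Almost surely `classRatio` at `t = g u` is `P(g,k|y) / P(k|y)`, whose logarithm splits into the
two entropies. -/
lemma condEntropy_prod_mul_log_two [MeasurableSpace T'] [MeasurableSingletonClass T'] (g : α → T)
    (k : α → T') :
    condEntropy μ (fun ω => g ω.1) (fun ω => (ω.2, k ω.1)) * Real.log 2 =
      classEntropy μ (fun u => (g u, k u)) - classEntropy μ k := by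
  classical
  rw [condEntropy, div_mul_cancel₀ _ (Real.log_pos one_lt_two).ne']
  have h1 : ∀ t, (∫ ω, Real.negMulLog ((μ⟦(fun ω : α × Y => g ω.1) ⁻¹' {t} |
      MeasurableSpace.comap (fun ω => (ω.2, k ω.1)) inferInstance⟧) ω) ∂μ) =
      ∫ ω : α × Y, Real.negMulLog (classRatio μ g k t ω.1 ω.2) ∂μ := by
    intro t
    refine integral_congr_ae ?_
    filter_upwards [classRatio_ae_eq_condExp μ g k t] with ω hω
    exact congrArg Real.negMulLog hω.symm
  have hi : ∀ t, Integrable (fun ω : α × Y => Real.negMulLog (classRatio μ g k t ω.1 ω.2)) μ := by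
    intro t
    refine Integrable.mono' (integrable_const (1 : ℝ))
      (Real.continuous_negMulLog.measurable.comp (measurable_of_forall_left fun u =>
        measurable_classRatio μ g k t u)).aestronglyMeasurable
      (Eventually.of_forall fun ω => ?_)
    have hp0 := classRatio_nonneg μ g k t ω.1 ω.2
    rw [Real.norm_of_nonneg (Real.negMulLog_nonneg hp0 (classRatio_le_one μ g k t ω.1 ω.2))]
    have := Real.negMulLog_le_one_sub_self hp0
    linarith
  simp_rw [h1]
  rw [tsum_eq_sum (s := Finset.univ.image g), ← integral_finsetSum _ fun t _ => hi t]
  · rw [integral_eq_integral_posterior μ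
      (f := fun u y => ∑ t ∈ Finset.univ.image g, Real.negMulLog (classRatio μ g k t u y))
      (fun u => Finset.measurable_sum _ fun t _ =>
        Real.continuous_negMulLog.measurable.comp (measurable_classRatio μ g k t u))
      (integrable_finsetSum _ fun t _ => hi t)]
    have h2 : classEntropy μ (fun u => (g u, k u)) - classEntropy μ k =
        ∫ ω : α × Y, -Real.log (classRatio μ g k (g ω.1) ω.1 ω.2) ∂μ := by
      unfold classEntropy
      rw [← integral_sub (integrable_log_classProb μ _).fun_neg (integrable_log_classProb μ _).fun_neg]
      refine integral_congr_ae ?_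
      filter_upwards [ae_classProb_pos μ k, ae_classProb_pos μ fun u => (g u, k u)] with ω ha hb
      have : (posterior μ ω.2).real (g ⁻¹' {g ω.1} ∩ k ⁻¹' {k ω.1}) =
          classProb μ (fun u => (g u, k u)) ω.1 ω.2 := by
        unfold classProb; congr 1; ext v; simp
      rw [classRatio, this, Real.log_div hb.ne' ha.ne']
      ring
    rw [h2]
    have hi2 : Integrable (fun ω : α × Y => -Real.log (classRatio μ g k (g ω.1) ω.1 ω.2)) μ := by
      refine ((integrable_log_classProb μ k).sub
        (integrable_log_classProb μ fun u => (g u, k u))).congr ?_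
      filter_upwards [ae_classProb_pos μ k, ae_classProb_pos μ fun u => (g u, k u)] with ω ha hb
      have : (posterior μ ω.2).real (g ⁻¹' {g ω.1} ∩ k ⁻¹' {k ω.1}) =
          classProb μ (fun u => (g u, k u)) ω.1 ω.2 := by
        unfold classProb; congr 1; ext v; simp
      rw [classRatio, this, Real.log_div hb.ne' ha.ne', Pi.sub_apply]
      ring
    rw [integral_eq_integral_posterior μ
      (f := fun u y => -Real.log (classRatio μ g k (g u) u y))
      (fun u => (measurable_classRatio μ g k _ u).log.neg) hi2]
    refine integral_congr_ae (Eventually.of_forall fun ω => ?_)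
    exact sum_negMulLog_ratio (posterior μ ω.2) g k
  · intro t ht
    have : g ⁻¹' {t} = ∅ := by
      ext u
      simp only [Set.mem_preimage, Set.mem_singleton_iff, Set.mem_empty_iff_false, iff_false]
      rintro rfl
      exact ht (Finset.mem_image_of_mem _ (Finset.mem_univ u))
    simp [classRatio, this]

end Chain

/-! ### Unconditional entropies, data processing with equality, subadditivity. -/

section Prior

variable {α Y T T' : Type*} [Fintype α] [Nonempty α] [MeasurableSpace α]
  [DiscreteMeasurableSpace α] [MeasurableSpace Y]

/-- The probability of the fibre of `g` through `u` under the first marginal. -/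
def priorProb (μ : Measure (α × Y)) (g : α → T) (u : α) : ℝ := μ.fst.real (g ⁻¹' {g u})

/-- The entropy in nats of `g` of the first coordinate. -/
def priorEntropy (μ : Measure (α × Y)) (g : α → T) : ℝ := ∫ ω, -Real.log (priorProb μ g ω.1) ∂μ

variable (μ : Measure (α × Y)) [IsProbabilityMeasure μ]

lemma integrable_comp_fst (f : α → ℝ) : Integrable (fun ω : α × Y => f ω.1) μ := by
  have h : Integrable f (μ.map Prod.fst) := by
    have : IsFiniteMeasure (μ.map (Prod.fst : α × Y → α)) := inferInstance
    exact Integrable.of_finite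
  exact h.comp_measurable measurable_fst

lemma integral_comp_fst (f : α → ℝ) : ∫ ω, f ω.1 ∂μ = ∑ u, μ.fst.real {u} * f u := by
  have h : ∫ ω, f ω.1 ∂μ = ∫ u, f u ∂μ.fst := by
    rw [Measure.fst, integral_map measurable_fst.aemeasurable
      (Measurable.of_discrete).aestronglyMeasurable]
  rw [h, integral_fintype .of_finite]
  rfl

lemma fst_real_apply (s : Set α) : μ.fst.real s = μ.real (Prod.fst ⁻¹' s) := by
  rw [measureReal_def, Measure.fst_apply MeasurableSet.of_discrete, measureReal_def]

lemma priorEntropy_eq_sum [DecidableEq T] (g : α → T) :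
    priorEntropy μ g = ∑ t ∈ Finset.univ.image g, Real.negMulLog (μ.fst.real (g ⁻¹' {t})) := by
  rw [priorEntropy, integral_comp_fst μ fun u => -Real.log (priorProb μ g u)]
  have := sum_real_singleton_mul_comp μ.fst g fun t => -Real.log (μ.fst.real (g ⁻¹' {t}))
  unfold priorProb
  rw [this]
  simp [Real.negMulLog]

lemma entropy_mul_log_two (g : α → T) :
    entropy μ (fun ω => g ω.1) * Real.log 2 = priorEntropy μ g := by
  classical
  rw [entropy, div_mul_cancel₀ _ (Real.log_pos one_lt_two).ne', priorEntropy_eq_sum]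
  have : ∀ t, μ.real ((fun ω : α × Y => g ω.1) ⁻¹' {t}) = μ.fst.real (g ⁻¹' {t}) := fun t =>
    (fst_real_apply μ (g ⁻¹' {t})).symm
  simp_rw [this]
  rw [tsum_eq_sum]
  intro t ht
  have : g ⁻¹' {t} = ∅ := by
    ext u
    simp only [Set.mem_preimage, Set.mem_singleton_iff, Set.mem_empty_iff_false, iff_false]
    rintro rfl
    exact ht (Finset.mem_image_of_mem _ (Finset.mem_univ u))
  simp [this]

lemma condEntropy_of_indepFun [MeasurableSpace T] [MeasurableSingletonClass T] [MeasurableSpace T']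
    {g : α → T} {k : α → T'} (h : IndepFun (fun ω : α × Y => g ω.1) (fun ω => k ω.1) μ) :
    condEntropy μ (fun ω => g ω.1) (fun ω => k ω.1) = entropy μ (fun ω => g ω.1) := by
  have hg : Measurable fun ω : α × Y => g ω.1 := Measurable.of_discrete.comp measurable_fst
  have hk : Measurable fun ω : α × Y => k ω.1 := Measurable.of_discrete.comp measurable_fst
  rw [condEntropy, entropy]
  congr 2
  ext t
  have hs : MeasurableSet[MeasurableSpace.comap (fun ω : α × Y => g ω.1) inferInstance]
      ((fun ω : α × Y => g ω.1) ⁻¹' {t}) := ⟨{t}, measurableSet_singleton t, rfl⟩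
  have h1 := condExp_indep_eq (f := ((fun ω : α × Y => g ω.1) ⁻¹' {t}).indicator fun _ => (1 : ℝ))
    hg.comap_le hk.comap_le (stronglyMeasurable_const.indicator hs) h
  have h2 : ∫ ω, Real.negMulLog ((μ⟦(fun ω : α × Y => g ω.1) ⁻¹' {t} |
      MeasurableSpace.comap (fun ω => k ω.1) inferInstance⟧) ω) ∂μ =
      ∫ _, Real.negMulLog (μ.real ((fun ω : α × Y => g ω.1) ⁻¹' {t})) ∂μ := by
    refine integral_congr_ae ?_
    filter_upwards [h1] with ω hω
    rw [hω, integral_indicator_const _ (hg.comap_le _ hs)]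
    simp
  rw [h2]
  simp

lemma ae_priorProb_pos (g : α → T) : ∀ᵐ ω ∂μ, 0 < priorProb μ g ω.1 := by
  have h : ∀ u : α, ∀ᵐ ω ∂μ, ω.1 = u → μ.fst.real {u} ≠ 0 := by
    intro u
    by_cases hu : μ.fst.real {u} = 0
    · rw [fst_real_apply, measureReal_eq_zero_iff] at hu
      filter_upwards [measure_eq_zero_iff_ae_notMem.1 hu] with ω hω h1
      exact absurd h1 hω
    · exact Eventually.of_forall fun _ _ => hu
  filter_upwards [ae_all_iff.2 h] with ω hω
  exact (lt_of_le_of_ne measureReal_nonneg (hω ω.1 rfl).symm).trans_le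
    (measureReal_mono (by simp))

/-- If the law of `Y` given `g` only depends on `x ∘ g`, then `g` and `x ∘ g` have the same mutual
information with `Y`. -/
lemma priorEntropy_sub_classEntropy_comp (g : α → T) (x : T → T') (c : T' → Set Y → ℝ)
    (h : ∀ t B, MeasurableSet B → μ.real (Prod.fst ⁻¹' (g ⁻¹' {t}) ∩ Prod.snd ⁻¹' B) =
      μ.fst.real (g ⁻¹' {t}) * c (x t) B) :
    priorEntropy μ g - classEntropy μ g =
      priorEntropy μ (x ∘ g) - classEntropy μ (x ∘ g) := by
  classical
  -- The factorization `h` passes from `g` to `x ∘ g`: sum it over the values `t` with `x t = r`,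
  -- where the factor `c (x t) B` is constant.
  have hx : ∀ r B, MeasurableSet B → μ.real (Prod.fst ⁻¹' ((x ∘ g) ⁻¹' {r}) ∩ Prod.snd ⁻¹' B) =
      μ.fst.real ((x ∘ g) ⁻¹' {r}) * c r B := by
    intro r B hB
    have hm : ∀ s : Set α, (μ.restrict (Prod.snd ⁻¹' B)).fst.real s =
        μ.real (Prod.fst ⁻¹' s ∩ Prod.snd ⁻¹' B) := by
      intro s
      rw [measureReal_def, Measure.fst_apply MeasurableSet.of_discrete, ← measureReal_def,
        measureReal_restrict_apply (measurable_fst MeasurableSet.of_discrete)]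
    have key : ∀ m : Measure α, IsFiniteMeasure m → m.real ((x ∘ g) ⁻¹' {r}) =
        ∑ t ∈ Finset.univ.image g, m.real (g ⁻¹' {t}) * if x t = r then 1 else 0 := by
      intro m _
      rw [← sum_real_singleton_mul_comp m g fun t => if x t = r then (1 : ℝ) else 0]
      have : ((x ∘ g) ⁻¹' {r} : Set α) =
          ((Finset.univ.filter fun u => x (g u) = r : Finset α) : Set α) := by
        ext u; simp
      rw [this, ← sum_measureReal_singleton, Finset.sum_filter]
      exact Finset.sum_congr rfl fun u _ => by split_ifs <;> simp
    rw [← hm, key _ inferInstance, key _ inferInstance, Finset.sum_mul]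
    refine Finset.sum_congr rfl fun t _ => ?_
    rw [hm, h t B hB]
    split_ifs with ht
    · rw [ht]; ring
    · simp
  -- The ratio of posterior to prior is the same for `g` and `x ∘ g`, so the two information
  -- densities agree almost surely. The identity is cleared of denominators and checked by
  -- integration over every measurable set of outputs.
  have hpost : ∀ u, ∀ᵐ ω ∂μ, classProb μ g u ω.2 * priorProb μ (x ∘ g) u =
      priorProb μ g u * classProb μ (x ∘ g) u ω.2 := by
    intro u
    have hs : ∀ s : Set α, ∀ B, MeasurableSet B →
        ∫ y in B, (posterior μ y).real s ∂(μ.snd) =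
          μ.real (Prod.fst ⁻¹' s ∩ Prod.snd ⁻¹' B) := by
      intro s B hB
      have h0 := setLIntegral_preimage_condDistrib (μ := μ) (X := Prod.snd) (Y := Prod.fst)
        measurable_snd measurable_fst.aemeasurable (MeasurableSet.of_discrete (s := s)) hB
      rw [Measure.snd, setIntegral_map hB (measurable_posterior_real μ s).aestronglyMeasurable
        measurable_snd.aemeasurable]
      simp_rw [measureReal_def]
      rw [integral_toReal (f := fun x : α × Y => posterior μ x.2 s)
        (((posterior μ).measurable_coe MeasurableSet.of_discrete).comp
          measurable_snd).aemeasurable (Eventually.of_forall fun ω => measure_lt_top _ _)]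
      rw [Set.inter_comm, ← h0]
      rfl
    have hi : ∀ s : Set α, Integrable (fun y => (posterior μ y).real s) μ.snd := fun s =>
      Integrable.mono' (integrable_const (1 : ℝ))
        (measurable_posterior_real μ s).aestronglyMeasurable
        (Eventually.of_forall fun y => by
          rw [Real.norm_of_nonneg measureReal_nonneg]; exact measureReal_le_one)
    have hae : (fun y => classProb μ g u y * priorProb μ (x ∘ g) u) =ᵐ[μ.snd]
        fun y => priorProb μ g u * classProb μ (x ∘ g) u y := by
      refine Integrable.ae_eq_of_forall_setIntegral_eq _ _ ((hi _).mul_const _)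
        ((hi _).const_mul _) fun B hB _ => ?_
      rw [integral_mul_const, integral_const_mul]
      unfold classProb priorProb
      rw [hs _ B hB, hs _ B hB, h _ B hB, hx _ B hB, Function.comp_apply]
      ring
    exact ae_of_ae_map measurable_snd.aemeasurable hae
  have hlog : ∀ᵐ ω ∂μ, -Real.log (priorProb μ g ω.1) - -Real.log (classProb μ g ω.1 ω.2) =
      -Real.log (priorProb μ (x ∘ g) ω.1) - -Real.log (classProb μ (x ∘ g) ω.1 ω.2) := by
    filter_upwards [ae_all_iff.2 hpost, ae_priorProb_pos μ g, ae_priorProb_pos μ (x ∘ g),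
      ae_classProb_pos μ g, ae_classProb_pos μ (x ∘ g)] with ω h0 h1 h2 h3 h4
    have := congrArg Real.log (h0 ω.1)
    rw [Real.log_mul h3.ne' h2.ne', Real.log_mul h1.ne' h4.ne'] at this
    linarith
  unfold priorEntropy classEntropy
  rw [← integral_sub (integrable_comp_fst μ fun u => -Real.log (priorProb μ g u))
      (integrable_log_classProb μ g).fun_neg,
    ← integral_sub (integrable_comp_fst μ fun u => -Real.log (priorProb μ (x ∘ g) u))
      (integrable_log_classProb μ (x ∘ g)).fun_neg]
  exact integral_congr_ae hlog

/-- Subadditivity of the conditional entropy. -/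
lemma classEntropy_id_le_add {g : α → T} {k : α → T'}
    (h : ∀ u v, g u = g v → k u = k v → u = v) :
    classEntropy μ id ≤ classEntropy μ g + classEntropy μ k := by
  classical
  -- Here `f = P(g|y) P(k|y) / P(u|y)`. Its mean is at most 1 because `u ↦ (g u, k u)` is injective,
  -- and the claim follows from `log f ≤ f - 1`.
  set f : α → Y → ℝ := fun u y => classProb μ g u y * classProb μ k u y * (classProb μ id u y)⁻¹
  have hfm : ∀ u, Measurable (f u) := fun u =>
    ((measurable_classProb μ g u).mul (measurable_classProb μ k u)).mul
      (measurable_classProb μ id u).inv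
  have hf0 : ∀ u y, 0 ≤ f u y := fun u y => mul_nonneg (mul_nonneg (classProb_nonneg _ _ _ _)
    (classProb_nonneg _ _ _ _)) (inv_nonneg.2 (classProb_nonneg _ _ _ _))
  have hfi : Integrable (fun ω : α × Y => f ω.1 ω.2) μ := by
    refine (integrable_inv_classProb μ id).mono' (measurable_of_forall_left hfm).aestronglyMeasurable
      (Eventually.of_forall fun ω => ?_)
    rw [Real.norm_of_nonneg (hf0 _ _)]
    exact mul_le_of_le_one_left (inv_nonneg.2 (classProb_nonneg _ _ _ _))
      (mul_le_one₀ (classProb_le_one _ _ _ _) (classProb_nonneg _ _ _ _) (classProb_le_one _ _ _ _))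
  have hf1 : ∫ ω, f ω.1 ω.2 ∂μ ≤ 1 := by
    rw [integral_eq_integral_posterior μ hfm hfi]
    have hle : ∀ y, ∑ u, (posterior μ y).real {u} * f u y ≤ 1 := by
      intro y
      have hone : ∑ t ∈ Finset.univ.image g, (posterior μ y).real (g ⁻¹' {t}) = 1 := by
        have := sum_posterior_mul_comp μ (g := g) y fun _ => 1
        simp only [mul_one] at this
        rw [← this, sum_posterior]
      have hone' : ∑ t ∈ Finset.univ.image k, (posterior μ y).real (k ⁻¹' {t}) = 1 := by
        have := sum_posterior_mul_comp μ (g := k) y fun _ => 1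
        simp only [mul_one] at this
        rw [← this, sum_posterior]
      calc ∑ u, (posterior μ y).real {u} * f u y
          ≤ ∑ u, (posterior μ y).real (g ⁻¹' {g u}) * (posterior μ y).real (k ⁻¹' {k u}) := by
            refine Finset.sum_le_sum fun u _ => ?_
            have h0 : 0 ≤ classProb μ g u y * classProb μ k u y :=
              mul_nonneg (classProb_nonneg _ _ _ _) (classProb_nonneg _ _ _ _)
            calc _ = (classProb μ g u y * classProb μ k u y) *
                  (classProb μ id u y * (classProb μ id u y)⁻¹) := by
                    simp only [f, classProb_id]; ring
              _ ≤ _ := mul_le_of_le_one_right h0 mul_inv_le_one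
        _ = ∑ z ∈ Finset.univ.image fun u => (g u, k u),
              (posterior μ y).real (g ⁻¹' {z.1}) * (posterior μ y).real (k ⁻¹' {z.2}) := by
            rw [Finset.sum_image]
            intro u _ v _ huv
            exact h u v (Prod.ext_iff.1 huv).1 (Prod.ext_iff.1 huv).2
        _ ≤ ∑ z ∈ Finset.univ.image g ×ˢ Finset.univ.image k,
              (posterior μ y).real (g ⁻¹' {z.1}) * (posterior μ y).real (k ⁻¹' {z.2}) := by
            refine Finset.sum_le_sum_of_subset_of_nonneg ?_ fun _ _ _ =>
              mul_nonneg measureReal_nonneg measureReal_nonneg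
            intro z hz
            obtain ⟨u, -, rfl⟩ := Finset.mem_image.1 hz
            simp
        _ = 1 := by
            rw [Finset.sum_product]
            dsimp only
            rw [← Finset.sum_mul_sum, hone, hone', one_mul]
    calc _ ≤ ∫ _ : α × Y, (1 : ℝ) ∂μ := by
          refine integral_mono_of_nonneg (Eventually.of_forall fun ω => ?_) (integrable_const _)
            (Eventually.of_forall fun ω => hle ω.2)
          exact Finset.sum_nonneg fun u _ => mul_nonneg measureReal_nonneg (hf0 _ _)
      _ = 1 := by simp
  have h0 : ∫ ω, (1 - f ω.1 ω.2) ∂μ ≤ ∫ ω, (-Real.log (classProb μ g ω.1 ω.2) +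
      -Real.log (classProb μ k ω.1 ω.2) - -Real.log (classProb μ id ω.1 ω.2)) ∂μ := by
    refine integral_mono_ae ((integrable_const _).sub hfi)
      (((integrable_log_classProb μ g).fun_neg.fun_add (integrable_log_classProb μ k).fun_neg).sub
        (integrable_log_classProb μ id).fun_neg) ?_
    filter_upwards [ae_classProb_pos μ g, ae_classProb_pos μ k, ae_classProb_pos μ id]
      with ω h1 h2 h3
    have hpos : 0 < f ω.1 ω.2 := mul_pos (mul_pos h1 h2) (inv_pos.2 h3)
    have := Real.log_le_sub_one_of_pos hpos
    rw [Real.log_mul (mul_pos h1 h2).ne' (inv_pos.2 h3).ne', Real.log_mul h1.ne' h2.ne',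
      Real.log_inv] at this
    linarith
  rw [integral_sub (integrable_const _) hfi, integral_sub
    ((integrable_log_classProb μ g).fun_neg.fun_add (integrable_log_classProb μ k).fun_neg)
    (integrable_log_classProb μ id).fun_neg, integral_add (integrable_log_classProb μ g).fun_neg
    (integrable_log_classProb μ k).fun_neg] at h0
  simp only [integral_const, probReal_univ, smul_eq_mul, mul_one] at h0
  unfold classEntropy
  linarith

end Prior

/-! ### The rate regions in nats, expressed through the auxiliary pair. -/

section Regions

variable {F X₁ X₂ Y T T' : Type*} [Field F] [Fintype F] [MeasurableSpace F]
  [DiscreteMeasurableSpace F] [MeasurableSpace X₁] [MeasurableSpace X₂] [MeasurableSpace Y]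

/-- The entropy of a probability mass function in nats. -/
def pmfEntropy (p : PMF F) : ℝ := ∑ v, Real.negMulLog (p v).toReal

/-- The linear combination of the two coordinates of a pair. -/
def pairComb (b : Fin 2 → F) (u : F × F) : F := linComb b u.1 u.2

variable (P : Kernel (X₁ × X₂) Y) [IsMarkovKernel P] (p₁ p₂ : PMF F) (x₁ : F → X₁) (x₂ : F → X₂)

instance : IsProbabilityMeasure (jointLaw P p₁ p₂ x₁ x₂) := by
  unfold jointLaw; infer_instance

lemma jointLaw_fst : (jointLaw P p₁ p₂ x₁ x₂).fst = p₁.toMeasure.prod p₂.toMeasure :=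
  Measure.fst_compProd _ _

lemma jointLaw_real_singleton (u : F × F) {B : Set Y} (hB : MeasurableSet B) :
    (jointLaw P p₁ p₂ x₁ x₂).real (Prod.fst ⁻¹' {u} ∩ Prod.snd ⁻¹' B) =
      (p₁ u.1).toReal * (p₂ u.2).toReal * (P (x₁ u.1, x₂ u.2)).real B := by
  have h1 : (Prod.fst ⁻¹' {u} ∩ Prod.snd ⁻¹' B : Set ((F × F) × Y)) = {u} ×ˢ B := by
    ext; simp
  have h2 : p₁.toMeasure.prod p₂.toMeasure {u} = p₁ u.1 * p₂ u.2 := by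
    have : ({u} : Set (F × F)) = {u.1} ×ˢ {u.2} := by simp
    rw [this, Measure.prod_prod, PMF.toMeasure_apply_singleton _ _ (measurableSet_singleton _),
      PMF.toMeasure_apply_singleton _ _ (measurableSet_singleton _)]
  rw [h1, measureReal_def, jointLaw, Measure.compProd_apply_prod (measurableSet_singleton u) hB,
    lintegral_singleton, h2, ENNReal.toReal_mul, ENNReal.toReal_mul]
  simp only [Kernel.comap_apply, measureReal_def]
  ring

lemma jointLaw_fst_real_prod (s t : Set F) : (jointLaw P p₁ p₂ x₁ x₂).fst.real (s ×ˢ t) =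
    p₁.toMeasure.real s * p₂.toMeasure.real t := by
  rw [jointLaw_fst, measureReal_prod_prod]

lemma pmf_toMeasure_real_singleton (p : PMF F) (v : F) : p.toMeasure.real {v} = (p v).toReal := by
  rw [measureReal_def, PMF.toMeasure_apply_singleton _ _ (measurableSet_singleton _)]

lemma jointLaw_fst_real_left (s : Set F) :
    (jointLaw P p₁ p₂ x₁ x₂).fst.real (Prod.fst ⁻¹' s) = p₁.toMeasure.real s := by
  rw [← Set.prod_univ, jointLaw_fst_real_prod]; simp

lemma jointLaw_fst_real_right (s : Set F) :
    (jointLaw P p₁ p₂ x₁ x₂).fst.real (Prod.snd ⁻¹' s) = p₂.toMeasure.real s := by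
  rw [← Set.univ_prod, jointLaw_fst_real_prod]; simp

lemma priorEntropy_jointLaw_fst :
    priorEntropy (jointLaw P p₁ p₂ x₁ x₂) Prod.fst = pmfEntropy p₁ := by
  classical
  rw [priorEntropy_eq_sum, Finset.image_univ_of_surjective Prod.fst_surjective]
  simp only [jointLaw_fst_real_left, pmf_toMeasure_real_singleton, pmfEntropy]

lemma priorEntropy_jointLaw_snd :
    priorEntropy (jointLaw P p₁ p₂ x₁ x₂) Prod.snd = pmfEntropy p₂ := by
  classical
  rw [priorEntropy_eq_sum, Finset.image_univ_of_surjective Prod.snd_surjective]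
  simp only [jointLaw_fst_real_right, pmf_toMeasure_real_singleton, pmfEntropy]

lemma priorEntropy_jointLaw_prod (g : F → T) (k : F → T') :
    priorEntropy (jointLaw P p₁ p₂ x₁ x₂) (fun u => (g u.1, k u.2)) =
      priorEntropy (jointLaw P p₁ p₂ x₁ x₂) (fun u => g u.1) +
        priorEntropy (jointLaw P p₁ p₂ x₁ x₂) (fun u => k u.2) := by
  set μ := jointLaw P p₁ p₂ x₁ x₂
  unfold priorEntropy
  rw [← integral_add (integrable_comp_fst μ fun u => -Real.log (priorProb μ (fun u => g u.1) u))
    (integrable_comp_fst μ fun u => -Real.log (priorProb μ (fun u => k u.2) u))]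
  refine integral_congr_ae ?_
  filter_upwards [ae_priorProb_pos μ fun u => g u.1, ae_priorProb_pos μ fun u => k u.2] with ω h1 h2
  have : priorProb μ (fun u => (g u.1, k u.2)) ω.1 =
      priorProb μ (fun u => g u.1) ω.1 * priorProb μ (fun u => k u.2) ω.1 := by
    unfold priorProb
    have e1 : ((fun u : F × F => (g u.1, k u.2)) ⁻¹' {(g ω.1.1, k ω.1.2)} : Set (F × F)) =
        (g ⁻¹' {g ω.1.1}) ×ˢ (k ⁻¹' {k ω.1.2}) := by
      ext; simp
    have e2 : ((fun u : F × F => g u.1) ⁻¹' {g ω.1.1} : Set (F × F)) =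
        Prod.fst ⁻¹' (g ⁻¹' {g ω.1.1}) := rfl
    have e3 : ((fun u : F × F => k u.2) ⁻¹' {k ω.1.2} : Set (F × F)) =
        Prod.snd ⁻¹' (k ⁻¹' {k ω.1.2}) := rfl
    rw [e1, e2, e3, jointLaw_fst_real_prod, jointLaw_fst_real_left, jointLaw_fst_real_right]
  rw [this, Real.log_mul h1.ne' h2.ne']
  ring

lemma indepFun_jointLaw [MeasurableSpace T] [MeasurableSpace T'] (g : F → T) (k : F → T') :
    IndepFun (fun ω => g ω.1.1) (fun ω => k ω.1.2) (jointLaw P p₁ p₂ x₁ x₂) := by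
  rw [indepFun_iff_measure_inter_preimage_eq_mul]
  intro s t hs ht
  have e : ∀ w : Set (F × F), jointLaw P p₁ p₂ x₁ x₂ (Prod.fst ⁻¹' w) =
      p₁.toMeasure.prod p₂.toMeasure w := by
    intro w
    rw [← jointLaw_fst P p₁ p₂ x₁ x₂, Measure.fst_apply MeasurableSet.of_discrete]
  have e1 := e ((g ⁻¹' s) ×ˢ (k ⁻¹' t))
  have e2 := e ((g ⁻¹' s) ×ˢ Set.univ)
  have e3 := e (Set.univ ×ˢ (k ⁻¹' t))
  rw [Measure.prod_prod] at e1 e2 e3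
  simp only [measure_univ, mul_one, one_mul] at e2 e3
  rw [Set.prod_univ] at e2
  rw [Set.univ_prod] at e3
  exact e1.trans (congrArg₂ (· * ·) e2.symm e3.symm)

/-- The output depends on the auxiliary pair only through the channel inputs, so replacing `(X₁,
X₂)` by `(U₁, U₂)` does not change the mutual information with `Y`. Independence then splits the
prior entropy. -/
lemma mutualInfo_pair_mul_log_two :
    priorEntropy (jointLaw P p₁ p₂ x₁ x₂) (fun u => (x₁ u.1, x₂ u.2)) -
        classEntropy (jointLaw P p₁ p₂ x₁ x₂) (fun u => (x₁ u.1, x₂ u.2)) =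
      pmfEntropy p₁ + pmfEntropy p₂ - classEntropy (jointLaw P p₁ p₂ x₁ x₂) id := by
  have h := priorEntropy_sub_classEntropy_comp (jointLaw P p₁ p₂ x₁ x₂) id
    (fun u : F × F => (x₁ u.1, x₂ u.2)) (fun x B => (P x).real B) (by
      intro u B hB
      rw [Set.preimage_id, jointLaw_real_singleton _ _ _ _ _ _ hB]
      have : ({u} : Set (F × F)) = {u.1} ×ˢ {u.2} := by simp
      rw [this, jointLaw_fst_real_prod, pmf_toMeasure_real_singleton,
        pmf_toMeasure_real_singleton])
  have h2 : priorEntropy (jointLaw P p₁ p₂ x₁ x₂) (id : F × F → F × F) =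
      pmfEntropy p₁ + pmfEntropy p₂ := by
    rw [← priorEntropy_jointLaw_fst P p₁ p₂ x₁ x₂, ← priorEntropy_jointLaw_snd P p₁ p₂ x₁ x₂]
    exact priorEntropy_jointLaw_prod P p₁ p₂ x₁ x₂ id id
  rw [h2] at h
  exact h.symm

/-- Same replacement for one user: averaging over the other user's symbol gives an effective channel
from `x₁(U₁)` to `Y`. -/
lemma mutualInfo_left_mul_log_two :
    priorEntropy (jointLaw P p₁ p₂ x₁ x₂) (fun u => x₁ u.1) -
        classEntropy (jointLaw P p₁ p₂ x₁ x₂) (fun u => x₁ u.1) =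
      pmfEntropy p₁ - classEntropy (jointLaw P p₁ p₂ x₁ x₂) Prod.fst := by
  classical
  have h := priorEntropy_sub_classEntropy_comp (jointLaw P p₁ p₂ x₁ x₂) Prod.fst
    x₁ (fun x B => ∑ v, (p₂ v).toReal * (P (x, x₂ v)).real B) (by
      intro v B hB
      have : (Prod.fst ⁻¹' (Prod.fst ⁻¹' {v}) ∩ Prod.snd ⁻¹' B : Set ((F × F) × Y)) =
          ⋃ w ∈ (Finset.univ : Finset F), (Prod.fst ⁻¹' {(v, w)} ∩ Prod.snd ⁻¹' B) := by
        ext ⟨⟨a, b⟩, y⟩; simp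
      rw [this, measureReal_biUnion_finset]
      · simp_rw [jointLaw_real_singleton _ _ _ _ _ _ hB]
        rw [jointLaw_fst_real_left, pmf_toMeasure_real_singleton, Finset.mul_sum]
        exact Finset.sum_congr rfl fun w _ => by ring
      · intro a _ b _ hab
        refine Set.disjoint_left.2 ?_
        rintro ⟨u, y⟩ ⟨h1, -⟩ ⟨h2, -⟩
        simp only [Set.mem_preimage, Set.mem_singleton_iff] at h1 h2
        exact hab (Prod.ext_iff.1 (h1.symm.trans h2)).2
      · exact fun w _ => (measurable_fst (measurableSet_singleton _)).inter (measurable_snd hB))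
  rw [priorEntropy_jointLaw_fst] at h
  exact h.symm

lemma mutualInfo_right_mul_log_two :
    priorEntropy (jointLaw P p₁ p₂ x₁ x₂) (fun u => x₂ u.2) -
        classEntropy (jointLaw P p₁ p₂ x₁ x₂) (fun u => x₂ u.2) =
      pmfEntropy p₂ - classEntropy (jointLaw P p₁ p₂ x₁ x₂) Prod.snd := by
  classical
  have h := priorEntropy_sub_classEntropy_comp (jointLaw P p₁ p₂ x₁ x₂) Prod.snd
    x₂ (fun x B => ∑ v, (p₁ v).toReal * (P (x₁ v, x)).real B) (by
      intro v B hB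
      have : (Prod.fst ⁻¹' (Prod.snd ⁻¹' {v}) ∩ Prod.snd ⁻¹' B : Set ((F × F) × Y)) =
          ⋃ w ∈ (Finset.univ : Finset F), (Prod.fst ⁻¹' {(w, v)} ∩ Prod.snd ⁻¹' B) := by
        ext ⟨⟨a, b⟩, y⟩; simp
      rw [this, measureReal_biUnion_finset]
      · simp_rw [jointLaw_real_singleton _ _ _ _ _ _ hB]
        rw [jointLaw_fst_real_right, pmf_toMeasure_real_singleton, Finset.mul_sum]
        exact Finset.sum_congr rfl fun w _ => by ring
      · intro a _ b _ hab
        refine Set.disjoint_left.2 ?_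
        rintro ⟨u, y⟩ ⟨h1, -⟩ ⟨h2, -⟩
        simp only [Set.mem_preimage, Set.mem_singleton_iff] at h1 h2
        exact hab (Prod.ext_iff.1 (h1.symm.trans h2)).1
      · exact fun w _ => (measurable_fst (measurableSet_singleton _)).inter (measurable_snd hB))
  rw [priorEntropy_jointLaw_snd] at h
  exact h.symm

variable {P p₁ p₂ x₁ x₂}

lemma iCF₁_mul_log_two (b : Fin 2 → F) : iCF₁ (jointLaw P p₁ p₂ x₁ x₂) b * Real.log 2 =
    pmfEntropy p₁ - classEntropy (jointLaw P p₁ p₂ x₁ x₂) (pairComb b) := by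
  rw [iCF₁, sub_mul, entropy_mul_log_two _ Prod.fst, priorEntropy_jointLaw_fst]
  exact congrArg _ (condEntropy_snd_mul_log_two _ (pairComb b))

lemma iCF₂_mul_log_two (b : Fin 2 → F) : iCF₂ (jointLaw P p₁ p₂ x₁ x₂) b * Real.log 2 =
    pmfEntropy p₂ - classEntropy (jointLaw P p₁ p₂ x₁ x₂) (pairComb b) := by
  rw [iCF₂, sub_mul, entropy_mul_log_two _ Prod.snd, priorEntropy_jointLaw_snd]
  exact congrArg _ (condEntropy_snd_mul_log_two _ (pairComb b))

lemma sumInfo_mul_log_two : sumInfo (jointLaw P p₁ p₂ x₁ x₂) x₁ x₂ * Real.log 2 =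
    pmfEntropy p₁ + pmfEntropy p₂ - classEntropy (jointLaw P p₁ p₂ x₁ x₂) id := by
  rw [← mutualInfo_pair_mul_log_two, sumInfo, mutualInfo, sub_mul,
    entropy_mul_log_two _ fun u : F × F => (x₁ u.1, x₂ u.2)]
  exact congrArg _ (condEntropy_snd_mul_log_two _ fun u : F × F => (x₁ u.1, x₂ u.2))

/-- Independence gives `H(X₂|X₁) = H(X₂)` and the chain rule gives `H(X₂|Y,X₁) = H(X₁,X₂|Y) -
H(X₁|Y)`. The two preceding replacements then turn channel inputs into auxiliary symbols. -/
lemma condMutualInfo_right_mul_log_two [MeasurableSingletonClass X₁] [MeasurableSingletonClass X₂] :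
    condMutualInfo (jointLaw P p₁ p₂ x₁ x₂) (fun ω => x₂ ω.1.2) (fun ω => ω.2)
        (fun ω => x₁ ω.1.1) * Real.log 2 =
      pmfEntropy p₂ - classEntropy (jointLaw P p₁ p₂ x₁ x₂) id +
        classEntropy (jointLaw P p₁ p₂ x₁ x₂) Prod.fst := by
  set μ := jointLaw P p₁ p₂ x₁ x₂
  have h1 := condEntropy_prod_mul_log_two μ (fun u : F × F => x₂ u.2) (fun u : F × F => x₁ u.1)
  have h2 := condEntropy_of_indepFun μ (g := fun u : F × F => x₂ u.2) (k := fun u => x₁ u.1)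
    (indepFun_jointLaw P p₁ p₂ x₁ x₂ x₁ x₂).symm
  have h3 := classEntropy_congr μ (g := fun u : F × F => (x₂ u.2, x₁ u.1))
    (k := fun u => (x₁ u.1, x₂ u.2)) (fun u v => by simp [and_comm])
  have h4 := mutualInfo_pair_mul_log_two P p₁ p₂ x₁ x₂
  have h5 := mutualInfo_left_mul_log_two P p₁ p₂ x₁ x₂
  have h6 := priorEntropy_jointLaw_prod P p₁ p₂ x₁ x₂ x₁ x₂
  have h7 := entropy_mul_log_two μ fun u : F × F => x₂ u.2
  rw [condMutualInfo, sub_mul, h1, h2, h7, h3]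
  linarith

lemma condMutualInfo_left_mul_log_two [MeasurableSingletonClass X₁] [MeasurableSingletonClass X₂] :
    condMutualInfo (jointLaw P p₁ p₂ x₁ x₂) (fun ω => x₁ ω.1.1) (fun ω => ω.2)
        (fun ω => x₂ ω.1.2) * Real.log 2 =
      pmfEntropy p₁ - classEntropy (jointLaw P p₁ p₂ x₁ x₂) id +
        classEntropy (jointLaw P p₁ p₂ x₁ x₂) Prod.snd := by
  set μ := jointLaw P p₁ p₂ x₁ x₂
  have h1 := condEntropy_prod_mul_log_two μ (fun u : F × F => x₁ u.1) (fun u : F × F => x₂ u.2)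
  have h2 := condEntropy_of_indepFun μ (g := fun u : F × F => x₁ u.1) (k := fun u => x₂ u.2)
    (indepFun_jointLaw P p₁ p₂ x₁ x₂ x₁ x₂)
  have h4 := mutualInfo_pair_mul_log_two P p₁ p₂ x₁ x₂
  have h5 := mutualInfo_right_mul_log_two P p₁ p₂ x₁ x₂
  have h6 := priorEntropy_jointLaw_prod P p₁ p₂ x₁ x₂ x₁ x₂
  have h7 := entropy_mul_log_two μ fun u : F × F => x₁ u.1
  rw [condMutualInfo, sub_mul, h1, h2, h7]
  linarith

/-- Two nonzero linear combinations are proportional or determine the pair. -/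
lemma pairComb_injective_or_equiv {b c : Fin 2 → F} (hb : b ≠ 0) (hc : c ≠ 0) :
    (∀ u v, pairComb b u = pairComb b v → pairComb c u = pairComb c v → u = v) ∨
      ∀ u v, pairComb b u = pairComb b v ↔ pairComb c u = pairComb c v := by
  -- A vanishing determinant makes `b` and `c` proportional; otherwise Cramer's rule recovers the
  -- pair from its two combinations.
  by_cases hd : b 0 * c 1 - b 1 * c 0 = 0
  · right
    obtain ⟨r, hr, hrc⟩ : ∃ r : F, r ≠ 0 ∧ ∀ i, c i = r * b i := by
      by_cases h0 : b 0 = 0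
      · have h1 : b 1 ≠ 0 := fun h1 => hb (by ext i; fin_cases i <;> simp [h0, h1])
        have hc0 : c 0 = 0 := by
          have : b 1 * c 0 = 0 := by rw [h0] at hd; linear_combination -hd
          exact (mul_eq_zero.1 this).resolve_left h1
        refine ⟨c 1 / b 1, ?_, ?_⟩
        · refine div_ne_zero (fun h => hc ?_) h1
          ext i; fin_cases i <;> simp [hc0, h]
        · intro i; fin_cases i
          · simp [hc0, h0]
          · simp [h1]
      · have hc1 : c 1 = c 0 / b 0 * b 1 := by
          field_simp; linear_combination hd
        refine ⟨c 0 / b 0, ?_, ?_⟩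
        · refine div_ne_zero (fun h => hc ?_) h0
          ext i; fin_cases i
          · simp [h]
          · simp [hc1, h]
        · intro i; fin_cases i
          · simp [h0]
          · simpa using hc1
    intro u v
    have : ∀ w, pairComb c w = r * pairComb b w := by
      intro w; simp only [pairComb, linComb, hrc]; ring
    rw [this, this]
    exact (mul_right_injective₀ hr).eq_iff.symm
  · left
    intro u v h1 h2
    simp only [pairComb, linComb] at h1 h2
    ext
    · refine sub_eq_zero.1 ((mul_eq_zero.1 ?_).resolve_left hd)
      linear_combination c 1 * h1 - b 1 * h2
    · refine sub_eq_zero.1 ((mul_eq_zero.1 ?_).resolve_left hd)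
      linear_combination b 0 * h2 - c 0 * h1

lemma classEntropy_pairComb_of_snd_eq_zero (μ : Measure ((F × F) × Y)) [IsProbabilityMeasure μ]
    {b : Fin 2 → F} (hb : b ≠ 0) (h1 : b 1 = 0) :
    classEntropy μ (pairComb b) = classEntropy μ Prod.fst := by
  have h0 : b 0 ≠ 0 := fun h0 => hb (by ext i; fin_cases i <;> simp [h0, h1])
  exact classEntropy_congr μ fun u v => by simp [pairComb, linComb, h1, h0]

lemma classEntropy_pairComb_of_fst_eq_zero (μ : Measure ((F × F) × Y)) [IsProbabilityMeasure μ]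
    {b : Fin 2 → F} (hb : b ≠ 0) (h0 : b 0 = 0) :
    classEntropy μ (pairComb b) = classEntropy μ Prod.snd := by
  have h1 : b 1 ≠ 0 := fun h1 => hb (by ext i; fin_cases i <;> simp [h0, h1])
  exact classEntropy_congr μ fun u v => by simp [pairComb, linComb, h1, h0]

/-- One good `b` serves every `c`. If `b` and `c` are not proportional, subadditivity gives `h -
H(W_b|Y) ≤ h - H(U₁,U₂|Y) + H(W_c|Y)`; if they are, the two combinations have the same conditional
entropy. -/
lemma classEntropy_id_sub_le (μ : Measure ((F × F) × Y)) [IsProbabilityMeasure μ] {h r : ℝ}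
    {b c : Fin 2 → F} (hb : b ≠ 0) (hc : c ≠ 0) (h1 : r < h - classEntropy μ (pairComb b))
    (h2 : r < h - classEntropy μ id + classEntropy μ (pairComb b)) :
    r < h - classEntropy μ id + classEntropy μ (pairComb c) := by
  rcases pairComb_injective_or_equiv hb hc with hi | he
  · have := classEntropy_id_le_add μ hi
    linarith
  · rwa [← classEntropy_congr μ he]

/-- The conditions, in nats, under which both codewords can be decoded. -/
def DecodablePair (μ : Measure ((F × F) × Y)) [IsFiniteMeasure μ] (h₁ h₂ r₁ r₂ : ℝ) : Prop :=
  r₁ + r₂ < h₁ + h₂ - classEntropy μ id ∧ ∀ b : Fin 2 → F, b ≠ 0 →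
    (b 1 ≠ 0 ∧ r₁ < h₁ - classEntropy μ id + classEntropy μ (pairComb b)) ∨
    (b 0 ≠ 0 ∧ r₂ < h₂ - classEntropy μ id + classEntropy μ (pairComb b))

lemma nats_of_mem_regionCF {a : Fin 2 → F} {R₁ R₂ : ℝ}
    (h : (R₁, R₂) ∈ regionCF (jointLaw P p₁ p₂ x₁ x₂) a) :
    R₁ * Real.log 2 < pmfEntropy p₁ - classEntropy (jointLaw P p₁ p₂ x₁ x₂) (pairComb a) ∧
      R₂ * Real.log 2 < pmfEntropy p₂ - classEntropy (jointLaw P p₁ p₂ x₁ x₂) (pairComb a) := by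
  have hl := Real.log_pos one_lt_two
  rw [← iCF₁_mul_log_two, ← iCF₂_mul_log_two]
  exact ⟨mul_lt_mul_of_pos_right h.1 hl, mul_lt_mul_of_pos_right h.2 hl⟩

/-- In nats, `I(X₁,X₂;Y) - I_{CF,2}(b)` is `H(U₁) - H(U₁,U₂|Y) + H(W_b|Y)`, so the two terms of the
minimum are exactly the two hypotheses of `classEntropy_id_sub_le`. -/
lemma decodablePair_of_mem_regionLMAC [MeasurableSingletonClass X₁] [MeasurableSingletonClass X₂]
    {R₁ R₂ : ℝ} (h : (R₁, R₂) ∈ regionLMAC (jointLaw P p₁ p₂ x₁ x₂) x₁ x₂) :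
    DecodablePair (jointLaw P p₁ p₂ x₁ x₂) (pmfEntropy p₁) (pmfEntropy p₂) (R₁ * Real.log 2)
      (R₂ * Real.log 2) := by
  have hl := Real.log_pos one_lt_two
  have : Nonempty {b : Fin 2 → F // b ≠ 0} := ⟨⟨fun _ => 1, fun h => one_ne_zero (congrFun h 0)⟩⟩
  rcases h with ⟨h1, h2, h3⟩ | ⟨h2, h1, h3⟩
  · obtain ⟨⟨b, hb⟩, hlt⟩ := exists_lt_of_lt_ciSup h1
    dsimp only at hlt h2 h3
    obtain ⟨ha, hc⟩ := lt_min_iff.1 hlt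
    have ha' := mul_lt_mul_of_pos_right ha hl
    have hc' := mul_lt_mul_of_pos_right hc hl
    have h2' := mul_lt_mul_of_pos_right h2 hl
    have h3' := mul_lt_mul_of_pos_right h3 hl
    rw [iCF₁_mul_log_two] at ha'
    rw [sub_mul, sumInfo_mul_log_two, iCF₂_mul_log_two] at hc'
    rw [sumInfo_mul_log_two] at h3'
    rw [condMutualInfo_right_mul_log_two] at h2'
    refine ⟨by linarith, fun c hc0 => ?_⟩
    -- If `c 1 = 0`, then `W_c` is a multiple of `U₁` and the required condition on the second rate
    -- is `R₂ < I(X₂;Y|X₁)`.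
    by_cases hz : c 1 = 0
    · right
      refine ⟨fun h0 => hc0 (by ext i; fin_cases i <;> simp [h0, hz]), ?_⟩
      rwa [classEntropy_pairComb_of_snd_eq_zero _ hc0 hz]
    · exact .inl ⟨hz, classEntropy_id_sub_le _ hb hc0 ha' (by linarith)⟩
  · obtain ⟨⟨b, hb⟩, hlt⟩ := exists_lt_of_lt_ciSup h1
    dsimp only at hlt h2 h3
    obtain ⟨ha, hc⟩ := lt_min_iff.1 hlt
    have ha' := mul_lt_mul_of_pos_right ha hl
    have hc' := mul_lt_mul_of_pos_right hc hl
    have h2' := mul_lt_mul_of_pos_right h2 hl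
    have h3' := mul_lt_mul_of_pos_right h3 hl
    rw [iCF₂_mul_log_two] at ha'
    rw [sub_mul, sumInfo_mul_log_two, iCF₁_mul_log_two] at hc'
    rw [sumInfo_mul_log_two] at h3'
    rw [condMutualInfo_left_mul_log_two] at h2'
    refine ⟨by linarith, fun c hc0 => ?_⟩
    by_cases hz : c 0 = 0
    · left
      refine ⟨fun h1 => hc0 (by ext i; fin_cases i <;> simp [h1, hz]), ?_⟩
      rwa [classEntropy_pairComb_of_fst_eq_zero _ hc0 hz]
    · exact .inr ⟨hz, classEntropy_id_sub_le _ hb hc0 ha' (by linarith)⟩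

end Regions

/-! ### Random matrices and dithers: uniformity, injectivity, multicoding. -/

section RandomLinear

variable {F : Type*} [Field F] [Fintype F] [DecidableEq F]

/-- All fibres of a surjective homomorphism have the same size, so the image of a uniform element is
uniform. All probabilities over codebooks are computed this way, in the form of counts. -/
lemma card_mul_sum_comp_of_surjective {A B : Type*} [AddCommGroup A] [AddCommGroup B] [Fintype A]
    [Fintype B] (φ : A →+ B) (hφ : Function.Surjective φ) (f : B → ℝ) :
    (Fintype.card B : ℝ) * ∑ x, f (φ x) = Fintype.card A * ∑ y, f y := by
  classical
  have hfib : ∀ y, (Finset.univ.filter fun x => φ x = y).card =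
      (Finset.univ.filter fun x => φ x = 0).card := by
    intro y
    obtain ⟨x₀, rfl⟩ := hφ y
    refine Finset.card_bij' (fun x _ => x - x₀) (fun x _ => x + x₀) ?_ ?_ ?_ ?_ <;>
      simp +contextual
  have h : ∀ f : B → ℝ, ∑ x, f (φ x) =
      (Finset.univ.filter fun x => φ x = 0).card * ∑ y, f y := by
    intro f
    rw [← Finset.sum_fiberwise (s := Finset.univ) (g := φ), Finset.mul_sum]
    refine Finset.sum_congr rfl fun y _ => ?_
    rw [Finset.sum_congr rfl (fun x hx => by rw [(Finset.mem_filter.1 hx).2]), Finset.sum_const,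
      hfib y, nsmul_eq_mul]
  have h1 := h fun _ => 1
  simp only [Finset.sum_const, Finset.card_univ, nsmul_eq_mul, mul_one] at h1
  rw [h f, h1]
  ring

lemma exists_vecMul_eq {κ n : ℕ} {ι : Type*} [Fintype ι] [DecidableEq ι] (η : ι → Fin κ → F)
    (hη : LinearIndependent F η) (z : ι → Fin n → F) :
    ∃ G : Matrix (Fin κ) (Fin n) F, ∀ i, η i ᵥ* G = z i := by
  obtain ⟨g, hg⟩ := LinearMap.exists_leftInverse_of_injective (Fintype.linearCombination F η)
    (LinearMap.ker_eq_bot.2 hη.fintypeLinearCombination_injective)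
  refine ⟨LinearMap.toMatrixRight' (Fintype.linearCombination F z ∘ₗ g), fun i => ?_⟩
  have h1 : Fintype.linearCombination F η (Pi.single i 1) = η i := by simp
  have h2 : g (η i) = Pi.single i 1 := by
    rw [← h1]; exact LinearMap.congr_fun hg _
  rw [← Matrix.toLinearMapRight'_apply]
  simp [h2]

/-- Right multiplication by a matrix, as an additive map in the matrix. -/
def vecMulHom {κ n : ℕ} (η : Fin κ → F) : Matrix (Fin κ) (Fin n) F →+ (Fin n → F) where
  toFun G := η ᵥ* G
  map_zero' := Matrix.vecMul_zero _
  map_add' _ _ := Matrix.vecMul_add _ _ _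

lemma vecMulHom_surjective {κ n : ℕ} {η : Fin κ → F} (hη : η ≠ 0) :
    Function.Surjective (vecMulHom (n := n) η) := by
  intro z
  obtain ⟨G, hG⟩ := exists_vecMul_eq (ι := Unit) (fun _ => η)
    (LinearIndependent.of_subsingleton () hη) fun _ => z
  exact ⟨G, hG ()⟩

lemma vecMulHom_prod_surjective {κ n : ℕ} {η₁ η₂ : Fin κ → F}
    (h : ∀ b : Fin 2 → F, b 0 • η₁ + b 1 • η₂ = 0 → b = 0) :
    Function.Surjective ((vecMulHom (n := n) η₁).prod (vecMulHom η₂)) := by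
  rintro ⟨z₁, z₂⟩
  obtain ⟨G, hG⟩ := exists_vecMul_eq ![η₁, η₂] (by
    rw [Fintype.linearIndependent_iff]
    intro b hb i
    exact congrFun (h b (by simpa [Fin.sum_univ_two] using hb)) i) ![z₁, z₂]
  exact ⟨G, Prod.ext (hG 0) (hG 1)⟩

lemma sum_vecMul {κ n : ℕ} {η : Fin κ → F} (hη : η ≠ 0) (f : (Fin n → F) → ℝ) :
    (Fintype.card F : ℝ) ^ n * ∑ G : Matrix (Fin κ) (Fin n) F, f (η ᵥ* G) =
      Fintype.card (Matrix (Fin κ) (Fin n) F) * ∑ z, f z := by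
  have := card_mul_sum_comp_of_surjective (vecMulHom (n := n) η) (vecMulHom_surjective hη) f
  simpa [vecMulHom] using this

lemma sum_vecMul_pair {κ n : ℕ} {η₁ η₂ : Fin κ → F}
    (h : ∀ b : Fin 2 → F, b 0 • η₁ + b 1 • η₂ = 0 → b = 0)
    (f : (Fin n → F) × (Fin n → F) → ℝ) :
    ((Fintype.card F : ℝ) ^ n * (Fintype.card F : ℝ) ^ n) *
        ∑ G : Matrix (Fin κ) (Fin n) F, f (η₁ ᵥ* G, η₂ ᵥ* G) =
      Fintype.card (Matrix (Fin κ) (Fin n) F) * ∑ z, f z := by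
  have := card_mul_sum_comp_of_surjective _ (vecMulHom_prod_surjective (n := n) h) f
  simpa [vecMulHom] using this

/-- Union bound over the nonzero `η`: each product `η ᵥ* G` is uniform, hence zero with probability
`q⁻ⁿ`. A matrix without such `η` makes both encoders one-to-one. -/
lemma card_exists_vecMul_eq_zero_le (κ n : ℕ) :
    (Fintype.card F : ℝ) ^ n * ∑ G : Matrix (Fin κ) (Fin n) F,
        (open scoped Classical in if ∃ η : Fin κ → F, η ≠ 0 ∧ η ᵥ* G = 0 then (1 : ℝ) else 0) ≤
      Fintype.card (Matrix (Fin κ) (Fin n) F) * (Fintype.card F : ℝ) ^ κ := by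
  classical
  have h1 : ∀ G : Matrix (Fin κ) (Fin n) F,
      (if ∃ η : Fin κ → F, η ≠ 0 ∧ η ᵥ* G = 0 then (1 : ℝ) else 0) ≤
      ∑ η ∈ Finset.univ.filter fun η : Fin κ → F => η ≠ 0, if η ᵥ* G = 0 then 1 else 0 := by
    intro G
    split_ifs with h
    · obtain ⟨η, h0, hη⟩ := h
      calc (1 : ℝ) = if η ᵥ* G = 0 then 1 else 0 := by rw [if_pos hη]
        _ ≤ _ := Finset.single_le_sum (f := fun η : Fin κ → F =>
            if η ᵥ* G = 0 then (1 : ℝ) else 0) (fun _ _ => by split_ifs <;> simp)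
            (Finset.mem_filter.2 ⟨Finset.mem_univ _, h0⟩)
    · exact Finset.sum_nonneg fun _ _ => by split_ifs <;> simp
  calc _ ≤ (Fintype.card F : ℝ) ^ n * ∑ G : Matrix (Fin κ) (Fin n) F,
        ∑ η ∈ Finset.univ.filter fun η : Fin κ → F => η ≠ 0, if η ᵥ* G = 0 then 1 else 0 := by
        gcongr with G; exact h1 G
    _ = ∑ η ∈ Finset.univ.filter fun η : Fin κ → F => η ≠ 0,
          (Fintype.card (Matrix (Fin κ) (Fin n) F) : ℝ) := by
        rw [Finset.sum_comm, Finset.mul_sum]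
        refine Finset.sum_congr rfl fun η hη => ?_
        rw [sum_vecMul (Finset.mem_filter.1 hη).2 fun z => if z = 0 then (1 : ℝ) else 0]
        simp
    _ ≤ _ := by
        rw [Finset.sum_const, nsmul_eq_mul, mul_comm]
        gcongr
        calc ((Finset.univ.filter fun η : Fin κ → F => η ≠ 0).card : ℝ)
            ≤ (Finset.univ : Finset (Fin κ → F)).card := by
              exact_mod_cast Finset.card_filter_le _ _
          _ = _ := by simp

lemma padConcat_sub {s t κ : ℕ} (v v' : Fin s → F) (l l' : Fin t → F) :
    padConcat κ (v - v') (l - l') = padConcat κ v l - padConcat κ v' l' := by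
  ext i
  simp only [padConcat, Pi.sub_apply]
  split_ifs <;> simp

lemma padConcat_injective {s t κ : ℕ} (h : s + t ≤ κ) {v v' : Fin s → F} {l l' : Fin t → F}
    (he : padConcat κ v l = padConcat κ v' l') : v = v' ∧ l = l' := by
  constructor
  · ext i
    have := congrFun he ⟨i, by omega⟩
    simpa [padConcat] using this
  · ext i
    have := congrFun he ⟨s + i, by omega⟩
    simpa [padConcat] using this

lemma codeword_injective {s t κ n : ℕ} (h : s + t ≤ κ) {G : Matrix (Fin κ) (Fin n) F}
    (hG : ∀ η, η ᵥ* G = 0 → η = 0) {d : Fin n → F} {v v' : Fin s → F} {l l' : Fin t → F}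
    (he : codeword G d v l = codeword G d v' l') : v = v' ∧ l = l' := by
  refine padConcat_injective h (sub_eq_zero.1 (hG _ ?_))
  rw [Matrix.sub_vecMul, sub_eq_zero]
  exact add_right_cancel he

/-- The pair of codewords of two indices, as an additive map in the matrix and the dither. -/
def affinePairHom {κ n : ℕ} (η η' : Fin κ → F) :
    Matrix (Fin κ) (Fin n) F × (Fin n → F) →+ (Fin n → F) × (Fin n → F) where
  toFun c := (η ᵥ* c.1 + c.2, η' ᵥ* c.1 + c.2)
  map_zero' := by simp
  map_add' c c' := by
    simp only [Prod.fst_add, Prod.snd_add, Matrix.vecMul_add, Prod.mk_add_mk, Prod.mk.injEq]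
    constructor <;> abel

/-- The matrix can realize the difference `z - z'` because `η - η' ≠ 0`; the dither then shifts the
first codeword to `z`. This is the pairwise independence of the codewords of one user. -/
lemma affinePairHom_surjective {κ n : ℕ} {η η' : Fin κ → F} (h : η ≠ η') :
    Function.Surjective (affinePairHom (n := n) η η') := by
  rintro ⟨z, z'⟩
  obtain ⟨G, hG⟩ := vecMulHom_surjective (n := n) (sub_ne_zero.2 h) (z - z')
  change (η - η') ᵥ* G = z - z' at hG
  rw [Matrix.sub_vecMul] at hG
  refine ⟨(G, z - η ᵥ* G), ?_⟩
  simp only [affinePairHom, AddMonoidHom.coe_mk, ZeroHom.coe_mk, Prod.mk.injEq]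
  refine ⟨by abel, ?_⟩
  have : η' ᵥ* G = η ᵥ* G - (z - z') := by rw [← hG]; abel
  rw [this]; abel

/-- Second moment bound for the event that no auxiliary index yields a codeword in `T`. -/
lemma card_forall_codeword_notMem_le {s t κ : ℕ} (n : ℕ) (h : s + t ≤ κ) (v : Fin s → F)
    (T : Finset (Fin n → F)) :
    ((Fintype.card F : ℝ) ^ t * T.card) * ∑ c : Matrix (Fin κ) (Fin n) F × (Fin n → F),
        (if ∀ l : Fin t → F, codeword c.1 c.2 v l ∉ T then (1 : ℝ) else 0) ≤
      (Fintype.card F : ℝ) ^ n *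
        (Fintype.card (Matrix (Fin κ) (Fin n) F) * (Fintype.card F : ℝ) ^ n) := by
  set N : ℝ := ((Fintype.card (Matrix (Fin κ) (Fin n) F) : ℕ) : ℝ)
  set Q : ℝ := (Fintype.card F : ℝ) ^ n with hQ
  set L : ℝ := (Fintype.card F : ℝ) ^ t with hL
  set τ : ℝ := (T.card : ℝ) with hτ
  have hQ0 : 0 < Q := by have := Fintype.card_pos (α := F); positivity
  have hN0 : 0 ≤ N := by positivity
  have hL0 : 0 ≤ L := by positivity
  have hτ0 : 0 ≤ τ := by positivity
  let ind : (Fin n → F) → ℝ := fun z => if z ∈ T then 1 else 0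
  have hind : ∑ z, ind z = τ := by simp [ind, hτ]
  -- The number of auxiliary indices whose codeword lies in `T`. Its mean is `L * τ / Q`; below
  -- everything is scaled by `Q` to avoid division.
  let S : Matrix (Fin κ) (Fin n) F × (Fin n → F) → ℝ := fun c =>
    ∑ l : Fin t → F, ind (codeword c.1 c.2 v l)
  have hcardL : (∑ _l : Fin t → F, (1 : ℝ)) = L := by simp [hL]
  have h1 : ∀ l : Fin t → F, ∑ c : Matrix (Fin κ) (Fin n) F × (Fin n → F),
      ind (codeword c.1 c.2 v l) = N * τ := by
    intro l
    rw [Fintype.sum_prod_type]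
    have : ∀ G : Matrix (Fin κ) (Fin n) F, ∑ d : Fin n → F, ind (codeword G d v l) = τ := by
      intro G
      rw [← hind, ← Equiv.sum_comp (Equiv.addLeft (padConcat κ v l ᵥ* G)) ind]
      rfl
    simp_rw [this]
    simp [N]
  have h2 : ∀ l l' : Fin t → F, l ≠ l' → Q * ∑ c : Matrix (Fin κ) (Fin n) F × (Fin n → F),
      ind (codeword c.1 c.2 v l) * ind (codeword c.1 c.2 v l') = N * τ * τ := by
    intro l l' hl
    have hne : padConcat κ v l ≠ padConcat κ v l' := fun he => hl (padConcat_injective h he).2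
    have := card_mul_sum_comp_of_surjective _ (affinePairHom_surjective (n := n) hne)
      fun z => ind z.1 * ind z.2
    rw [Fintype.sum_prod_type (f := fun z : (Fin n → F) × (Fin n → F) => ind z.1 * ind z.2)] at this
    simp only [← Finset.sum_mul_sum, hind] at this
    have hc1 : (Fintype.card ((Fin n → F) × (Fin n → F)) : ℝ) = Q * Q := by simp [hQ]
    have hc2 : (Fintype.card (Matrix (Fin κ) (Fin n) F × (Fin n → F)) : ℝ) = N * Q := by
      simp [N, hQ]
    rw [hc1, hc2] at this
    have h3 : Q * (Q * ∑ c : Matrix (Fin κ) (Fin n) F × (Fin n → F),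
      ind (codeword c.1 c.2 v l) * ind (codeword c.1 c.2 v l')) = Q * (N * τ * τ) := by
      calc _ = Q * Q * ∑ c : Matrix (Fin κ) (Fin n) F × (Fin n → F),
            ind (codeword c.1 c.2 v l) * ind (codeword c.1 c.2 v l') := by ring
        _ = N * Q * (τ * τ) := this
        _ = _ := by ring
    exact mul_left_cancel₀ hQ0.ne' h3
  have hS1 : ∑ c, S c = L * (N * τ) := by
    simp only [S]
    rw [Finset.sum_comm]
    simp_rw [h1]
    rw [← hcardL, Finset.sum_mul]; simp
  have hS2 : Q * ∑ c, S c ^ 2 ≤ L * (Q * (N * τ)) + L * L * (N * τ * τ) := by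
    have : ∀ c, S c ^ 2 = ∑ l : Fin t → F, ∑ l' : Fin t → F,
        ind (codeword c.1 c.2 v l) * ind (codeword c.1 c.2 v l') := by
      intro c; simp only [S, sq, Finset.sum_mul_sum]
    simp_rw [this]
    rw [Finset.sum_comm, Finset.mul_sum]
    calc _ ≤ ∑ _l : Fin t → F, (Q * (N * τ) + L * (N * τ * τ)) := by
          refine Finset.sum_le_sum fun l _ => ?_
          rw [Finset.sum_comm, Finset.mul_sum]
          calc _ ≤ ∑ l' : Fin t → F, ((if l' = l then Q * (N * τ) else 0) + N * τ * τ) := by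
                refine Finset.sum_le_sum fun l' _ => ?_
                split_ifs with hl
                · subst hl
                  have : ∀ z, ind z * ind z = ind z := by
                    intro z; simp only [ind]; split_ifs <;> simp
                  simp_rw [this, h1]
                  have : 0 ≤ N * τ * τ := by positivity
                  linarith
                · rw [h2 l l' (Ne.symm hl)]; simp
            _ = _ := by
                rw [Finset.sum_add_distrib, Finset.sum_ite_eq', if_pos (Finset.mem_univ _),
                  ← hcardL, Finset.sum_mul]
                simp
      _ = _ := by
          rw [← hcardL, Finset.sum_const, Finset.sum_const]; simp; ring
  set B := ∑ c : Matrix (Fin κ) (Fin n) F × (Fin n → F),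
        (if ∀ l : Fin t → F, codeword c.1 c.2 v l ∉ T then (1 : ℝ) else 0) with hB
  have hB0 : 0 ≤ B := Finset.sum_nonneg fun _ _ => by split_ifs <;> simp
  -- Chebyshev's inequality: on the bad event `S = 0`, so the scaled deviation is the whole mean.
  have hcheb : (L * τ) ^ 2 * B ≤ ∑ c, (Q * S c - L * τ) ^ 2 := by
    rw [hB, Finset.mul_sum]
    refine Finset.sum_le_sum fun c _ => ?_
    split_ifs with hc
    · have : S c = 0 := Finset.sum_eq_zero fun l _ => by simp [ind, hc l]
      rw [this]; simp
    · simp; positivity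
  have hexp : ∑ c, (Q * S c - L * τ) ^ 2 ≤ Q * Q * (L * (N * τ)) := by
    have : ∀ c, (Q * S c - L * τ) ^ 2 = Q * (Q * S c ^ 2) - 2 * Q * (L * τ) * S c + (L * τ) ^ 2 := by
      intro c; ring
    simp_rw [this]
    rw [Finset.sum_add_distrib, Finset.sum_sub_distrib, ← Finset.mul_sum, ← Finset.mul_sum,
      ← Finset.mul_sum, hS1, Finset.sum_const, nsmul_eq_mul]
    have hc2 : ((Finset.univ : Finset (Matrix (Fin κ) (Fin n) F × (Fin n → F))).card : ℝ) =
        N * Q := by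
      simp [N, hQ]
    rw [hc2]
    nlinarith [mul_le_mul_of_nonneg_left hS2 hQ0.le]
  rcases eq_or_lt_of_le (mul_nonneg hL0 hτ0) with h0 | hpos
  · rw [← h0, zero_mul]; positivity
  · have := hcheb.trans hexp
    refine le_of_mul_le_mul_left ?_ hpos
    calc L * τ * (L * τ * B) = (L * τ) ^ 2 * B := by ring
      _ ≤ Q * Q * (L * (N * τ)) := this
      _ = _ := by ring

end RandomLinear

/-! ### The decoder and the random coding bound. -/

section RandomCoding

variable {F Y : Type*} [Field F] [Fintype F] [DecidableEq F] [MeasurableSpace F]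
  [DiscreteMeasurableSpace F] [MeasurableSpace Y]

/-- The componentwise linear combination of two sequences. -/
def seqComb {n : ℕ} (a : Fin 2 → F) (u₁ u₂ : Fin n → F) : Fin n → F := fun i =>
  linComb a (u₁ i) (u₂ i)

lemma seqComb_add {n : ℕ} (a : Fin 2 → F) (u₁ u₂ z₁ z₂ : Fin n → F) :
    seqComb a (u₁ + z₁) (u₂ + z₂) = seqComb a u₁ u₂ + seqComb a z₁ z₂ := by
  ext i; simp [seqComb, linComb]; ring

/-- An auxiliary index whose codeword lies in `T`, if there is one. -/
def selectIndex {s t κ n : ℕ} (G : Matrix (Fin κ) (Fin n) F) (d : Fin n → F)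
    (T : Finset (Fin n → F)) (v : Fin s → F) : Fin t → F :=
  open scoped Classical in
  if h : ∃ l : Fin t → F, codeword G d v l ∈ T then h.choose else 0

lemma codeword_selectIndex_mem {s t κ n : ℕ} {G : Matrix (Fin κ) (Fin n) F} {d : Fin n → F}
    {T : Finset (Fin n → F)} {v : Fin s → F} (h : ∃ l : Fin t → F, codeword G d v l ∈ T) :
    codeword G d v (selectIndex (t := t) G d T v) ∈ T := by
  unfold selectIndex
  rw [dif_pos h]
  exact h.choose_spec

/-- The linear combination of some pair in a set of candidates. -/
def pickComb {n : ℕ} (a : Fin 2 → F) (S : Set ((Fin n → F) × (Fin n → F))) : Fin n → F :=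
  open scoped Classical in
  if h : S.Nonempty then seqComb a h.some.1 h.some.2 else 0

/-- The decoder that tests all pairs of candidates. -/
def testDecoder {n : ℕ} (a : Fin 2 → F) (C : Set ((Fin n → F) × (Fin n → F)))
    (A : (Fin n → F) → (Fin n → F) → Set (Fin n → Y)) (y : Fin n → Y) : Fin n → F :=
  pickComb a {p | p ∈ C ∧ y ∈ A p.1 p.2}

/-- The estimate depends on `y` only through the set of accepted candidates, an element of a finite
discrete space, so any rule for picking a candidate is measurable. -/
lemma measurable_testDecoder {n : ℕ} (a : Fin 2 → F) (C : Set ((Fin n → F) × (Fin n → F)))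
    {A : (Fin n → F) → (Fin n → F) → Set (Fin n → Y)}
    (hA : ∀ u₁ u₂, MeasurableSet (A u₁ u₂)) : Measurable (testDecoder a C A) := by
  have h : Measurable fun y => {p : (Fin n → F) × (Fin n → F) | p ∈ C ∧ y ∈ A p.1 p.2} := by
    refine measurable_set_iff.2 fun p => ?_
    refine measurable_to_prop ?_
    by_cases hp : p ∈ C
    · simpa [Set.preimage, hp] using hA p.1 p.2
    · simp [Set.preimage, hp]
  have hd : DiscreteMeasurableSpace (Set ((Fin n → F) × (Fin n → F))) := by
    have : MeasurableSingletonClass (((Fin n → F) × (Fin n → F)) → Prop) := inferInstance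
    have : DiscreteMeasurableSpace (((Fin n → F) × (Fin n → F)) → Prop) := inferInstance
    exact this
  exact (Measurable.of_discrete (f := pickComb a)).comp h

/-- The outputs for which some other pair of codewords passes the test and has another linear
combination. -/
def confusionSet {κ n : ℕ} (a : Fin 2 → F) (s₁ t₁ s₂ t₂ : ℕ)
    (A : (Fin n → F) → (Fin n → F) → Set (Fin n → Y)) (G : Matrix (Fin κ) (Fin n) F)
    (u₁ u₂ : Fin n → F) : Set (Fin n → Y) :=
  {y | ∃ (v₁ : Fin s₁ → F) (l₁ : Fin t₁ → F) (v₂ : Fin s₂ → F) (l₂ : Fin t₂ → F),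
    seqComb a (padConcat κ v₁ l₁ ᵥ* G) (padConcat κ v₂ l₂ ᵥ* G) ≠ 0 ∧
      y ∈ A (u₁ + padConcat κ v₁ l₁ ᵥ* G) (u₂ + padConcat κ v₂ l₂ ᵥ* G)}

lemma measurableSet_confusionSet {κ n : ℕ} (a : Fin 2 → F) (s₁ t₁ s₂ t₂ : ℕ)
    {A : (Fin n → F) → (Fin n → F) → Set (Fin n → Y)} (hA : ∀ u₁ u₂, MeasurableSet (A u₁ u₂))
    (G : Matrix (Fin κ) (Fin n) F) (u₁ u₂ : Fin n → F) :
    MeasurableSet (confusionSet a s₁ t₁ s₂ t₂ A G u₁ u₂) := by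
  have : confusionSet a s₁ t₁ s₂ t₂ A G u₁ u₂ =
      ⋃ (v₁ : Fin s₁ → F) (l₁ : Fin t₁ → F) (v₂ : Fin s₂ → F) (l₂ : Fin t₂ → F),
        {y | seqComb a (padConcat κ v₁ l₁ ᵥ* G) (padConcat κ v₂ l₂ ᵥ* G) ≠ 0} ∩
          A (u₁ + padConcat κ v₁ l₁ ᵥ* G) (u₂ + padConcat κ v₂ l₂ ᵥ* G) := by
    ext y; simp [confusionSet]
  rw [this]
  exact .iUnion fun _ => .iUnion fun _ => .iUnion fun _ => .iUnion fun _ =>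
    (MeasurableSet.const _).inter (hA _ _)

lemma sum_codeword {s t κ n : ℕ} (G : Matrix (Fin κ) (Fin n) F) (v : Fin s → F) (l : Fin t → F)
    (f : (Fin n → F) → ℝ) : ∑ d, f (codeword G d v l) = ∑ z, f z := by
  rw [← Equiv.sum_comp (Equiv.addLeft (padConcat κ v l ᵥ* G)) f]
  rfl

/-- The error probability of one pair of messages is at most the probability of the failure of an
encoder, of the test failing, or of a confusion, summed over all auxiliary indices. -/
lemma real_testDecoder_ne_le {s₁ t₁ s₂ t₂ κ n : ℕ} (a : Fin 2 → F) (T₁ T₂ : Finset (Fin n → F))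
    (W : (Fin n → F) → (Fin n → F) → Measure (Fin n → Y)) [∀ u₁ u₂, IsProbabilityMeasure (W u₁ u₂)]
    (A : (Fin n → F) → (Fin n → F) → Set (Fin n → Y))
    (G : Matrix (Fin κ) (Fin n) F) (d₁ d₂ : Fin n → F) (v₁ : Fin s₁ → F) (v₂ : Fin s₂ → F) :
    let u₁ := codeword G d₁ v₁ (selectIndex (t := t₁) G d₁ T₁ v₁)
    let u₂ := codeword G d₂ v₂ (selectIndex (t := t₂) G d₂ T₂ v₂)
    (W u₁ u₂).real {y | testDecoder a {p | (∃ (v : Fin s₁ → F) (l : Fin t₁ → F),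
        p.1 = codeword G d₁ v l) ∧ ∃ (v : Fin s₂ → F) (l : Fin t₂ → F), p.2 = codeword G d₂ v l}
          A y ≠ seqComb a u₁ u₂} ≤
      (if ∀ l : Fin t₁ → F, codeword G d₁ v₁ l ∉ T₁ then (1 : ℝ) else 0) +
      (if ∀ l : Fin t₂ → F, codeword G d₂ v₂ l ∉ T₂ then (1 : ℝ) else 0) +
      ∑ l₁ : Fin t₁ → F, ∑ l₂ : Fin t₂ → F,
        (fun z₁ z₂ => if z₁ ∈ T₁ ∧ z₂ ∈ T₂ then (W z₁ z₂).real (A z₁ z₂)ᶜ +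
          (W z₁ z₂).real (confusionSet a s₁ t₁ s₂ t₂ A G z₁ z₂) else 0)
          (codeword G d₁ v₁ l₁) (codeword G d₂ v₂ l₂) := by
  intro u₁ u₂
  set g : (Fin n → F) → (Fin n → F) → ℝ := fun z₁ z₂ => if z₁ ∈ T₁ ∧ z₂ ∈ T₂ then
    (W z₁ z₂).real (A z₁ z₂)ᶜ + (W z₁ z₂).real (confusionSet a s₁ t₁ s₂ t₂ A G z₁ z₂) else 0
    with hg
  have hg0 : ∀ z₁ z₂, 0 ≤ g z₁ z₂ := by
    intro z₁ z₂; simp only [hg]; split_ifs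
    · exact add_nonneg measureReal_nonneg measureReal_nonneg
    · exact le_rfl
  have hsum0 : 0 ≤ ∑ l₁ : Fin t₁ → F, ∑ l₂ : Fin t₂ → F,
      g (codeword G d₁ v₁ l₁) (codeword G d₂ v₂ l₂) :=
    Finset.sum_nonneg fun _ _ => Finset.sum_nonneg fun _ _ => hg0 _ _
  by_cases h1 : ∀ l : Fin t₁ → F, codeword G d₁ v₁ l ∉ T₁
  · rw [if_pos h1]
    refine (measureReal_le_one).trans ?_
    have : (0 : ℝ) ≤ if ∀ l : Fin t₂ → F, codeword G d₂ v₂ l ∉ T₂ then (1 : ℝ) else 0 := by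
      split_ifs <;> simp
    linarith
  by_cases h2 : ∀ l : Fin t₂ → F, codeword G d₂ v₂ l ∉ T₂
  · rw [if_pos h2, if_neg h1]
    refine (measureReal_le_one).trans ?_
    linarith
  rw [if_neg h1, if_neg h2, zero_add, zero_add]
  push Not at h1 h2
  have hu1 : u₁ ∈ T₁ := codeword_selectIndex_mem h1
  have hu2 : u₂ ∈ T₂ := codeword_selectIndex_mem h2
  -- The selected indices depend on the codebook. Their term is dominated by the sum over all
  -- indices, in which no selection remains.
  refine le_trans ?_ (Finset.single_le_sum (f := fun l₁ : Fin t₁ → F => ∑ l₂ : Fin t₂ → F,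
      g (codeword G d₁ v₁ l₁) (codeword G d₂ v₂ l₂))
      (fun _ _ => Finset.sum_nonneg fun _ _ => hg0 _ _)
      (Finset.mem_univ (selectIndex (t := t₁) G d₁ T₁ v₁)))
  refine le_trans ?_ (Finset.single_le_sum (f := fun l₂ : Fin t₂ → F =>
      g u₁ (codeword G d₂ v₂ l₂)) (fun _ _ => hg0 _ _)
      (Finset.mem_univ (selectIndex (t := t₂) G d₂ T₂ v₂)))
  change _ ≤ g u₁ u₂
  simp only [hg, if_pos (And.intro hu1 hu2)]
  refine (measureReal_mono ?_).trans (measureReal_union_le _ _)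
  intro y hy
  by_cases hyA : y ∈ A u₁ u₂
  · right
    set S := {p : (Fin n → F) × (Fin n → F) | p ∈ {p : (Fin n → F) × (Fin n → F) |
      (∃ (v : Fin s₁ → F) (l : Fin t₁ → F), p.1 = codeword G d₁ v l) ∧
        ∃ (v : Fin s₂ → F) (l : Fin t₂ → F), p.2 = codeword G d₂ v l} ∧ y ∈ A p.1 p.2} with hS
    have hne : S.Nonempty := ⟨(u₁, u₂), ⟨⟨v₁, _, rfl⟩, v₂, _, rfl⟩, hyA⟩
    have hdec : pickComb a S = seqComb a hne.some.1 hne.some.2 := by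
      unfold pickComb; rw [dif_pos hne]
    obtain ⟨⟨⟨w₁, k₁, e1⟩, w₂, k₂, e2⟩, hA'⟩ := hne.some_mem
    -- The dither cancels in the difference of two codewords of one user, so the candidate differs
    -- from the truth by a padded vector times `G`.
    have hd1 : hne.some.1 = u₁ + padConcat κ (w₁ - v₁) (k₁ - selectIndex G d₁ T₁ v₁) ᵥ* G := by
      rw [e1, padConcat_sub, Matrix.sub_vecMul]
      simp only [u₁, codeword]; abel
    have hd2 : hne.some.2 = u₂ + padConcat κ (w₂ - v₂) (k₂ - selectIndex G d₂ T₂ v₂) ᵥ* G := by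
      rw [e2, padConcat_sub, Matrix.sub_vecMul]
      simp only [u₂, codeword]; abel
    refine ⟨_, _, _, _, fun h0 => hy ?_, by rw [← hd1, ← hd2]; exact hA'⟩
    change pickComb a S = _
    rw [hdec, hd1, hd2, seqComb_add, h0, add_zero]
  · exact .inl hyA

/-- Random coding: a bound on the error probability of some nested linear code with multicoding. -/
theorem exists_nested_linear_code {M₁ M₂ s₁ t₁ s₂ t₂ κ n : ℕ} (h₁ : s₁ + t₁ ≤ κ)
    (h₂ : s₂ + t₂ ≤ κ) (hM₁ : 0 < M₁) (hM₂ : 0 < M₂) (a : Fin 2 → F) (T₁ T₂ : Finset (Fin n → F))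
    (hT₁ : T₁.Nonempty) (hT₂ : T₂.Nonempty)
    (W : (Fin n → F) → (Fin n → F) → Measure (Fin n → Y)) [∀ u₁ u₂, IsProbabilityMeasure (W u₁ u₂)]
    (A : (Fin n → F) → (Fin n → F) → Set (Fin n → Y)) (hA : ∀ u₁ u₂, MeasurableSet (A u₁ u₂))
    (ν₁ : Fin M₁ → Fin s₁ → F) (ν₂ : Fin M₂ → Fin s₂ → F) {α β ε : ℝ}
    (hα : ∑ u₁ ∈ T₁, ∑ u₂ ∈ T₂, (W u₁ u₂).real (A u₁ u₂)ᶜ ≤ α)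
    (hβ : ∀ u₁ u₂ y, ∑ G : Matrix (Fin κ) (Fin n) F,
      (confusionSet a s₁ t₁ s₂ t₂ A G u₁ u₂).indicator (fun _ => (1 : ℝ)) y ≤
        Fintype.card (Matrix (Fin κ) (Fin n) F) * β)
    (hε : (Fintype.card F : ℝ) ^ n / ((Fintype.card F : ℝ) ^ t₁ * T₁.card) +
      (Fintype.card F : ℝ) ^ n / ((Fintype.card F : ℝ) ^ t₂ * T₂.card) +
      (Fintype.card F : ℝ) ^ t₁ * (Fintype.card F : ℝ) ^ t₂ /
        ((Fintype.card F : ℝ) ^ n * (Fintype.card F : ℝ) ^ n) * (α + T₁.card * T₂.card * β) +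
      (Fintype.card F : ℝ) ^ κ / (Fintype.card F : ℝ) ^ n ≤ ε) (hε1 : ε < 1) :
    ∃ (G : Matrix (Fin κ) (Fin n) F) (d₁ d₂ : Fin n → F) (l₁ : Fin M₁ → Fin t₁ → F)
      (l₂ : Fin M₂ → Fin t₂ → F) (dec : (Fin n → Y) → Fin n → F), Measurable dec ∧
      (∀ η, η ᵥ* G = 0 → η = 0) ∧
      (∀ m, (∃ l' : Fin t₁ → F, codeword G d₁ (ν₁ m) l' ∈ T₁) →
        codeword G d₁ (ν₁ m) (l₁ m) ∈ T₁) ∧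
      (∀ m, (∃ l' : Fin t₂ → F, codeword G d₂ (ν₂ m) l' ∈ T₂) →
        codeword G d₂ (ν₂ m) (l₂ m) ∈ T₂) ∧
      (∑ m₁, ∑ m₂, (W (codeword G d₁ (ν₁ m₁) (l₁ m₁)) (codeword G d₂ (ν₂ m₂) (l₂ m₂))).real
        {y | dec y ≠ seqComb a (codeword G d₁ (ν₁ m₁) (l₁ m₁)) (codeword G d₂ (ν₂ m₂) (l₂ m₂))}) /
          ((M₁ : ℝ) * M₂) ≤ ε := by
  classical
  set q : ℝ := (Fintype.card F : ℝ) with hq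
  set N : ℝ := ((Fintype.card (Matrix (Fin κ) (Fin n) F) : ℕ) : ℝ) with hN
  have hq0 : 0 < q := by simp only [hq]; exact_mod_cast Fintype.card_pos
  have hN0 : 0 < N := by simp only [hN]; exact_mod_cast Fintype.card_pos
  have hM0 : 0 < (M₁ : ℝ) * M₂ := by positivity
  have hτ₁ : 0 < (T₁.card : ℝ) := by exact_mod_cast hT₁.card_pos
  have hτ₂ : 0 < (T₂.card : ℝ) := by exact_mod_cast hT₂.card_pos
  let C := Matrix (Fin κ) (Fin n) F × (Fin n → F) × (Fin n → F)
  let bad₁ : C → Fin M₁ → ℝ := fun c m =>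
    if ∀ l : Fin t₁ → F, codeword c.1 c.2.1 (ν₁ m) l ∉ T₁ then 1 else 0
  let bad₂ : C → Fin M₂ → ℝ := fun c m =>
    if ∀ l : Fin t₂ → F, codeword c.1 c.2.2 (ν₂ m) l ∉ T₂ then 1 else 0
  let g : Matrix (Fin κ) (Fin n) F → (Fin n → F) → (Fin n → F) → ℝ := fun G z₁ z₂ =>
    if z₁ ∈ T₁ ∧ z₂ ∈ T₂ then (W z₁ z₂).real (A z₁ z₂)ᶜ +
          (W z₁ z₂).real (confusionSet a s₁ t₁ s₂ t₂ A G z₁ z₂) else 0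
  let dec : C → (Fin n → Y) → Fin n → F := fun c =>
    testDecoder a {p | (∃ (v : Fin s₁ → F) (l : Fin t₁ → F), p.1 = codeword c.1 c.2.1 v l) ∧
      ∃ (v : Fin s₂ → F) (l : Fin t₂ → F), p.2 = codeword c.1 c.2.2 v l} A
  let w₁ : C → Fin M₁ → Fin n → F := fun c m =>
    codeword c.1 c.2.1 (ν₁ m) (selectIndex (t := t₁) c.1 c.2.1 T₁ (ν₁ m))
  let w₂ : C → Fin M₂ → Fin n → F := fun c m =>
    codeword c.1 c.2.2 (ν₂ m) (selectIndex (t := t₂) c.1 c.2.2 T₂ (ν₂ m))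
  let err : C → Fin M₁ → Fin M₂ → ℝ := fun c m₁ m₂ =>
    (W (w₁ c m₁) (w₂ c m₂)).real {y | dec c y ≠ seqComb a (w₁ c m₁) (w₂ c m₂)}
  -- A degenerate matrix is charged a full unit. Since the total average is at most `ε < 1`, the
  -- codebook extracted at the end cannot be degenerate.
  let sing : C → ℝ := fun c => if ∃ η : Fin κ → F, η ≠ 0 ∧ η ᵥ* c.1 = 0 then 1 else 0
  have herr : ∀ c m₁ m₂, err c m₁ m₂ ≤ bad₁ c m₁ + bad₂ c m₂ +
      ∑ l₁ : Fin t₁ → F, ∑ l₂ : Fin t₂ → F,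
        g c.1 (codeword c.1 c.2.1 (ν₁ m₁) l₁) (codeword c.1 c.2.2 (ν₂ m₂) l₂) := by
    intro c m₁ m₂
    exact real_testDecoder_ne_le a T₁ T₂ W A c.1 c.2.1 c.2.2 (ν₁ m₁) (ν₂ m₂)
  have hbad₁ : ∀ m, ∑ c, bad₁ c m ≤ N * q ^ n * q ^ n * (q ^ n / (q ^ t₁ * T₁.card)) := by
    intro m
    have h := card_forall_codeword_notMem_le n h₁ (ν₁ m) T₁
    rw [Fintype.sum_prod_type] at h
    have e : ∑ c, bad₁ c m = q ^ n * ∑ G : Matrix (Fin κ) (Fin n) F, ∑ d : Fin n → F,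
        if ∀ l : Fin t₁ → F, codeword G d (ν₁ m) l ∉ T₁ then (1 : ℝ) else 0 := by
      rw [Fintype.sum_prod_type, Finset.mul_sum]
      refine Finset.sum_congr rfl fun G _ => ?_
      rw [Fintype.sum_prod_type, Finset.mul_sum]
      refine Finset.sum_congr rfl fun d _ => ?_
      simp only [bad₁]
      split_ifs <;> simp [hq]
    rw [e, ← mul_div_assoc, le_div_iff₀ (by positivity)]
    nlinarith [mul_le_mul_of_nonneg_left h (by positivity : (0 : ℝ) ≤ q ^ n)]
  have hbad₂ : ∀ m, ∑ c, bad₂ c m ≤ N * q ^ n * q ^ n * (q ^ n / (q ^ t₂ * T₂.card)) := by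
    intro m
    have h := card_forall_codeword_notMem_le n h₂ (ν₂ m) T₂
    rw [Fintype.sum_prod_type] at h
    have e : ∑ c, bad₂ c m = q ^ n * ∑ G : Matrix (Fin κ) (Fin n) F, ∑ d : Fin n → F,
        if ∀ l : Fin t₂ → F, codeword G d (ν₂ m) l ∉ T₂ then (1 : ℝ) else 0 := by
      rw [Fintype.sum_prod_type, Finset.mul_sum]
      refine Finset.sum_congr rfl fun G _ => ?_
      rw [Fintype.sum_prod_type]
      simp [bad₂, hq]
    rw [e, ← mul_div_assoc, le_div_iff₀ (by positivity)]
    nlinarith [mul_le_mul_of_nonneg_left h (by positivity : (0 : ℝ) ≤ q ^ n)]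
  have hsing : ∑ c, sing c ≤ N * q ^ n * q ^ n * (q ^ κ / q ^ n) := by
    have h := card_exists_vecMul_eq_zero_le (F := F) κ n
    have e : ∑ c, sing c = q ^ n * q ^ n * ∑ G : Matrix (Fin κ) (Fin n) F,
        if ∃ η : Fin κ → F, η ≠ 0 ∧ η ᵥ* G = 0 then (1 : ℝ) else 0 := by
      rw [Fintype.sum_prod_type, Finset.mul_sum]
      refine Finset.sum_congr rfl fun G _ => ?_
      simp only [sing]
      split_ifs <;> simp [hq]
    rw [e, ← mul_div_assoc, le_div_iff₀ (by positivity)]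
    calc _ = (q ^ n * q ^ n) * (q ^ n * ∑ G : Matrix (Fin κ) (Fin n) F,
        if ∃ η : Fin κ → F, η ≠ 0 ∧ η ᵥ* G = 0 then (1 : ℝ) else 0) := by ring
      _ ≤ (q ^ n * q ^ n) * (N * q ^ κ) := by
          gcongr
      _ = _ := by ring
  -- The pair sent is now fixed independently of `G`, so the pointwise bound `hβ` can be integrated
  -- over the output.
  have hconf : ∀ z₁ z₂, ∑ G : Matrix (Fin κ) (Fin n) F, (W z₁ z₂).real (confusionSet a s₁ t₁ s₂ t₂ A G z₁ z₂) ≤ N * β := by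
    intro z₁ z₂
    have hm : ∀ G : Matrix (Fin κ) (Fin n) F,
        MeasurableSet (confusionSet a s₁ t₁ s₂ t₂ A G z₁ z₂) := fun G =>
      measurableSet_confusionSet a s₁ t₁ s₂ t₂ hA G z₁ z₂
    calc _ = ∑ G : Matrix (Fin κ) (Fin n) F, ∫ y,
          (confusionSet a s₁ t₁ s₂ t₂ A G z₁ z₂).indicator (fun _ => (1 : ℝ)) y ∂W z₁ z₂ := by
          refine Finset.sum_congr rfl fun G _ => ?_
          rw [integral_indicator_const _ (hm G)]; simp
      _ = ∫ y, ∑ G : Matrix (Fin κ) (Fin n) F,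
          (confusionSet a s₁ t₁ s₂ t₂ A G z₁ z₂).indicator (fun _ => (1 : ℝ)) y ∂W z₁ z₂ := by
          rw [integral_finsetSum]
          exact fun G _ => (integrable_const _).indicator (hm G)
      _ ≤ ∫ _, N * β ∂W z₁ z₂ := by
          refine integral_mono (integrable_finsetSum _ fun G _ =>
            (integrable_const _).indicator (hm G)) (integrable_const _) fun y => hβ z₁ z₂ y
      _ = _ := by simp
  have hg : ∑ G, ∑ z₁, ∑ z₂, g G z₁ z₂ ≤ N * (α + T₁.card * T₂.card * β) := by
    have e : ∀ G, ∑ z₁, ∑ z₂, g G z₁ z₂ = ∑ z₁ ∈ T₁, ∑ z₂ ∈ T₂, ((W z₁ z₂).real (A z₁ z₂)ᶜ +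
          (W z₁ z₂).real (confusionSet a s₁ t₁ s₂ t₂ A G z₁ z₂)) := by
      intro G
      rw [← Finset.sum_subset (Finset.subset_univ T₁)
        (fun z _ hz => Finset.sum_eq_zero fun w _ => by simp [g, hz])]
      refine Finset.sum_congr rfl fun z₁ hz₁ => ?_
      rw [← Finset.sum_subset (Finset.subset_univ T₂) (fun w _ hw => by simp [g, hw])]
      exact Finset.sum_congr rfl fun z₂ hz₂ => by simp [g, hz₁, hz₂]
    simp_rw [e, Finset.sum_add_distrib]
    rw [mul_add]
    refine add_le_add ?_ ?_
    · rw [Finset.sum_const, nsmul_eq_mul]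
      exact mul_le_mul_of_nonneg_left hα hN0.le
    · rw [Finset.sum_comm]
      calc _ ≤ ∑ z₁ ∈ T₁, ∑ z₂ ∈ T₂, N * β := by
            refine Finset.sum_le_sum fun z₁ _ => ?_
            rw [Finset.sum_comm]
            exact Finset.sum_le_sum fun z₂ _ => hconf z₁ z₂
        _ = _ := by simp; ring
  have hgsum : ∀ m₁ m₂, ∑ c : C, ∑ l₁ : Fin t₁ → F, ∑ l₂ : Fin t₂ → F,
        g c.1 (codeword c.1 c.2.1 (ν₁ m₁) l₁) (codeword c.1 c.2.2 (ν₂ m₂) l₂) ≤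
      N * q ^ n * q ^ n * (q ^ t₁ * q ^ t₂ / (q ^ n * q ^ n) * (α + T₁.card * T₂.card * β)) := by
    intro m₁ m₂
    -- For fixed `G` and indices, translation by the dithers is a bijection, so the two codewords
    -- run over all pairs of sequences. This decouples them from `G`.
    have e : ∑ c : C, ∑ l₁ : Fin t₁ → F, ∑ l₂ : Fin t₂ → F,
        g c.1 (codeword c.1 c.2.1 (ν₁ m₁) l₁) (codeword c.1 c.2.2 (ν₂ m₂) l₂) =
        q ^ t₁ * q ^ t₂ * ∑ G, ∑ z₁, ∑ z₂, g G z₁ z₂ := by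
      rw [Fintype.sum_prod_type, Finset.mul_sum]
      refine Finset.sum_congr rfl fun G _ => ?_
      rw [Fintype.sum_prod_type]
      calc _ = ∑ l₁ : Fin t₁ → F, ∑ l₂ : Fin t₂ → F, ∑ d₁, ∑ d₂,
            g G (codeword G d₁ (ν₁ m₁) l₁) (codeword G d₂ (ν₂ m₂) l₂) := by
            simp only [Finset.sum_comm (s := (Finset.univ : Finset (Fin n → F)))
              (t := (Finset.univ : Finset (Fin t₁ → F))),
              Finset.sum_comm (s := (Finset.univ : Finset (Fin n → F)))
              (t := (Finset.univ : Finset (Fin t₂ → F)))]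
        _ = ∑ l₁ : Fin t₁ → F, ∑ l₂ : Fin t₂ → F, ∑ z₁, ∑ z₂, g G z₁ z₂ := by
            refine Finset.sum_congr rfl fun l₁ _ => Finset.sum_congr rfl fun l₂ _ => ?_
            rw [sum_codeword G (ν₁ m₁) l₁ fun z₁ => ∑ d₂, g G z₁ (codeword G d₂ (ν₂ m₂) l₂)]
            exact Finset.sum_congr rfl fun z₁ _ => sum_codeword G (ν₂ m₂) l₂ fun z₂ => g G z₁ z₂
        _ = _ := by simp [hq]; ring
    rw [e]
    calc _ ≤ q ^ t₁ * q ^ t₂ * (N * (α + T₁.card * T₂.card * β)) := by gcongr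
      _ = _ := by field_simp
  set B := q ^ n / (q ^ t₁ * T₁.card) + q ^ n / (q ^ t₂ * T₂.card) +
      q ^ t₁ * q ^ t₂ / (q ^ n * q ^ n) * (α + T₁.card * T₂.card * β) with hB
  have herrsum : ∀ m₁ m₂, ∑ c, err c m₁ m₂ ≤ N * q ^ n * q ^ n * B := by
    intro m₁ m₂
    calc _ ≤ ∑ c : C, (bad₁ c m₁ + bad₂ c m₂ + ∑ l₁ : Fin t₁ → F, ∑ l₂ : Fin t₂ → F,
        g c.1 (codeword c.1 c.2.1 (ν₁ m₁) l₁) (codeword c.1 c.2.2 (ν₂ m₂) l₂)) :=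
          Finset.sum_le_sum fun c _ => herr c m₁ m₂
      _ ≤ _ := by
        rw [Finset.sum_add_distrib, Finset.sum_add_distrib, hB, mul_add, mul_add]
        exact add_le_add (add_le_add (hbad₁ m₁) (hbad₂ m₂)) (hgsum m₁ m₂)
  have htot : ∑ c : C, ((∑ m₁, ∑ m₂, err c m₁ m₂) / ((M₁ : ℝ) * M₂) + sing c) ≤
      ∑ _c : C, ε := by
    have e : (∑ _c : C, ε) = N * q ^ n * q ^ n * ε := by
      rw [Finset.sum_const, nsmul_eq_mul]
      simp [C, hN, hq]; left; ring
    rw [e, Finset.sum_add_distrib, ← Finset.sum_div]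
    have h1 : (∑ c : C, ∑ m₁, ∑ m₂, err c m₁ m₂) / ((M₁ : ℝ) * M₂) ≤ N * q ^ n * q ^ n * B := by
      rw [div_le_iff₀ hM0, Finset.sum_comm]
      calc _ ≤ ∑ _m₁ : Fin M₁, ∑ _m₂ : Fin M₂, N * q ^ n * q ^ n * B := by
            refine Finset.sum_le_sum fun m₁ _ => ?_
            rw [Finset.sum_comm]
            exact Finset.sum_le_sum fun m₂ _ => herrsum m₁ m₂
        _ = _ := by simp; ring
    calc _ ≤ N * q ^ n * q ^ n * B + N * q ^ n * q ^ n * (q ^ κ / q ^ n) := add_le_add h1 hsing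
      _ = N * q ^ n * q ^ n * (B + q ^ κ / q ^ n) := by ring
      _ ≤ _ := by gcongr
  obtain ⟨c, -, hc⟩ := Finset.exists_le_of_sum_le Finset.univ_nonempty htot
  have herr0 : 0 ≤ (∑ m₁, ∑ m₂, err c m₁ m₂) / ((M₁ : ℝ) * M₂) :=
    div_nonneg (Finset.sum_nonneg fun _ _ => Finset.sum_nonneg fun _ _ => measureReal_nonneg) hM0.le
  have hs : ¬ ∃ η : Fin κ → F, η ≠ 0 ∧ η ᵥ* c.1 = 0 := by
    intro h
    have : sing c = 1 := if_pos h
    linarith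
  have hs0 : sing c = 0 := if_neg hs
  refine ⟨c.1, c.2.1, c.2.2, fun m => selectIndex c.1 c.2.1 T₁ (ν₁ m),
    fun m => selectIndex c.1 c.2.2 T₂ (ν₂ m), dec c, measurable_testDecoder a _ hA, ?_, ?_, ?_, ?_⟩
  · intro η hη
    by_contra h
    exact hs ⟨η, h, hη⟩
  · exact fun m hm => codeword_selectIndex_mem hm
  · exact fun m hm => codeword_selectIndex_mem hm
  · rw [hs0, add_zero] at hc
    exact hc

end RandomCoding

/-! ### Chernoff bounds and typical sequences. -/

section Chernoff

variable {F : Type*} [Field F] [Fintype F] [DecidableEq F] [MeasurableSpace F]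
  [DiscreteMeasurableSpace F]

/-- At `t = 0` both sides equal 1, and the derivative `θ` of the right-hand side exceeds the
derivative `μ[X]` of the left-hand side; hence the inequality for small `t > 0`. -/
lemma exists_mgf_lt_exp {Ω : Type*} [MeasurableSpace Ω] {μ : Measure Ω} [IsProbabilityMeasure μ]
    {X : Ω → ℝ} (h : 0 ∈ interior (integrableExpSet X μ)) {θ : ℝ} (hθ : μ[X] < θ) :
    ∃ t, 0 < t ∧ t ∈ integrableExpSet X μ ∧ mgf X μ t < Real.exp (t * θ) := by
  have h1 : HasDerivAt (mgf X μ) (μ[X]) 0 := by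
    have := hasDerivAt_mgf h
    simpa using this
  have h2 : HasDerivAt (fun t => Real.exp (t * θ)) θ 0 := by
    have := ((hasDerivAt_id (0 : ℝ)).mul_const θ).exp
    simpa using this
  have h3 := h2.sub h1
  have h4 := eventually_nhdsWithin_sign_eq_of_deriv_pos
    (f := (fun t => Real.exp (t * θ)) - mgf X μ) (x₀ := 0)
    (by rw [h3.deriv]; linarith) (by simp)
  have h5 : ∀ᶠ t in 𝓝[>] (0 : ℝ), t ∈ integrableExpSet X μ :=
    nhdsWithin_le_nhds (mem_interior_iff_mem_nhds.1 h)
  have h6 := h4.filter_mono (nhdsWithin_le_nhds (s := Set.Ioi (0 : ℝ)))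
  obtain ⟨t, ht1, ht2, ht3⟩ := (h6.and (h5.and self_mem_nhdsWithin)).exists
  refine ⟨t, ht3, ht2, ?_⟩
  have ht3' : (0 : ℝ) < t := ht3
  rw [sub_zero, sign_pos ht3', sign_eq_one_iff] at ht1
  simpa using ht1

lemma sum_prod_eq_pow {ι R : Type*} [Fintype ι] [DecidableEq ι] [CommSemiring R] (n : ℕ)
    (f : ι → R) : ∑ u : Fin n → ι, ∏ i, f (u i) = (∑ v, f v) ^ n := by
  have := Finset.prod_univ_sum (fun _ : Fin n => (Finset.univ : Finset ι)) fun _ v => f v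
  simp only [Finset.prod_const, Finset.card_univ, Fintype.card_fin, Fintype.piFinset_univ] at this
  exact this.symm

/-- The probability of a sequence under the memoryless source with marginal `p`. -/
def seqProb (p : PMF F) {n : ℕ} (u : Fin n → F) : ℝ := ∏ i, (p (u i)).toReal

lemma seqProb_nonneg (p : PMF F) {n : ℕ} (u : Fin n → F) : 0 ≤ seqProb p u :=
  Finset.prod_nonneg fun _ _ => ENNReal.toReal_nonneg

lemma sum_pmf_toReal (p : PMF F) : ∑ v, (p v).toReal = 1 := by
  rw [← ENNReal.toReal_sum fun v _ => p.apply_ne_top v, ← tsum_fintype (L := .unconditional F), p.tsum_coe,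
    ENNReal.toReal_one]

lemma sum_seqProb (p : PMF F) (n : ℕ) : ∑ u : Fin n → F, seqProb p u = 1 := by
  unfold seqProb
  rw [sum_prod_eq_pow n fun v => (p v).toReal, sum_pmf_toReal, one_pow]

lemma exists_seqProb_ge_le (p : PMF F) (X : F → ℝ) {θ : ℝ} (hθ : ∑ v, (p v).toReal * X v < θ) :
    ∃ ρ : ℝ, 0 ≤ ρ ∧ ρ < 1 ∧ ∀ n : ℕ,
      ∑ u : Fin n → F, seqProb p u * (if (n : ℝ) * θ ≤ ∑ i, X (u i) then 1 else 0) ≤ ρ ^ n := by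
  have hp : ∀ v, p.toMeasure.real {v} = (p v).toReal := fun v => by
    rw [measureReal_def, PMF.toMeasure_apply_singleton _ _ (measurableSet_singleton _)]
  have hE : ∀ f : F → ℝ, ∫ v, f v ∂p.toMeasure = ∑ v, (p v).toReal * f v := by
    intro f
    rw [integral_fintype .of_finite]
    simp [hp]
  have hs : integrableExpSet X p.toMeasure = Set.univ := by
    ext t; simp [integrableExpSet, Integrable.of_finite]
  obtain ⟨t, ht0, -, ht⟩ := exists_mgf_lt_exp (μ := p.toMeasure) (X := X) (θ := θ)
    (by rw [hs]; simp) (by rw [hE]; exact hθ)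
  rw [mgf, hE] at ht
  set m := ∑ v, (p v).toReal * Real.exp (t * X v)
  have hm0 : 0 ≤ m := Finset.sum_nonneg fun v _ => by positivity
  refine ⟨m / Real.exp (t * θ), by positivity, (div_lt_one (Real.exp_pos _)).2 ht, fun n => ?_⟩
  rw [div_pow, le_div_iff₀ (by positivity), ← sum_prod_eq_pow n fun v =>
    (p v).toReal * Real.exp (t * X v), Finset.sum_mul]
  refine Finset.sum_le_sum fun u _ => ?_
  rw [Finset.prod_mul_distrib, ← Real.exp_sum, ← Finset.mul_sum, mul_assoc]
  refine mul_le_mul_of_nonneg_left ?_ (seqProb_nonneg p u)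
  split_ifs with h
  · rw [one_mul, ← Real.exp_nat_mul]
    refine Real.exp_le_exp.2 ?_
    nlinarith
  · simp only [zero_mul]; positivity

/-- The finset of typical sequences. -/
def typicalFinset (p : PMF F) (ε : ℝ) (n : ℕ) : Finset (Fin n → F) :=
  (Set.toFinite (typicalSet p ε n)).toFinset

lemma mem_typicalFinset {p : PMF F} {ε : ℝ} {n : ℕ} {u : Fin n → F} :
    u ∈ typicalFinset p ε n ↔ u ∈ typicalSet p ε n := by
  simp [typicalFinset]

/-- The number of occurrences of `v` in `u`. -/
def countOf {n : ℕ} (u : Fin n → F) (v : F) : ℕ := (Finset.univ.filter fun i => u i = v).card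

lemma countOf_eq_sum {n : ℕ} (u : Fin n → F) (v : F) :
    (countOf u v : ℝ) = ∑ i, if u i = v then (1 : ℝ) else 0 := by
  simp [countOf]

lemma eventually_half_le_sum_typical (p : PMF F) {ε : ℝ} (hε : 0 < ε) :
    ∀ᶠ n in atTop, 1 / 2 ≤ ∑ u ∈ typicalFinset p ε n, seqProb p u := by
  classical
  have key : ∀ v : F, ∃ ρ σ : ℝ, (0 ≤ ρ ∧ ρ < 1) ∧ (0 ≤ σ ∧ σ < 1) ∧ ∀ n : ℕ, 0 < n →
      ∑ u : Fin n → F, seqProb p u *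
        (if ε * (p v).toReal < |(countOf u v : ℝ) / n - (p v).toReal| then 1 else 0) ≤
          ρ ^ n + σ ^ n := by
    intro v
    rcases eq_or_lt_of_le (ENNReal.toReal_nonneg (a := p v)) with h0 | hpos
    -- A letter of zero mass deviates only if it occurs, and then the sequence has probability zero.
    -- For `n > 0` the bound `0 ^ n` is available.
    · refine ⟨0, 0, by simp, by simp, fun n hn => ?_⟩
      rw [zero_pow hn.ne', add_zero]
      refine (Finset.sum_eq_zero fun u _ => ?_).le
      split_ifs with h
      · rw [← h0] at h
        have : countOf u v ≠ 0 := fun hz => by simp [hz] at h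
        obtain ⟨i, hi⟩ := Finset.card_ne_zero.1 this
        have hi' := (Finset.mem_filter.1 hi).2
        have : seqProb p u = 0 := Finset.prod_eq_zero (Finset.mem_univ i) (by rw [hi', ← h0])
        rw [this, zero_mul]
      · rw [mul_zero]
    · have hsum : ∑ w, (p w).toReal * (if w = v then (1 : ℝ) else 0) = (p v).toReal := by simp
      obtain ⟨ρ, hρ0, hρ1, hρ⟩ := exists_seqProb_ge_le p (fun w => if w = v then (1 : ℝ) else 0)
        (θ := (1 + ε) * (p v).toReal) (by rw [hsum]; nlinarith)
      obtain ⟨σ, hσ0, hσ1, hσ⟩ := exists_seqProb_ge_le p (fun w => -(if w = v then (1 : ℝ) else 0))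
        (θ := -((1 - ε) * (p v).toReal)) (by
          simp only [mul_neg, Finset.sum_neg_distrib, hsum]; nlinarith)
      refine ⟨ρ, σ, ⟨hρ0, hρ1⟩, ⟨hσ0, hσ1⟩, fun n hn => ?_⟩
      refine le_trans ?_ (add_le_add (hρ n) (hσ n))
      rw [← Finset.sum_add_distrib]
      refine Finset.sum_le_sum fun u _ => ?_
      rw [← mul_add]
      refine mul_le_mul_of_nonneg_left ?_ (seqProb_nonneg p u)
      simp only [Finset.sum_neg_distrib, ← countOf_eq_sum]
      have hn' : (0 : ℝ) < n := by exact_mod_cast hn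
      split_ifs with h1 h2 h3 h3 h2 h3 <;> norm_num
      rw [not_le] at h2 h3
      have hc1 : (countOf u v : ℝ) / n < (1 + ε) * (p v).toReal := by
        rw [div_lt_iff₀ hn']; linarith
      have hc2 : (1 - ε) * (p v).toReal < (countOf u v : ℝ) / n := by
        rw [lt_div_iff₀ hn']; linarith
      exact absurd h1 (not_lt.2 (abs_le.2 ⟨by linarith, by linarith⟩))
  choose ρ σ hρ hσ hb using key
  have hlim : Tendsto (fun n : ℕ => ∑ v, (ρ v ^ n + σ v ^ n)) atTop (𝓝 0) := by
    have : Tendsto (fun n : ℕ => ∑ v, (ρ v ^ n + σ v ^ n)) atTop (𝓝 (∑ _v : F, ((0 : ℝ) + 0))) :=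
      tendsto_finsetSum _ fun v _ =>
        (tendsto_pow_atTop_nhds_zero_of_lt_one (hρ v).1 (hρ v).2).add
          (tendsto_pow_atTop_nhds_zero_of_lt_one (hσ v).1 (hσ v).2)
    simpa using this
  filter_upwards [hlim.eventually_le_const (show (0 : ℝ) < 1 / 2 by norm_num), eventually_gt_atTop 0]
    with n hn hn0
  have h1 := sum_seqProb p n
  rw [← Finset.sum_add_sum_compl (typicalFinset p ε n)] at h1
  have h2 : ∑ u ∈ (typicalFinset p ε n)ᶜ, seqProb p u ≤ ∑ v, (ρ v ^ n + σ v ^ n) := by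
    refine le_trans ?_ (Finset.sum_le_sum fun v _ => hb v n hn0)
    rw [Finset.sum_comm]
    refine le_trans ?_ (Finset.sum_le_sum_of_subset_of_nonneg
      (Finset.subset_univ (typicalFinset p ε n)ᶜ) fun u _ _ => Finset.sum_nonneg fun v _ =>
        mul_nonneg (seqProb_nonneg p u) (by split_ifs <;> simp))
    refine Finset.sum_le_sum fun u hu => ?_
    rw [Finset.mem_compl, mem_typicalFinset, typicalSet, Set.mem_ofPred_eq] at hu
    push Not at hu
    obtain ⟨v, hv⟩ := hu
    refine le_trans (le_of_eq ?_) (Finset.single_le_sum (f := fun v => seqProb p u *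
        (if ε * (p v).toReal < |(countOf u v : ℝ) / n - (p v).toReal| then 1 else 0))
        (fun v _ => mul_nonneg (seqProb_nonneg p u) (by split_ifs <;> simp)) (Finset.mem_univ v))
    have hv' : ε * (p v).toReal < |(countOf u v : ℝ) / n - (p v).toReal| := hv
    simp only [if_pos hv', mul_one]
  linarith

/-- The log probability of a sequence is the sum over letters of the count times `log p`, and
typicality controls every count up to a factor `1 ± ε`. -/
lemma seqProb_bounds_of_typical (p : PMF F) {ε : ℝ} {n : ℕ} (hn : 0 < n) {u : Fin n → F}
    (hu : u ∈ typicalSet p ε n) :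
    Real.exp (-(n * ((1 + ε) * ∑ v, Real.negMulLog (p v).toReal))) ≤ seqProb p u ∧
      seqProb p u ≤ Real.exp (-(n * ((1 - ε) * ∑ v, Real.negMulLog (p v).toReal))) := by
  have hn' : (0 : ℝ) < n := by exact_mod_cast hn
  have hc : ∀ v, (1 - ε) * (p v).toReal * n ≤ countOf u v ∧
      (countOf u v : ℝ) ≤ (1 + ε) * (p v).toReal * n := by
    intro v
    have h := abs_le.1 (show |(countOf u v : ℝ) / n - (p v).toReal| ≤ ε * (p v).toReal from hu v)
    constructor
    · rw [← le_div_iff₀ hn']; linarith [h.1]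
    · rw [← div_le_iff₀ hn']; linarith [h.2]
  -- The tolerance is relative to `p v`, so letters of zero mass cannot occur and the logarithms may
  -- be taken.
  have hpos : ∀ i, 0 < (p (u i)).toReal := by
    intro i
    refine lt_of_le_of_ne ENNReal.toReal_nonneg fun h0 => ?_
    have h1 := (hc (u i)).2
    rw [← h0, mul_zero, zero_mul] at h1
    have h2 : 0 < countOf u (u i) := Finset.card_pos.2 ⟨i, by simp⟩
    have h3 : (0 : ℝ) < countOf u (u i) := by exact_mod_cast h2
    linarith
  have hexp : seqProb p u = Real.exp (∑ v, (countOf u v : ℝ) * Real.log (p v).toReal) := by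
    have h1 : seqProb p u = Real.exp (∑ i, Real.log (p (u i)).toReal) := by
      rw [Real.exp_sum, seqProb]
      exact Finset.prod_congr rfl fun i _ => (Real.exp_log (hpos i)).symm
    rw [h1, ← Finset.sum_fiberwise (s := Finset.univ) (g := u)]
    congr 1
    refine Finset.sum_congr rfl fun v _ => ?_
    rw [Finset.sum_congr rfl (fun i hi => by rw [(Finset.mem_filter.1 hi).2]), Finset.sum_const,
      nsmul_eq_mul, countOf]
  have hle1 : ∀ v, Real.log (p v).toReal ≤ 0 := fun v =>
    Real.log_nonpos ENNReal.toReal_nonneg (ENNReal.toReal_le_of_le_ofReal zero_le_one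
      (by simpa using p.coe_le_one v))
  rw [hexp, Real.exp_le_exp, Real.exp_le_exp]
  constructor
  · rw [Finset.mul_sum, Finset.mul_sum, ← Finset.sum_neg_distrib]
    refine Finset.sum_le_sum fun v _ => ?_
    rw [Real.negMulLog]
    nlinarith [mul_le_mul_of_nonpos_right (hc v).2 (hle1 v)]
  · rw [Finset.mul_sum, Finset.mul_sum, ← Finset.sum_neg_distrib]
    refine Finset.sum_le_sum fun v _ => ?_
    rw [Real.negMulLog]
    nlinarith [mul_le_mul_of_nonpos_right (hc v).1 (hle1 v)]

lemma card_typicalFinset_le (p : PMF F) (ε : ℝ) {n : ℕ} (hn : 0 < n) :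
    ((typicalFinset p ε n).card : ℝ) ≤
      Real.exp (n * ((1 + ε) * ∑ v, Real.negMulLog (p v).toReal)) := by
  have h : ((typicalFinset p ε n).card : ℝ) *
      Real.exp (-(n * ((1 + ε) * ∑ v, Real.negMulLog (p v).toReal))) ≤ 1 := by
    refine le_of_le_of_eq ?_ (sum_seqProb p n)
    rw [← nsmul_eq_mul, ← Finset.sum_const]
    exact (Finset.sum_le_sum fun u hu =>
      (seqProb_bounds_of_typical p hn (mem_typicalFinset.1 hu)).1).trans
      (Finset.sum_le_sum_of_subset_of_nonneg (Finset.subset_univ _)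
        fun u _ _ => seqProb_nonneg p u)
  rwa [Real.exp_neg, ← div_eq_mul_inv, div_le_one (Real.exp_pos _)] at h

lemma eventually_le_card_typicalFinset (p : PMF F) {ε : ℝ} (hε : 0 < ε) :
    ∀ᶠ n : ℕ in atTop, Real.exp (n * ((1 - ε) * ∑ v, Real.negMulLog (p v).toReal)) / 2 ≤
      (typicalFinset p ε n).card := by
  filter_upwards [eventually_half_le_sum_typical p hε, eventually_gt_atTop 0] with n h hn
  have h1 : ∑ u ∈ typicalFinset p ε n, seqProb p u ≤ (typicalFinset p ε n).card *
      Real.exp (-(n * ((1 - ε) * ∑ v, Real.negMulLog (p v).toReal))) := by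
    rw [← nsmul_eq_mul, ← Finset.sum_const]
    exact Finset.sum_le_sum fun u hu =>
      (seqProb_bounds_of_typical p hn (mem_typicalFinset.1 hu)).2
  rw [Real.exp_neg, ← div_eq_mul_inv] at h1
  have h2 := h.trans h1
  rw [le_div_iff₀ (Real.exp_pos _)] at h2
  linarith

end Chernoff

/-! ### Posterior tests and their failure probability. -/

section Tests

variable {F X₁ X₂ Y T T' : Type*} [Field F] [Fintype F] [DecidableEq F] [MeasurableSpace F]
  [DiscreteMeasurableSpace F] [MeasurableSpace X₁] [MeasurableSpace X₂] [MeasurableSpace Y]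

/-- The conditional information density of `g` given `s` and the output. -/
def infoDensity (μ : Measure ((F × F) × Y)) [IsFiniteMeasure μ] (g : F × F → T) (s : F × F → T')
    (ω : (F × F) × Y) : ℝ :=
  Real.log (classProb μ s ω.1 ω.2) - Real.log (classProb μ g ω.1 ω.2)

lemma measurable_infoDensity (μ : Measure ((F × F) × Y)) [IsFiniteMeasure μ] (g : F × F → T)
    (s : F × F → T') : Measurable (infoDensity μ g s) :=
  (measurable_classProb_uncurry μ s).log.sub (measurable_classProb_uncurry μ g).log

lemma ae_infoDensity_nonneg (μ : Measure ((F × F) × Y)) [IsFiniteMeasure μ] {g : F × F → T}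
    {s : F × F → T'} (h : ∀ u v, g u = g v → s u = s v) : ∀ᵐ ω ∂μ, 0 ≤ infoDensity μ g s ω := by
  filter_upwards [ae_classProb_pos μ g] with ω hg
  exact sub_nonneg.2 (Real.log_le_log hg (classProb_le_of_factor μ h ω.1 ω.2))

/-- The exponential moment at `t = 1` is at most the mean of `1 / P(g|y)`; at `t = -1` it is at most
1 because the density is nonnegative when `g` determines `s`. Convexity covers the interval between.
-/
lemma zero_mem_interior_integrableExpSet_infoDensity (μ : Measure ((F × F) × Y))
    [IsProbabilityMeasure μ] {g : F × F → T} {s : F × F → T'} (h : ∀ u v, g u = g v → s u = s v) :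
    0 ∈ interior (integrableExpSet (infoDensity μ g s) μ) := by
  have hm : ∀ t : ℝ, AEStronglyMeasurable (fun ω => Real.exp (t * infoDensity μ g s ω)) μ := fun t =>
    ((measurable_infoDensity μ g s).const_mul t).exp.aestronglyMeasurable
  have h1 : (1 : ℝ) ∈ integrableExpSet (infoDensity μ g s) μ := by
    refine Integrable.mono' (integrable_inv_classProb μ g) (hm 1) ?_
    filter_upwards [ae_classProb_pos μ g, ae_classProb_pos μ s] with ω hg hs
    rw [Real.norm_of_nonneg (Real.exp_pos _).le, one_mul, infoDensity, Real.exp_sub,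
      Real.exp_log hg, Real.exp_log hs, div_eq_mul_inv]
    exact mul_le_of_le_one_left (inv_pos.2 hg).le (classProb_le_one _ _ _ _)
  have h2 : (-1 : ℝ) ∈ integrableExpSet (infoDensity μ g s) μ := by
    refine Integrable.mono' (integrable_const (1 : ℝ)) (hm (-1)) ?_
    filter_upwards [ae_infoDensity_nonneg μ h] with ω hω
    rw [Real.norm_of_nonneg (Real.exp_pos _).le, Real.exp_le_one_iff]
    linarith
  have h3 : Set.Icc (-1 : ℝ) 1 ⊆ integrableExpSet (infoDensity μ g s) μ :=
    convex_integrableExpSet.ordConnected.out h2 h1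
  exact interior_mono h3 (by rw [interior_Icc]; norm_num)

lemma integral_infoDensity (μ : Measure ((F × F) × Y)) [IsProbabilityMeasure μ] (g : F × F → T)
    (s : F × F → T') : ∫ ω, infoDensity μ g s ω ∂μ = classEntropy μ g - classEntropy μ s := by
  unfold infoDensity classEntropy
  rw [integral_sub (integrable_log_classProb μ s) (integrable_log_classProb μ g), integral_neg,
    integral_neg]
  ring

/-- The product of the posterior class probabilities along a sequence. -/
def seqClassProb (μ : Measure ((F × F) × Y)) [IsFiniteMeasure μ] (g : F × F → T) {n : ℕ}
    (u₁ u₂ : Fin n → F) (y : Fin n → Y) : ℝ := ∏ i, classProb μ g (u₁ i, u₂ i) (y i)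

/-- The outputs for which `g` of the pair has a posterior of exponent at most `θ` given `s`. -/
def testSet (μ : Measure ((F × F) × Y)) [IsFiniteMeasure μ] (g : F × F → T) (s : F × F → T')
    (θ : ℝ) {n : ℕ} (u₁ u₂ : Fin n → F) : Set (Fin n → Y) :=
  {y | 0 < seqClassProb μ g u₁ u₂ y ∧
    Real.exp (-(n * θ)) * seqClassProb μ s u₁ u₂ y ≤ seqClassProb μ g u₁ u₂ y}

lemma measurable_seqClassProb (μ : Measure ((F × F) × Y)) [IsFiniteMeasure μ] (g : F × F → T)
    {n : ℕ} (u₁ u₂ : Fin n → F) : Measurable (seqClassProb μ g u₁ u₂) :=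
  Finset.measurable_prod _ fun i _ => (measurable_classProb μ g _).comp (measurable_pi_apply i)

lemma measurableSet_testSet (μ : Measure ((F × F) × Y)) [IsFiniteMeasure μ] (g : F × F → T)
    (s : F × F → T') (θ : ℝ) {n : ℕ} (u₁ u₂ : Fin n → F) :
    MeasurableSet (testSet μ g s θ u₁ u₂) :=
  (measurableSet_lt measurable_const (measurable_seqClassProb μ g u₁ u₂)).inter
    (measurableSet_le ((measurable_seqClassProb μ s u₁ u₂).const_mul _)
      (measurable_seqClassProb μ g u₁ u₂))

/-- The exponential moment of the information density, infinite where the posterior vanishes. -/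
def expDensity (μ : Measure ((F × F) × Y)) [IsFiniteMeasure μ] (g : F × F → T) (s : F × F → T')
    (t : ℝ) (u : F × F) (y : Y) : ℝ≥0∞ :=
  open scoped Classical in
  if 0 < classProb μ g u y then ENNReal.ofReal (Real.exp (t * infoDensity μ g s (u, y))) else ⊤

lemma measurable_expDensity (μ : Measure ((F × F) × Y)) [IsFiniteMeasure μ] (g : F × F → T)
    (s : F × F → T') (t : ℝ) (u : F × F) : Measurable (expDensity μ g s t u) := by
  refine Measurable.ite (measurableSet_lt measurable_const (measurable_classProb μ g u)) ?_
    measurable_const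
  exact (((measurable_infoDensity μ g s).comp (measurable_prodMk_left)).const_mul t).exp.ennreal_ofReal

lemma expDensity_ne_zero (μ : Measure ((F × F) × Y)) [IsFiniteMeasure μ] (g : F × F → T)
    (s : F × F → T') (t : ℝ) (u : F × F) (y : Y) : expDensity μ g s t u y ≠ 0 := by
  unfold expDensity
  split_ifs
  · simpa using Real.exp_pos _
  · simp

lemma lintegral_expDensity (μ : Measure ((F × F) × Y)) [IsProbabilityMeasure μ] (g : F × F → T)
    (s : F × F → T') {t : ℝ} (ht : t ∈ integrableExpSet (infoDensity μ g s) μ) :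
    ∫⁻ ω, expDensity μ g s t ω.1 ω.2 ∂μ = ENNReal.ofReal (mgf (infoDensity μ g s) μ t) := by
  rw [mgf, ofReal_integral_eq_lintegral_ofReal ht
    (Eventually.of_forall fun _ => (Real.exp_pos _).le)]
  refine lintegral_congr_ae ?_
  filter_upwards [ae_classProb_pos μ g] with ω h
  unfold expDensity
  rw [if_pos h]

/-- With positive posteriors, failing the test means that the densities sum to at least `nθ`. If
some posterior vanishes, the value `⊤` of that factor makes the bound trivial, as the other factors
are nonzero. -/
lemma le_prod_expDensity_of_notMem_testSet (μ : Measure ((F × F) × Y)) [IsFiniteMeasure μ]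
    {g : F × F → T} {s : F × F → T'} (h : ∀ u v, g u = g v → s u = s v) {θ t : ℝ} (ht : 0 < t)
    {n : ℕ} {u₁ u₂ : Fin n → F} {y : Fin n → Y} (hy : y ∉ testSet μ g s θ u₁ u₂) :
    ENNReal.ofReal (Real.exp (t * θ)) ^ n ≤ ∏ i, expDensity μ g s t (u₁ i, u₂ i) (y i) := by
  by_cases hz : ∀ i, 0 < classProb μ g (u₁ i, u₂ i) (y i)
  · have hz' : ∀ i, 0 < classProb μ s (u₁ i, u₂ i) (y i) := fun i =>
      (hz i).trans_le (classProb_le_of_factor μ h _ _)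
    have hgpos : 0 < seqClassProb μ g u₁ u₂ y := Finset.prod_pos fun i _ => hz i
    have hspos : 0 < seqClassProb μ s u₁ u₂ y := Finset.prod_pos fun i _ => hz' i
    have hlt : seqClassProb μ g u₁ u₂ y < Real.exp (-(n * θ)) * seqClassProb μ s u₁ u₂ y := by
      by_contra hc
      exact hy ⟨hgpos, not_lt.1 hc⟩
    have hlog := Real.log_lt_log hgpos hlt
    rw [Real.log_mul (Real.exp_pos _).ne' hspos.ne', Real.log_exp, seqClassProb, seqClassProb,
      Real.log_prod fun i _ => (hz i).ne', Real.log_prod fun i _ => (hz' i).ne'] at hlog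
    have hsum : n * θ ≤ ∑ i, infoDensity μ g s ((u₁ i, u₂ i), y i) := by
      simp only [infoDensity, Finset.sum_sub_distrib]
      linarith
    have hprod : ∏ i, expDensity μ g s t (u₁ i, u₂ i) (y i) =
        ENNReal.ofReal (Real.exp (t * ∑ i, infoDensity μ g s ((u₁ i, u₂ i), y i))) := by
      rw [Finset.mul_sum, Real.exp_sum, ENNReal.ofReal_prod_of_nonneg fun i _ => (Real.exp_pos _).le]
      refine Finset.prod_congr rfl fun i _ => ?_
      unfold expDensity
      rw [if_pos (hz i)]
    rw [hprod, ← ENNReal.ofReal_pow (Real.exp_pos _).le, ← Real.exp_nat_mul]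
    refine ENNReal.ofReal_le_ofReal (Real.exp_le_exp.2 ?_)
    nlinarith
  · push Not at hz
    obtain ⟨i, hi⟩ := hz
    have : ∏ i, expDensity μ g s t (u₁ i, u₂ i) (y i) = ⊤ := by
      rw [← Finset.mul_prod_erase _ _ (Finset.mem_univ i)]
      have h1 : expDensity μ g s t (u₁ i, u₂ i) (y i) = ⊤ := by
        unfold expDensity
        rw [if_neg (not_lt.2 hi)]
      rw [h1, ENNReal.top_mul]
      exact Finset.prod_ne_zero_iff.2 fun j _ => expDensity_ne_zero _ _ _ _ _ _
    rw [this]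
    exact le_top

variable (P : Kernel (X₁ × X₂) Y) [IsMarkovKernel P] (p₁ p₂ : PMF F) (x₁ : F → X₁) (x₂ : F → X₂)

/-- The law of the output sequence when the codewords `u₁`, `u₂` are sent. -/
def outputLaw {n : ℕ} (u₁ u₂ : Fin n → F) : Measure (Fin n → Y) :=
  Measure.pi fun i => P (x₁ (u₁ i), x₂ (u₂ i))

instance {n : ℕ} (u₁ u₂ : Fin n → F) : IsProbabilityMeasure (outputLaw P x₁ x₂ u₁ u₂) := by
  unfold outputLaw; infer_instance

lemma lintegral_jointLaw {f : F × F → Y → ℝ≥0∞} (hf : ∀ u, Measurable (f u)) :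
    ∫⁻ ω, f ω.1 ω.2 ∂(jointLaw P p₁ p₂ x₁ x₂) =
      ∑ u : F × F, p₁ u.1 * p₂ u.2 * ∫⁻ y, f u y ∂P (x₁ u.1, x₂ u.2) := by
  rw [jointLaw, Measure.lintegral_compProd (f := fun ω : (F × F) × Y => f ω.1 ω.2)
    (measurable_of_forall_left hf), lintegral_fintype]
  refine Finset.sum_congr rfl fun u _ => ?_
  have : ({u} : Set (F × F)) = {u.1} ×ˢ {u.2} := by simp
  rw [this, Measure.prod_prod, PMF.toMeasure_apply_singleton _ _ (measurableSet_singleton _),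
    PMF.toMeasure_apply_singleton _ _ (measurableSet_singleton _), mul_comm]
  rfl

lemma lintegral_prod_outputLaw {f : F × F → Y → ℝ≥0∞} (hf : ∀ u, Measurable (f u)) {n : ℕ}
    (u₁ u₂ : Fin n → F) :
    ∫⁻ y, ∏ i, f (u₁ i, u₂ i) (y i) ∂(outputLaw P x₁ x₂ u₁ u₂) =
      ∏ i, ∫⁻ z, f (u₁ i, u₂ i) z ∂P (x₁ (u₁ i), x₂ (u₂ i)) := by
  have hi : iIndepFun (fun (i : Fin n) (y : Fin n → Y) => f (u₁ i, u₂ i) (y i))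
      (outputLaw P x₁ x₂ u₁ u₂) :=
    iIndepFun_pi (X := fun i z => f (u₁ i, u₂ i) z) fun i => (hf _).aemeasurable
  rw [lintegral_prod_eq_prod_lintegral_of_indepFun _ _ hi fun i =>
    (hf _).comp (measurable_pi_apply i)]
  refine Finset.prod_congr rfl fun i _ => ?_
  rw [← (measurePreserving_eval (fun i => P (x₁ (u₁ i), x₂ (u₂ i))) i).lintegral_comp (hf _)]
  rfl

/-- For independent inputs the test fails with exponentially small probability. -/
lemma exists_sum_outputLaw_compl_testSet_le {g : F × F → T} {s : F × F → T'}
    (h : ∀ u v, g u = g v → s u = s v) {θ : ℝ}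
    (hθ : classEntropy (jointLaw P p₁ p₂ x₁ x₂) g - classEntropy (jointLaw P p₁ p₂ x₁ x₂) s < θ) :
    ∃ ρ : ℝ, 0 ≤ ρ ∧ ρ < 1 ∧ ∀ n : ℕ, ∑ u₁ : Fin n → F, ∑ u₂ : Fin n → F,
      seqProb p₁ u₁ * seqProb p₂ u₂ * (outputLaw P x₁ x₂ u₁ u₂).real
        (testSet (jointLaw P p₁ p₂ x₁ x₂) g s θ u₁ u₂)ᶜ ≤ ρ ^ n := by
  set μ := jointLaw P p₁ p₂ x₁ x₂
  obtain ⟨t, ht0, htm, ht⟩ := exists_mgf_lt_exp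
    (zero_mem_interior_integrableExpSet_infoDensity μ h)
    (θ := θ) (by rw [integral_infoDensity]; exact hθ)
  set m := mgf (infoDensity μ g s) μ t
  have hm0 : 0 ≤ m := mgf_nonneg
  refine ⟨m / Real.exp (t * θ), by positivity, (div_lt_one (Real.exp_pos _)).2 ht, fun n => ?_⟩
  rw [div_pow, le_div_iff₀ (by positivity)]
  -- Markov's inequality for fixed codewords; the moment factorizes because the channel is
  -- memoryless.
  have hmarkov : ∀ u₁ u₂ : Fin n → F,
      outputLaw P x₁ x₂ u₁ u₂ (testSet μ g s θ u₁ u₂)ᶜ * ENNReal.ofReal (Real.exp (t * θ)) ^ n ≤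
        ∏ i, ∫⁻ z, expDensity μ g s t (u₁ i, u₂ i) z ∂P (x₁ (u₁ i), x₂ (u₂ i)) := by
    intro u₁ u₂
    rw [← lintegral_prod_outputLaw P x₁ x₂ (fun u => measurable_expDensity μ g s t u) u₁ u₂,
      mul_comm]
    refine le_trans ?_ (mul_meas_ge_le_lintegral (μ := outputLaw P x₁ x₂ u₁ u₂)
      (Finset.measurable_prod _ fun i _ => (measurable_expDensity μ g s t (u₁ i, u₂ i)).comp
        (measurable_pi_apply i)) (ENNReal.ofReal (Real.exp (t * θ)) ^ n))
    gcongr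
    exact fun y hy => le_prod_expDensity_of_notMem_testSet μ h ht0 hy
  -- Averaging over the product source collapses the bound to the `n`-th power of a single-letter
  -- moment. Moments at symbol pairs of zero mass may be infinite, but `0 * ⊤ = 0` removes them,
  -- which is why the computation stays in `ℝ≥0∞`.
  have key : ∑ u₁ : Fin n → F, ∑ u₂ : Fin n → F, (∏ i, p₁ (u₁ i)) * (∏ i, p₂ (u₂ i)) *
      (outputLaw P x₁ x₂ u₁ u₂ (testSet μ g s θ u₁ u₂)ᶜ * ENNReal.ofReal (Real.exp (t * θ)) ^ n) ≤
      ENNReal.ofReal m ^ n := by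
    rw [← lintegral_expDensity μ g s htm,
      lintegral_jointLaw P p₁ p₂ x₁ x₂ (fun u => measurable_expDensity μ g s t u),
      ← sum_prod_eq_pow n fun u : F × F => p₁ u.1 * p₂ u.2 *
        ∫⁻ y, expDensity μ g s t u y ∂P (x₁ u.1, x₂ u.2),
      ← (Equiv.arrowProdEquivProdArrow (Fin n) (fun _ => F) (fun _ => F)).symm.sum_comp,
      Fintype.sum_prod_type]
    refine Finset.sum_le_sum fun u₁ _ => Finset.sum_le_sum fun u₂ _ => ?_
    simp only [Equiv.arrowProdEquivProdArrow, Equiv.coe_fn_symm_mk]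
    rw [Finset.prod_mul_distrib, Finset.prod_mul_distrib]
    gcongr
    exact hmarkov u₁ u₂
  have key2 := ENNReal.toReal_mono (by simp) key
  rw [ENNReal.toReal_pow, ENNReal.toReal_ofReal hm0] at key2
  refine le_of_eq_of_le ?_ key2
  rw [ENNReal.toReal_sum, Finset.sum_mul]
  · refine Finset.sum_congr rfl fun u₁ _ => ?_
    rw [ENNReal.toReal_sum, Finset.sum_mul]
    · refine Finset.sum_congr rfl fun u₂ _ => ?_
      rw [ENNReal.toReal_mul, ENNReal.toReal_mul, ENNReal.toReal_mul, ENNReal.toReal_pow,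
        ENNReal.toReal_ofReal (Real.exp_pos _).le, ENNReal.toReal_prod, ENNReal.toReal_prod,
        seqProb, seqProb, measureReal_def]
      ring
    · exact fun u₂ _ => ne_top_of_le_ne_top (by simp) ((Finset.single_le_sum
        (f := fun u₂ : Fin n → F => (∏ i, p₁ (u₁ i)) * (∏ i, p₂ (u₂ i)) *
          (outputLaw P x₁ x₂ u₁ u₂ (testSet μ g s θ u₁ u₂)ᶜ *
            ENNReal.ofReal (Real.exp (t * θ)) ^ n)) (fun _ _ => zero_le) (Finset.mem_univ u₂)).trans
        ((Finset.single_le_sum (f := fun u₁ : Fin n → F => ∑ u₂ : Fin n → F,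
          (∏ i, p₁ (u₁ i)) * (∏ i, p₂ (u₂ i)) *
          (outputLaw P x₁ x₂ u₁ u₂ (testSet μ g s θ u₁ u₂)ᶜ *
            ENNReal.ofReal (Real.exp (t * θ)) ^ n)) (fun _ _ => zero_le)
            (Finset.mem_univ u₁)).trans key))
  · exact fun u₁ _ => ne_top_of_le_ne_top (by simp) ((Finset.single_le_sum
        (f := fun u₁ : Fin n → F => ∑ u₂ : Fin n → F,
          (∏ i, p₁ (u₁ i)) * (∏ i, p₂ (u₂ i)) *
          (outputLaw P x₁ x₂ u₁ u₂ (testSet μ g s θ u₁ u₂)ᶜ *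
            ENNReal.ofReal (Real.exp (t * θ)) ^ n)) (fun _ _ => zero_le)
            (Finset.mem_univ u₁)).trans key)

end Tests

/-! ### Counting the competitors that pass the tests. -/

section Confusion

variable {F Y : Type*} [Field F] [Fintype F] [DecidableEq F] [MeasurableSpace F]
  [DiscreteMeasurableSpace F] [MeasurableSpace Y]

/-- A measure of total mass at most `r` gives mass at least `exp(-x) r` to at most `exp x`
sequences. This bounds the size of every decoding list. -/
lemma sum_le_exp_of_prod_sum_le {ι : Type*} [Fintype ι] [DecidableEq ι] {n : ℕ} {Q : Fin n → ι → ℝ}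
    (hQ : ∀ i w, 0 ≤ Q i w) (x : ℝ) {r : ℝ} (hr : 0 < r) (h : ∏ i, ∑ w, Q i w ≤ r) :
    (∑ w : Fin n → ι, if Real.exp (-x) * r ≤ ∏ i, Q i (w i) then (1 : ℝ) else 0) ≤
      Real.exp x := by
  have h' := Finset.prod_univ_sum (fun _ : Fin n => (Finset.univ : Finset ι)) Q
  rw [Fintype.piFinset_univ] at h'
  have hc : 0 < Real.exp (-x) * r := mul_pos (Real.exp_pos _) hr
  refine le_of_mul_le_mul_right ?_ hc
  calc _ ≤ ∏ i, ∑ w, Q i w := by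
        rw [h', Finset.sum_mul]
        refine Finset.sum_le_sum fun w _ => ?_
        split_ifs with hw
        · rwa [one_mul]
        · rw [zero_mul]; exact Finset.prod_nonneg fun i _ => hQ i _
    _ ≤ r := h
    _ = _ := by rw [← mul_assoc, ← Real.exp_add, add_neg_cancel, Real.exp_zero, one_mul]

lemma seqComb_vecMul {κ n : ℕ} (a : Fin 2 → F) (δ₁ δ₂ : Fin κ → F) (G : Matrix (Fin κ) (Fin n) F) :
    seqComb a (δ₁ ᵥ* G) (δ₂ ᵥ* G) = (a 0 • δ₁ + a 1 • δ₂) ᵥ* G := by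
  rw [Matrix.add_vecMul, Matrix.smul_vecMul, Matrix.smul_vecMul]
  rfl

lemma sum_exists_le_sum {γ ι : Type*} [Fintype γ] [Fintype ι] (p : γ → ι → Prop) [∀ G i, Decidable (p G i)]
    [∀ G, Decidable (∃ i, p G i)] {c : ι → ℝ}
    (h : ∀ i, ∑ G, (if p G i then (1 : ℝ) else 0) ≤ c i) :
    ∑ G, (if ∃ i, p G i then (1 : ℝ) else 0) ≤ ∑ i, c i := by
  refine le_trans ?_ (Finset.sum_le_sum fun i _ => h i)
  rw [Finset.sum_comm]
  refine Finset.sum_le_sum fun G _ => ?_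
  split_ifs with hG
  · obtain ⟨i, hi⟩ := hG
    calc (1 : ℝ) = if p G i then 1 else 0 := by rw [if_pos hi]
      _ ≤ _ := Finset.single_le_sum (f := fun i => if p G i then (1 : ℝ) else 0)
        (fun _ _ => by split_ifs <;> simp) (Finset.mem_univ i)
  · exact Finset.sum_nonneg fun _ _ => by split_ifs <;> simp

lemma seqClassProb_const (μ : Measure ((F × F) × Y)) [IsFiniteMeasure μ] {n : ℕ}
    (u₁ u₂ : Fin n → F) (y : Fin n → Y) : seqClassProb μ (fun _ => ()) u₁ u₂ y = 1 := by
  simp [seqClassProb, classProb]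

/-- A confusion forces `W_a + ηG` onto the list for `η = a₀δ₁ + a₁δ₂`, with `η ≠ 0` as the
combination changes. Because `G` is shared, the union bound runs over the `q^κ` vectors `η` and not
over pairs of differences. -/
lemma sum_confusionSet_comb_le (μ : Measure ((F × F) × Y)) [IsFiniteMeasure μ] (a : Fin 2 → F)
    (s₁ t₁ s₂ t₂ κ : ℕ) {n : ℕ} (θ : ℝ) (u₁ u₂ : Fin n → F) (y : Fin n → Y) :
    ∑ G : Matrix (Fin κ) (Fin n) F, (confusionSet a s₁ t₁ s₂ t₂
      (testSet μ (pairComb a) (fun _ => ()) θ) G u₁ u₂).indicator (fun _ => (1 : ℝ)) y ≤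
      Fintype.card (Matrix (Fin κ) (Fin n) F) *
        ((Fintype.card F : ℝ) ^ κ / (Fintype.card F : ℝ) ^ n * Real.exp (n * θ)) := by
  classical
  set q : ℝ := (Fintype.card F : ℝ) with hq
  have hq0 : 0 < q := by simp only [hq]; exact_mod_cast Fintype.card_pos
  set N : ℝ := ((Fintype.card (Matrix (Fin κ) (Fin n) F) : ℕ) : ℝ) with hN
  let Q : Fin n → F → ℝ := fun i w => (posterior μ (y i)).real (pairComb a ⁻¹' {w})
  have hQ0 : ∀ i w, 0 ≤ Q i w := fun _ _ => measureReal_nonneg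
  have hQ1 : ∀ i, ∑ w, Q i w = 1 := by
    intro i
    have h1 := sum_posterior_mul_comp μ (g := pairComb a) (y i) fun _ => 1
    simp only [mul_one, sum_posterior] at h1
    rw [h1]
    refine (Finset.sum_subset (Finset.subset_univ _) fun w _ hw => ?_).symm
    have : pairComb a ⁻¹' {w} = ∅ := by
      ext u
      simp only [Set.mem_preimage, Set.mem_singleton_iff, Set.mem_empty_iff_false, iff_false]
      rintro rfl
      exact hw (Finset.mem_image_of_mem _ (Finset.mem_univ u))
    show (posterior μ (y i)).real (pairComb a ⁻¹' {w}) = 0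
    rw [this, measureReal_empty]
  let lst : (Fin n → F) → ℝ := fun w => if Real.exp (-(n * θ)) * 1 ≤ ∏ i, Q i (w i) then 1 else 0
  have hlst : ∑ w, lst w ≤ Real.exp (n * θ) :=
    sum_le_exp_of_prod_sum_le hQ0 _ one_pos (by simp [hQ1])
  have hkey : ∀ η : Fin κ → F, ∑ G : Matrix (Fin κ) (Fin n) F,
      (if η ≠ 0 ∧ Real.exp (-(n * θ)) * 1 ≤ ∏ i, Q i ((seqComb a u₁ u₂ + η ᵥ* G) i)
        then (1 : ℝ) else 0) ≤ N * (Real.exp (n * θ) / q ^ n) := by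
    intro η
    by_cases hη : η = 0
    · simp only [hη, ne_eq, not_true_eq_false, false_and, if_false, Finset.sum_const_zero]
      positivity
    · have h := sum_vecMul (n := n) hη fun z => lst (seqComb a u₁ u₂ + z)
      have e : ∑ z, lst (seqComb a u₁ u₂ + z) = ∑ z, lst z :=
        Equiv.sum_comp (Equiv.addLeft (seqComb a u₁ u₂)) lst
      rw [e] at h
      rw [← mul_div_assoc, le_div_iff₀ (by positivity), mul_comm]
      simp only [ne_eq, hη, not_false_eq_true, true_and]
      refine le_of_eq_of_le h ?_
      gcongr
  calc _ ≤ ∑ G : Matrix (Fin κ) (Fin n) F, (if ∃ η : Fin κ → F, η ≠ 0 ∧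
        Real.exp (-(n * θ)) * 1 ≤ ∏ i, Q i ((seqComb a u₁ u₂ + η ᵥ* G) i) then (1 : ℝ) else 0) := by
        refine Finset.sum_le_sum fun G _ => ?_
        by_cases hy : y ∈ confusionSet a s₁ t₁ s₂ t₂ (testSet μ (pairComb a) (fun _ => ()) θ) G u₁ u₂
        · rw [Set.indicator_of_mem hy, if_pos]
          obtain ⟨v₁, l₁, v₂, l₂, hne, -, hA⟩ := hy
          rw [seqComb_vecMul] at hne
          refine ⟨a 0 • padConcat κ v₁ l₁ + a 1 • padConcat κ v₂ l₂,
            fun h0 => hne (by rw [h0, Matrix.zero_vecMul]), ?_⟩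
          rw [seqClassProb_const] at hA
          rw [← seqComb_vecMul, ← seqComb_add]
          exact hA
        · rw [Set.indicator_of_notMem hy]
          split_ifs <;> simp
    _ ≤ ∑ _η : Fin κ → F, N * (Real.exp (n * θ) / q ^ n) := sum_exists_le_sum _ hkey
    _ = _ := by
      rw [Finset.sum_const, nsmul_eq_mul]
      simp only [Finset.card_univ, Fintype.card_fun, Fintype.card_fin, Nat.cast_pow, ← hq]
      ring

/-- The test for a pair of codewords given all linear combinations of the pair. -/
def pairTestSet (μ : Measure ((F × F) × Y)) [IsFiniteMeasure μ] (θ : (Fin 2 → F) → ℝ) {n : ℕ}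
    (u₁ u₂ : Fin n → F) : Set (Fin n → Y) :=
  ⋂ b : Fin 2 → F, testSet μ id (pairComb b) (θ b) u₁ u₂

/-- Along a line on which a linear combination is constant few pairs pass the test. -/
lemma sum_line_pairTestSet_le (μ : Measure ((F × F) × Y)) [IsFiniteMeasure μ] {b : Fin 2 → F}
    (θ : (Fin 2 → F) → ℝ) {e₁ e₂ : F} (he : b 0 * e₁ + b 1 * e₂ = 0) (hne : ¬ (e₁ = 0 ∧ e₂ = 0))
    {n : ℕ} (u₁ u₂ : Fin n → F) (y : Fin n → Y) :
    (∑ z : Fin n → F, (open scoped Classical in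
      if y ∈ pairTestSet μ θ (u₁ + e₁ • z) (u₂ + e₂ • z) then (1 : ℝ) else 0)) ≤
      Real.exp (n * θ b) := by
  classical
  -- Posterior masses of the points of the line through `(u₁ i, u₂ i)`. These points share one value
  -- of `W_b`, so their total is at most the posterior of that value.
  let Q : Fin n → F → ℝ := fun i z => (posterior μ (y i)).real {(u₁ i + e₁ * z, u₂ i + e₂ * z)}
  have hQ0 : ∀ i w, 0 ≤ Q i w := fun _ _ => measureReal_nonneg
  have hQ1 : ∀ i, ∑ z, Q i z ≤ classProb μ (pairComb b) (u₁ i, u₂ i) (y i) := by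
    intro i
    have hinj : Function.Injective fun z : F => (u₁ i + e₁ * z, u₂ i + e₂ * z) := by
      intro z z' hz
      simp only [Prod.mk.injEq, add_right_inj, mul_eq_mul_left_iff] at hz
      tauto
    calc ∑ z, Q i z = ∑ p ∈ Finset.univ.image fun z : F => (u₁ i + e₁ * z, u₂ i + e₂ * z),
          (posterior μ (y i)).real {p} := by
          rw [Finset.sum_image fun _ _ _ _ h => hinj h]
      _ = (posterior μ (y i)).real ((Finset.univ.image fun z : F =>
          (u₁ i + e₁ * z, u₂ i + e₂ * z) : Finset (F × F)) : Set (F × F)) :=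
          sum_measureReal_singleton _
      _ ≤ _ := by
          refine measureReal_mono ?_
          intro p hp
          simp only [Finset.coe_image, Finset.coe_univ, Set.image_univ, Set.mem_range] at hp
          obtain ⟨z, rfl⟩ := hp
          simp only [Set.mem_preimage, Set.mem_singleton_iff, pairComb, linComb]
          linear_combination z * he
  set R := seqClassProb μ (pairComb b) u₁ u₂ y with hR
  have hR0 : 0 ≤ R := Finset.prod_nonneg fun _ _ => classProb_nonneg _ _ _ _
  have hcomb : ∀ z : Fin n → F,
      seqClassProb μ (pairComb b) (u₁ + e₁ • z) (u₂ + e₂ • z) y = R := by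
    intro z
    refine Finset.prod_congr rfl fun i _ => ?_
    have : pairComb b ((u₁ + e₁ • z) i, (u₂ + e₂ • z) i) = pairComb b (u₁ i, u₂ i) := by
      simp only [pairComb, linComb, Pi.add_apply, Pi.smul_apply, smul_eq_mul]
      linear_combination z i * he
    unfold classProb
    rw [this]
  have hid : ∀ z : Fin n → F, seqClassProb μ id (u₁ + e₁ • z) (u₂ + e₂ • z) y = ∏ i, Q i (z i) :=
    fun z => rfl
  -- If the posterior of the combination vanishes, nothing passes, since the test requires a
  -- positive posterior of the pair.
  rcases eq_or_lt_of_le hR0 with h0 | hpos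
  · rw [Finset.sum_eq_zero]
    · exact (Real.exp_pos _).le
    · intro z _
      rw [if_neg]
      intro hy
      have h1 := (Set.mem_iInter.1 hy b).1
      have h2 : seqClassProb μ id (u₁ + e₁ • z) (u₂ + e₂ • z) y ≤
          seqClassProb μ (pairComb b) (u₁ + e₁ • z) (u₂ + e₂ • z) y :=
        Finset.prod_le_prod (fun _ _ => classProb_nonneg _ _ _ _)
          fun i _ => posterior_singleton_le_classProb μ _ _ _
      rw [hcomb, ← h0] at h2
      exact absurd h1 (not_lt.2 h2)
  · have h2 := sum_le_exp_of_prod_sum_le hQ0 (n * θ b) hpos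
      (Finset.prod_le_prod (fun i _ => Finset.sum_nonneg fun z _ => hQ0 i z) fun i _ => hQ1 i)
    refine le_trans (Finset.sum_le_sum fun z _ => ?_) h2
    by_cases hy : y ∈ pairTestSet μ θ (u₁ + e₁ • z) (u₂ + e₂ • z)
    · rw [if_pos hy, if_pos]
      have := (Set.mem_iInter.1 hy b).2
      rwa [hcomb, hid] at this
    · rw [if_neg hy]
      split_ifs <;> simp

/-- Only the test for `b = 0` is used: `W_0` is constant, so that test bounds the posterior of the
pair itself from below. -/
lemma sum_pairTestSet_le (μ : Measure ((F × F) × Y)) [IsFiniteMeasure μ]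
    (θ : (Fin 2 → F) → ℝ) {n : ℕ} (y : Fin n → Y) :
    (∑ z : (Fin n → F) × (Fin n → F), (open scoped Classical in
      if y ∈ pairTestSet μ θ z.1 z.2 then (1 : ℝ) else 0)) ≤ Real.exp (n * θ 0) := by
  classical
  let Q : Fin n → F × F → ℝ := fun i z => (posterior μ (y i)).real {z}
  have h := sum_le_exp_of_prod_sum_le (Q := Q) (fun _ _ => measureReal_nonneg) (n * θ 0) one_pos
    (by simp [Q])
  refine le_trans ?_ h
  rw [← (Equiv.arrowProdEquivProdArrow (Fin n) (fun _ => F) (fun _ => F)).symm.sum_comp]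
  refine Finset.sum_le_sum fun z _ => ?_
  by_cases hy : y ∈ pairTestSet μ θ z.1 z.2
  · rw [if_pos hy, if_pos]
    have := (Set.mem_iInter.1 hy 0).2
    have h1 : seqClassProb μ (pairComb 0) z.1 z.2 y = 1 := by
      have h0 : (pairComb (0 : Fin 2 → F)) ⁻¹' {0} = Set.univ := by
        ext; simp [pairComb, linComb]
      have h3 : ∀ u, pairComb (0 : Fin 2 → F) u = 0 := fun u => by simp [pairComb, linComb]
      simp [seqClassProb, classProb, h3, h0]
    rw [h1] at this
    exact this
  · rw [if_neg hy]
    split_ifs <;> simp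

/-- Independent differences give a uniform pair, counted by the first term. In a relation `b₀δ₁ +
b₁δ₂ = 0` with `b₁ ≠ 0` the second difference is a multiple of the first, and symmetrically for `b₀
≠ 0`; `D b` counts the choices of the free difference, and `hD` leaves open which user supplies it.
-/
lemma sum_confusionSet_pair_le (μ : Measure ((F × F) × Y)) [IsFiniteMeasure μ] (a : Fin 2 → F)
    (s₁ t₁ s₂ t₂ κ : ℕ) {n : ℕ} (θ : (Fin 2 → F) → ℝ) (D : (Fin 2 → F) → ℝ) (hD0 : ∀ b, 0 ≤ D b)
    (hD : ∀ b : Fin 2 → F, b ≠ 0 →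
      (b 1 ≠ 0 ∧ D b = (Fintype.card F : ℝ) ^ (s₁ + t₁)) ∨
      (b 0 ≠ 0 ∧ D b = (Fintype.card F : ℝ) ^ (s₂ + t₂)))
    (u₁ u₂ : Fin n → F) (y : Fin n → Y) :
    ∑ G : Matrix (Fin κ) (Fin n) F, (confusionSet a s₁ t₁ s₂ t₂
      (pairTestSet μ θ) G u₁ u₂).indicator (fun _ => (1 : ℝ)) y ≤
      Fintype.card (Matrix (Fin κ) (Fin n) F) *
        ((Fintype.card F : ℝ) ^ (s₁ + t₁) * (Fintype.card F : ℝ) ^ (s₂ + t₂) /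
          ((Fintype.card F : ℝ) ^ n * (Fintype.card F : ℝ) ^ n) * Real.exp (n * θ 0) +
          ∑ b, D b / (Fintype.card F : ℝ) ^ n * Real.exp (n * θ b)) := by
  classical
  set q : ℝ := (Fintype.card F : ℝ) with hq
  have hq0 : 0 < q := by simp only [hq]; exact_mod_cast Fintype.card_pos
  set N : ℝ := ((Fintype.card (Matrix (Fin κ) (Fin n) F) : ℕ) : ℝ) with hN
  have hcard : ∀ s t : ℕ, ((Fintype.card ((Fin s → F) × (Fin t → F)) : ℕ) : ℝ) = q ^ (s + t) := by
    intro s t; simp [hq, pow_add]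
  let pad : ∀ {s t : ℕ}, (Fin s → F) × (Fin t → F) → Fin κ → F := fun i => padConcat κ i.1 i.2
  let indep : (Fin κ → F) → (Fin κ → F) → Prop := fun δ₁ δ₂ =>
    ∀ b : Fin 2 → F, b 0 • δ₁ + b 1 • δ₂ = 0 → b = 0
  -- two independent differences
  let ev₀ : Matrix (Fin κ) (Fin n) F →
      ((Fin s₁ → F) × (Fin t₁ → F)) × ((Fin s₂ → F) × (Fin t₂ → F)) → Prop := fun G i =>
    indep (pad i.1) (pad i.2) ∧ y ∈ pairTestSet μ θ (u₁ + pad i.1 ᵥ* G) (u₂ + pad i.2 ᵥ* G)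
  have h₀ : ∑ G, (if ∃ i, ev₀ G i then (1 : ℝ) else 0) ≤
      N * (q ^ (s₁ + t₁) * q ^ (s₂ + t₂) / (q ^ n * q ^ n) * Real.exp (n * θ 0)) := by
    refine (sum_exists_le_sum ev₀ (c := fun _ => N * (Real.exp (n * θ 0) / (q ^ n * q ^ n)))
      fun i => ?_).trans (le_of_eq ?_)
    · by_cases hi : indep (pad i.1) (pad i.2)
      · rw [← mul_div_assoc, le_div_iff₀ (by positivity), mul_comm]
        have h := sum_vecMul_pair (n := n) hi fun z =>
          if y ∈ pairTestSet μ θ (u₁ + z.1) (u₂ + z.2) then (1 : ℝ) else 0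
        simp only [ev₀, hi, true_and]
        refine le_of_eq_of_le h (mul_le_mul_of_nonneg_left ?_ (by positivity))
        refine le_of_eq_of_le ?_ (sum_pairTestSet_le μ θ y)
        exact ((Equiv.addLeft u₁).prodCongr (Equiv.addLeft u₂)).sum_comp fun z =>
          if y ∈ pairTestSet μ θ z.1 z.2 then (1 : ℝ) else 0
      · simp only [ev₀, hi, false_and, if_false, Finset.sum_const_zero]
        positivity
    · rw [Finset.sum_const, Finset.card_univ, Fintype.card_prod, nsmul_eq_mul, Nat.cast_mul, hcard,
        hcard]
      ring
  -- differences on a line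
  let ev : ∀ {s t : ℕ}, F → F → Matrix (Fin κ) (Fin n) F → ((Fin s → F) × (Fin t → F)) → Prop :=
    fun e₁ e₂ G i => pad i ≠ 0 ∧
      y ∈ pairTestSet μ θ (u₁ + e₁ • (pad i ᵥ* G)) (u₂ + e₂ • (pad i ᵥ* G))
  have h₁ : ∀ (s t : ℕ) (b : Fin 2 → F) (e₁ e₂ : F), b 0 * e₁ + b 1 * e₂ = 0 →
      ¬ (e₁ = 0 ∧ e₂ = 0) →
      ∑ G, (if ∃ i : (Fin s → F) × (Fin t → F), ev e₁ e₂ G i then (1 : ℝ) else 0) ≤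
        N * (q ^ (s + t) / q ^ n * Real.exp (n * θ b)) := by
    intro s t b e₁ e₂ he hne
    refine (sum_exists_le_sum (ev (s := s) (t := t) e₁ e₂)
      (c := fun _ => N * (Real.exp (n * θ b) / q ^ n)) fun i => ?_).trans (le_of_eq ?_)
    · by_cases hi : pad i = 0
      · simp only [ev, hi, ne_eq, not_true_eq_false, false_and, if_false, Finset.sum_const_zero]
        positivity
      · rw [← mul_div_assoc, le_div_iff₀ (by positivity), mul_comm]
        have h := sum_vecMul (n := n) hi fun z =>
          if y ∈ pairTestSet μ θ (u₁ + e₁ • z) (u₂ + e₂ • z) then (1 : ℝ) else 0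
        simp only [ev, hi, ne_eq, not_false_eq_true, true_and]
        exact le_of_eq_of_le h (mul_le_mul_of_nonneg_left
          (sum_line_pairTestSet_le μ θ he hne u₁ u₂ y) (by positivity))
    · rw [Finset.sum_const, Finset.card_univ, nsmul_eq_mul, hcard]
      ring
  -- each dependent pair of differences lies on a line
  let dep : Matrix (Fin κ) (Fin n) F → (Fin 2 → F) → Prop := fun G b =>
    b ≠ 0 ∧ ∃ (i : (Fin s₁ → F) × (Fin t₁ → F)) (j : (Fin s₂ → F) × (Fin t₂ → F)),
      ¬ (pad i = 0 ∧ pad j = 0) ∧ b 0 • pad i + b 1 • pad j = 0 ∧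
      y ∈ pairTestSet μ θ (u₁ + pad i ᵥ* G) (u₂ + pad j ᵥ* G)
  have h₂ : ∀ b, ∑ G, (if dep G b then (1 : ℝ) else 0) ≤
      N * (D b / q ^ n * Real.exp (n * θ b)) := by
    intro b
    by_cases hb : b = 0
    · simp only [dep, hb, ne_eq, not_true_eq_false, false_and, if_false, Finset.sum_const_zero]
      have := hD0 0
      positivity
    rcases hD b hb with ⟨hb1, hDb⟩ | ⟨hb0, hDb⟩
    · rw [hDb]
      refine le_trans (Finset.sum_le_sum fun G _ => ?_) (h₁ s₁ t₁ b 1 (-(b 0 / b 1))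
        (by field_simp; ring) (by simp))
      by_cases hG : dep G b
      · rw [if_pos hG, if_pos]
        obtain ⟨-, i, j, hij, hcomb, hy⟩ := hG
        have hj : pad j = -(b 0 / b 1) • pad i := by
          have : b 1 • pad j = -(b 0 • pad i) := by rw [eq_neg_iff_add_eq_zero, add_comm]; exact hcomb
          calc pad j = (b 1)⁻¹ • (b 1 • pad j) := by rw [smul_smul, inv_mul_cancel₀ hb1, one_smul]
            _ = _ := by rw [this, smul_neg, smul_smul, neg_smul]; congr 2; field_simp
        refine ⟨i, fun h0 => hij ⟨h0, by rw [hj, h0, smul_zero]⟩, ?_⟩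
        rw [hj, Matrix.smul_vecMul] at hy
        rwa [one_smul]
      · rw [if_neg hG]
        split_ifs <;> simp
    · rw [hDb]
      refine le_trans (Finset.sum_le_sum fun G _ => ?_) (h₁ s₂ t₂ b (-(b 1 / b 0)) 1
        (by field_simp; ring) (by simp))
      by_cases hG : dep G b
      · rw [if_pos hG, if_pos]
        obtain ⟨-, i, j, hij, hcomb, hy⟩ := hG
        have hi : pad i = -(b 1 / b 0) • pad j := by
          have : b 0 • pad i = -(b 1 • pad j) := by rw [eq_neg_iff_add_eq_zero]; exact hcomb
          calc pad i = (b 0)⁻¹ • (b 0 • pad i) := by rw [smul_smul, inv_mul_cancel₀ hb0, one_smul]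
            _ = _ := by rw [this, smul_neg, smul_smul, neg_smul]; congr 2; field_simp
        refine ⟨j, fun h0 => hij ⟨by rw [hi, h0, smul_zero], h0⟩, ?_⟩
        rw [hi, Matrix.smul_vecMul] at hy
        rwa [one_smul]
      · rw [if_neg hG]
        split_ifs <;> simp
  have h₃ := sum_exists_le_sum dep h₂
  rw [mul_add, Finset.mul_sum]
  refine le_trans ?_ (add_le_add h₀ h₃)
  rw [← Finset.sum_add_distrib]
  refine Finset.sum_le_sum fun G _ => ?_
  have hnn : ∀ p : Prop, ∀ _ : Decidable p, (0 : ℝ) ≤ if p then (1 : ℝ) else 0 := fun p _ => by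
    split_ifs <;> simp
  by_cases hy : y ∈ confusionSet a s₁ t₁ s₂ t₂ (pairTestSet μ θ) G u₁ u₂
  · rw [Set.indicator_of_mem hy]
    obtain ⟨v₁, l₁, v₂, l₂, hne, hA⟩ := hy
    by_cases hi : indep (padConcat κ v₁ l₁) (padConcat κ v₂ l₂)
    · rw [if_pos (⟨((v₁, l₁), (v₂, l₂)), hi, hA⟩ : ∃ i, ev₀ G i)]
      linarith [hnn (∃ b, dep G b) inferInstance]
    · simp only [indep, not_forall] at hi
      obtain ⟨b, hb, hb0⟩ := hi
      have : ∃ b, dep G b := by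
        refine ⟨b, hb0, (v₁, l₁), (v₂, l₂), ?_, hb, hA⟩
        -- Two zero differences would leave the linear combination unchanged, contrary to confusion.
        rintro ⟨e1, e2⟩
        simp only [pad] at e1 e2
        refine hne ?_
        rw [seqComb_vecMul, e1, e2]
        simp
      rw [if_pos this]
      linarith [hnn (∃ i, ev₀ G i) inferInstance]
  · rw [Set.indicator_of_notMem hy]
    exact add_nonneg (hnn _ _) (hnn _ _)

end Confusion

/-! ### From block lengths to rates and exponents. -/

section Asymptotics

variable {F X₁ X₂ Y : Type*} [Field F] [Fintype F] [DecidableEq F] [MeasurableSpace F]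
  [DiscreteMeasurableSpace F] [MeasurableSpace X₁] [MeasurableSpace X₂] [MeasurableSpace Y]

lemma toReal_pmf_le_one (p : PMF F) (v : F) : (p v).toReal ≤ 1 :=
  ENNReal.toReal_le_of_le_ofReal zero_le_one (by simpa using p.coe_le_one v)

lemma sum_toReal_pmf (p : PMF F) : ∑ v, (p v).toReal = 1 := by
  rw [← ENNReal.toReal_sum fun v _ => p.apply_ne_top v, ← tsum_fintype (L := .unconditional F),
    p.tsum_coe, ENNReal.toReal_one]

lemma pmfEntropy_nonneg (p : PMF F) : 0 ≤ pmfEntropy p :=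
  Finset.sum_nonneg fun v _ => Real.negMulLog_nonneg ENNReal.toReal_nonneg (toReal_pmf_le_one p v)

lemma pmfEntropy_le_log_card (p : PMF F) : pmfEntropy p ≤ Real.log (Fintype.card F) := by
  have hq : (0 : ℝ) < Fintype.card F := by exact_mod_cast Fintype.card_pos
  have key : ∀ v, Real.negMulLog (p v).toReal - (p v).toReal * Real.log (Fintype.card F) ≤
      (Fintype.card F : ℝ)⁻¹ - (p v).toReal := by
    intro v
    rcases eq_or_lt_of_le (ENNReal.toReal_nonneg (a := p v)) with h0 | hpos
    · rw [← h0]; simp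
    · have h := Real.log_le_sub_one_of_pos (inv_pos.2 (mul_pos hpos hq))
      rw [Real.log_inv, Real.log_mul hpos.ne' hq.ne'] at h
      have h2 := mul_le_mul_of_nonneg_left h hpos.le
      rw [Real.negMulLog]
      have h3 : (p v).toReal * (((p v).toReal * (Fintype.card F : ℝ))⁻¹ - 1) =
          (Fintype.card F : ℝ)⁻¹ - (p v).toReal := by
        field_simp
      linarith
  have h := Finset.sum_le_sum fun v (_ : v ∈ Finset.univ) => key v
  rw [Finset.sum_sub_distrib, Finset.sum_sub_distrib, ← Finset.sum_mul, sum_toReal_pmf,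
    Finset.sum_const, Finset.card_univ, nsmul_eq_mul, mul_inv_cancel₀ hq.ne'] at h
  unfold pmfEntropy
  linarith

lemma log_card_pos : 0 < Real.log (Fintype.card F) :=
  Real.log_pos (by exact_mod_cast Fintype.one_lt_card)

lemma exp_mul_log_card (s : ℕ) :
    Real.exp (s * Real.log (Fintype.card F)) = (Fintype.card F : ℝ) ^ s := by
  rw [mul_comm, Real.exp_mul, Real.exp_log (by exact_mod_cast Fintype.card_pos), Real.rpow_natCast]

lemma exp_le_card_pow_expansionLength (R : ℝ) (n : ℕ) :
    Real.exp (n * (R * Real.log 2)) ≤ (Fintype.card F : ℝ) ^ expansionLength F R n := by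
  have hl := log_card_pos (F := F)
  rw [← exp_mul_log_card, Real.exp_le_exp]
  have h := Nat.le_ceil ((n : ℝ) * R / Real.logb 2 (Fintype.card F))
  have h2 := mul_le_mul_of_nonneg_right h hl.le
  refine le_of_eq_of_le ?_ h2
  rw [Real.logb]
  have := Real.log_pos one_lt_two
  field_simp

/-- Rounding the length up to an integer costs at most one factor `q`. -/
lemma card_pow_expansionLength_le {R : ℝ} (hR : 0 ≤ R) (n : ℕ) :
    (Fintype.card F : ℝ) ^ expansionLength F R n ≤
      Fintype.card F * Real.exp (n * (R * Real.log 2)) := by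
  have hl := log_card_pos (F := F)
  have h2 := Real.log_pos one_lt_two
  have hq : (0 : ℝ) < Fintype.card F := by exact_mod_cast Fintype.card_pos
  nth_rewrite 2 [← Real.exp_log hq]
  rw [← exp_mul_log_card, ← Real.exp_add, Real.exp_le_exp]
  have h := (Nat.ceil_lt_add_one (a := (n : ℝ) * R / Real.logb 2 (Fintype.card F))
    (div_nonneg (by positivity) (div_nonneg hl.le h2.le))).le
  have h2 := mul_le_mul_of_nonneg_right h hl.le
  refine h2.trans (le_of_eq ?_)
  rw [Real.logb]
  field_simp
  ring

lemma numMessages_pos (R : ℝ) (n : ℕ) : 0 < numMessages R n :=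
  Nat.ceil_pos.2 (by positivity)

lemma numMessages_le_card_pow {R : ℝ} {n s : ℕ}
    (h : Real.exp (n * (R * Real.log 2)) ≤ (Fintype.card F : ℝ) ^ s) :
    numMessages R n ≤ Fintype.card (Fin s → F) := by
  refine Nat.ceil_le.2 ?_
  rw [Fintype.card_fun, Fintype.card_fin, Nat.cast_pow]
  refine le_of_eq_of_le ?_ h
  rw [Real.rpow_def_of_pos two_pos]
  congr 1
  ring

lemma exists_injective_label {R : ℝ} {n s : ℕ}
    (h : Real.exp (n * (R * Real.log 2)) ≤ (Fintype.card F : ℝ) ^ s) :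
    ∃ ν : Fin (numMessages R n) → Fin s → F, Function.Injective ν := by
  obtain ⟨e⟩ := Function.Embedding.nonempty_of_card_le (α := Fin (numMessages R n))
    (β := Fin s → F) (by rw [Fintype.card_fin]; exact numMessages_le_card_pow h)
  exact ⟨e, e.injective⟩

/-- A typical sequence has probability at least `exp(-n(1+ε)H)`, so multiplying by the inverse turns
the average over the source into an unweighted sum over typical pairs. -/
lemma sum_typical_compl_le (P : Kernel (X₁ × X₂) Y) [IsMarkovKernel P] (p₁ p₂ : PMF F)
    (x₁ : F → X₁) (x₂ : F → X₂) {n : ℕ} (hn : 0 < n) (ε : ℝ)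
    (A : (Fin n → F) → (Fin n → F) → Set (Fin n → Y)) {α : ℝ}
    (hα : ∑ u₁ : Fin n → F, ∑ u₂ : Fin n → F,
      seqProb p₁ u₁ * seqProb p₂ u₂ * (outputLaw P x₁ x₂ u₁ u₂).real (A u₁ u₂)ᶜ ≤ α) :
    ∑ u₁ ∈ typicalFinset p₁ ε n, ∑ u₂ ∈ typicalFinset p₂ ε n,
      (outputLaw P x₁ x₂ u₁ u₂).real (A u₁ u₂)ᶜ ≤
        Real.exp (n * ((1 + ε) * pmfEntropy p₁)) * Real.exp (n * ((1 + ε) * pmfEntropy p₂)) * α := by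
  set e₁ := Real.exp (n * ((1 + ε) * pmfEntropy p₁)) with he₁
  set e₂ := Real.exp (n * ((1 + ε) * pmfEntropy p₂)) with he₂
  have hone : ∀ (p : PMF F) (u : Fin n → F), u ∈ typicalFinset p ε n →
      1 ≤ Real.exp (n * ((1 + ε) * pmfEntropy p)) * seqProb p u := by
    intro p u hu
    have h := (seqProb_bounds_of_typical p hn (mem_typicalFinset.1 hu)).1
    have h2 := mul_le_mul_of_nonneg_left h (Real.exp_pos (n * ((1 + ε) * pmfEntropy p))).le
    rw [← Real.exp_add] at h2
    refine le_of_eq_of_le ?_ h2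
    unfold pmfEntropy
    rw [add_neg_cancel, Real.exp_zero]
  have hterm : ∀ u₁ u₂, 0 ≤ seqProb p₁ u₁ * seqProb p₂ u₂ *
      (outputLaw P x₁ x₂ u₁ u₂).real (A u₁ u₂)ᶜ := fun u₁ u₂ =>
    mul_nonneg (mul_nonneg (seqProb_nonneg _ _) (seqProb_nonneg _ _)) measureReal_nonneg
  refine le_trans ?_ (mul_le_mul_of_nonneg_left hα (by positivity))
  calc _ ≤ ∑ u₁ ∈ typicalFinset p₁ ε n, ∑ u₂ ∈ typicalFinset p₂ ε n, e₁ * e₂ *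
        (seqProb p₁ u₁ * seqProb p₂ u₂ * (outputLaw P x₁ x₂ u₁ u₂).real (A u₁ u₂)ᶜ) := by
        refine Finset.sum_le_sum fun u₁ h₁ => Finset.sum_le_sum fun u₂ h₂ => ?_
        have h := one_le_mul_of_one_le_of_one_le (hone p₁ u₁ h₁) (hone p₂ u₂ h₂)
        have := mul_le_mul_of_nonneg_right h
          (measureReal_nonneg (μ := outputLaw P x₁ x₂ u₁ u₂) (s := (A u₁ u₂)ᶜ))
        rw [one_mul] at this
        refine this.trans (le_of_eq ?_)
        ring
    _ = e₁ * e₂ * ∑ u₁ ∈ typicalFinset p₁ ε n, ∑ u₂ ∈ typicalFinset p₂ ε n,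
        (seqProb p₁ u₁ * seqProb p₂ u₂ * (outputLaw P x₁ x₂ u₁ u₂).real (A u₁ u₂)ᶜ) := by
        simp only [Finset.mul_sum]
    _ ≤ _ := by
        refine mul_le_mul_of_nonneg_left ?_ (by positivity)
        refine le_trans (Finset.sum_le_sum fun u₁ _ => Finset.sum_le_sum_of_subset_of_nonneg
          (Finset.subset_univ _) fun u₂ _ _ => hterm u₁ u₂) ?_
        exact Finset.sum_le_sum_of_subset_of_nonneg (Finset.subset_univ _)
          fun u₁ _ _ => Finset.sum_nonneg fun u₂ _ => hterm u₁ u₂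

lemma tendsto_exp_natCast_mul_zero {x : ℝ} (hx : x < 0) :
    Tendsto (fun n : ℕ => Real.exp (n * x)) atTop (𝓝 0) := by
  refine Real.tendsto_exp_atBot.comp ?_
  exact tendsto_natCast_atTop_atTop.atTop_mul_const_of_neg hx

/-- The union bound on the expected number of confusable pairs of codewords, with exponential
decay `c` when the auxiliary rates exceed the minimal ones by at most `γ`. -/
def ConfusionBound (a : Fin 2 → F)
    (A : ∀ n : ℕ, (Fin n → F) → (Fin n → F) → Set (Fin n → Y)) (g₁ g₂ c K : ℝ) : Prop :=
  ∀ (γ : ℝ) (n s₁ t₁ s₂ t₂ : ℕ), 0 ≤ γ →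
    (Fintype.card F : ℝ) ^ (s₁ + t₁) / (Fintype.card F : ℝ) ^ n ≤
      (Fintype.card F : ℝ) ^ 2 * Real.exp (n * (γ - g₁)) →
    (Fintype.card F : ℝ) ^ (s₂ + t₂) / (Fintype.card F : ℝ) ^ n ≤
      (Fintype.card F : ℝ) ^ 2 * Real.exp (n * (γ - g₂)) →
    ∀ u₁ u₂ y, ∑ G : Matrix (Fin (max (s₁ + t₁) (s₂ + t₂))) (Fin n) F,
      (confusionSet a s₁ t₁ s₂ t₂ (A n) G u₁ u₂).indicator (fun _ => (1 : ℝ)) y ≤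
        Fintype.card (Matrix (Fin (max (s₁ + t₁) (s₂ + t₂))) (Fin n) F) *
          (K * Real.exp (n * (2 * γ - c)))

end Asymptotics

/-! ### Choice of the parameters and the sequence of codes. -/

section Achievability

variable {F X₁ X₂ Y : Type*} [Field F] [Fintype F] [DecidableEq F] [MeasurableSpace F]
  [DiscreteMeasurableSpace F] [MeasurableSpace X₁] [MeasurableSpace X₂] [MeasurableSpace Y]

lemma exists_code_isNestedLinear (P : Kernel (X₁ × X₂) Y) [IsMarkovKernel P] (a : Fin 2 → F)
    (p₁ p₂ : PMF F) (x₁ : F → X₁) (x₂ : F → X₂) {R₁ R₂ Q₁ Q₂ ε δ α β : ℝ} {n : ℕ}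
    (A : (Fin n → F) → (Fin n → F) → Set (Fin n → Y)) (hA : ∀ u₁ u₂, MeasurableSet (A u₁ u₂))
    (hT₁ : (typicalFinset p₁ ε n).Nonempty) (hT₂ : (typicalFinset p₂ ε n).Nonempty)
    (hα : ∑ u₁ ∈ typicalFinset p₁ ε n, ∑ u₂ ∈ typicalFinset p₂ ε n,
      (outputLaw P x₁ x₂ u₁ u₂).real (A u₁ u₂)ᶜ ≤ α)
    (hβ : ∀ u₁ u₂ y, ∑ G : Matrix (Fin (max (expansionLength F R₁ n + expansionLength F Q₁ n)
        (expansionLength F R₂ n + expansionLength F Q₂ n))) (Fin n) F,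
      (confusionSet a (expansionLength F R₁ n) (expansionLength F Q₁ n) (expansionLength F R₂ n)
        (expansionLength F Q₂ n) A G u₁ u₂).indicator (fun _ => (1 : ℝ)) y ≤
        Fintype.card (Matrix (Fin (max (expansionLength F R₁ n + expansionLength F Q₁ n)
          (expansionLength F R₂ n + expansionLength F Q₂ n))) (Fin n) F) * β)
    (hδ : (Fintype.card F : ℝ) ^ n /
        ((Fintype.card F : ℝ) ^ expansionLength F Q₁ n * (typicalFinset p₁ ε n).card) +
      (Fintype.card F : ℝ) ^ n /
        ((Fintype.card F : ℝ) ^ expansionLength F Q₂ n * (typicalFinset p₂ ε n).card) +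
      (Fintype.card F : ℝ) ^ expansionLength F Q₁ n * (Fintype.card F : ℝ) ^ expansionLength F Q₂ n /
        ((Fintype.card F : ℝ) ^ n * (Fintype.card F : ℝ) ^ n) *
          (α + (typicalFinset p₁ ε n).card * (typicalFinset p₂ ε n).card * β) +
      (Fintype.card F : ℝ) ^ (max (expansionLength F R₁ n + expansionLength F Q₁ n)
        (expansionLength F R₂ n + expansionLength F Q₂ n)) / (Fintype.card F : ℝ) ^ n ≤ δ)
    (hδ1 : δ < 1) :
    ∃ c : Code F X₁ X₂ Y n (numMessages R₁ n) (numMessages R₂ n),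
      c.IsNestedLinear R₁ R₂ Q₁ Q₂ ε p₁ p₂ x₁ x₂ ∧ c.errorProb P a ≤ δ := by
  obtain ⟨ν₁, hν₁⟩ := exists_injective_label (exp_le_card_pow_expansionLength (F := F) R₁ n)
  obtain ⟨ν₂, hν₂⟩ := exists_injective_label (exp_le_card_pow_expansionLength (F := F) R₂ n)
  obtain ⟨G, d₁, d₂, l₁, l₂, dec, hdec, hG, hl₁, hl₂, herr⟩ := exists_nested_linear_code
    (le_max_left _ _) (le_max_right _ _) (numMessages_pos R₁ n) (numMessages_pos R₂ n) a
    _ _ hT₁ hT₂ (fun u₁ u₂ => outputLaw P x₁ x₂ u₁ u₂) A hA ν₁ ν₂ hα hβ hδ hδ1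
  refine ⟨{ u₁ := fun m => codeword G d₁ (ν₁ m) (l₁ m)
            u₂ := fun m => codeword G d₂ (ν₂ m) (l₂ m)
            x₁ := fun m i => x₁ (codeword G d₁ (ν₁ m) (l₁ m) i)
            x₂ := fun m i => x₂ (codeword G d₂ (ν₂ m) (l₂ m) i)
            dec := dec
            u₁_injective := fun m m' h => hν₁ (codeword_injective (le_max_left _ _) hG h).1
            u₂_injective := fun m m' h => hν₂ (codeword_injective (le_max_right _ _) hG h).1
            measurable_dec := hdec }, ⟨⟨G, ⟨d₁, ν₁, l₁, hν₁, fun _ => rfl, fun m h => ?_⟩,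
              ⟨d₂, ν₂, l₂, hν₂, fun _ => rfl, fun m h => ?_⟩⟩, fun _ _ => rfl, fun _ _ => rfl⟩, herr⟩
  · simp only [← mem_typicalFinset] at h ⊢
    exact hl₁ m h
  · simp only [← mem_typicalFinset] at h ⊢
    exact hl₂ m h

/-- Supplies codes for the finitely many block lengths not covered by random coding: the messages
need only inject into `Fⁿ`. -/
lemma exists_code (x₁ : F → X₁) (x₂ : F → X₂) {R₁ R₂ : ℝ}
    (h₁ : R₁ * Real.log 2 ≤ Real.log (Fintype.card F))
    (h₂ : R₂ * Real.log 2 ≤ Real.log (Fintype.card F)) (n : ℕ) :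
    Nonempty (Code F X₁ X₂ Y n (numMessages R₁ n) (numMessages R₂ n)) := by
  have h : ∀ {R : ℝ}, R * Real.log 2 ≤ Real.log (Fintype.card F) →
      Real.exp (n * (R * Real.log 2)) ≤ (Fintype.card F : ℝ) ^ n := fun hR => by
    rw [← exp_mul_log_card, Real.exp_le_exp]
    exact mul_le_mul_of_nonneg_left hR (Nat.cast_nonneg n)
  obtain ⟨ν₁, hν₁⟩ := exists_injective_label (h h₁)
  obtain ⟨ν₂, hν₂⟩ := exists_injective_label (h h₂)
  exact ⟨⟨ν₁, ν₂, fun m i => x₁ (ν₁ m i), fun m i => x₂ (ν₂ m i), fun _ => 0, hν₁, hν₂,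
    measurable_const⟩⟩

lemma Code.errorProb_nonneg {n M₁ M₂ : ℕ} (c : Code F X₁ X₂ Y n M₁ M₂) (P : Kernel (X₁ × X₂) Y)
    (a : Fin 2 → F) : 0 ≤ c.errorProb P a :=
  div_nonneg (Finset.sum_nonneg fun _ _ => Finset.sum_nonneg fun _ _ => measureReal_nonneg)
    (by positivity)

/-- Bound for the failure of multicoding: the expected number of typical codewords of a message is
at least of order `exp(nγ/2)`. -/
lemma card_pow_div_mul_le {h γ ε Q τ : ℝ} {n : ℕ} (hε : ε * h ≤ γ / 2)
    (hQ : Q * Real.log 2 = Real.log (Fintype.card F) - h + γ)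
    (hτ : Real.exp (n * ((1 - ε) * h)) / 2 ≤ τ) :
    (Fintype.card F : ℝ) ^ n / ((Fintype.card F : ℝ) ^ expansionLength F Q n * τ) ≤
      2 * Real.exp (n * (-(γ / 2))) := by
  have hq : (0 : ℝ) < Fintype.card F := by exact_mod_cast Fintype.card_pos
  have h1 := exp_le_card_pow_expansionLength (F := F) Q n
  rw [hQ] at h1
  have hτ0 : 0 < τ := lt_of_lt_of_le (by positivity) hτ
  rw [div_le_iff₀ (by positivity)]
  have h2 := mul_le_mul h1 hτ (by positivity) (by positivity)
  have h3 := mul_le_mul_of_nonneg_left h2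
    (show 0 ≤ 2 * Real.exp ((n : ℝ) * (-(γ / 2))) by positivity)
  refine le_trans ?_ h3
  rw [← exp_mul_log_card]
  have : 2 * Real.exp (↑n * -(γ / 2)) * (Real.exp (↑n * (Real.log ↑(Fintype.card F) - h + γ)) *
      (Real.exp (↑n * ((1 - ε) * h)) / 2)) = Real.exp (n * (Real.log ↑(Fintype.card F) +
        (γ / 2 - ε * h))) := by
    rw [show (n : ℝ) * (Real.log ↑(Fintype.card F) + (γ / 2 - ε * h)) = ↑n * -(γ / 2) +
      (↑n * (Real.log ↑(Fintype.card F) - h + γ) + ↑n * ((1 - ε) * h)) by ring, Real.exp_add,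
      Real.exp_add]
    ring
  rw [this, Real.exp_le_exp]
  exact mul_le_mul_of_nonneg_left (by linarith) (Nat.cast_nonneg n)

/-- Cost, for one user, of summing over all auxiliary indices: the exponent is `γ + εh`, which is at
most `2γ`. -/
lemma card_pow_div_mul_exp_le {h γ ε Q : ℝ} {n : ℕ} (hε : ε * h ≤ γ / 2) (hγ : 0 ≤ γ) (hQ0 : 0 ≤ Q)
    (hQ : Q * Real.log 2 = Real.log (Fintype.card F) - h + γ) :
    (Fintype.card F : ℝ) ^ expansionLength F Q n / (Fintype.card F : ℝ) ^ n *
      Real.exp (n * ((1 + ε) * h)) ≤ Fintype.card F * Real.exp (n * (2 * γ)) := by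
  have hq : (0 : ℝ) < Fintype.card F := by exact_mod_cast Fintype.card_pos
  have h1 := card_pow_expansionLength_le (F := F) hQ0 n
  rw [hQ] at h1
  rw [div_mul_eq_mul_div, div_le_iff₀ (by positivity)]
  refine (mul_le_mul_of_nonneg_right h1 (Real.exp_pos _).le).trans ?_
  rw [← exp_mul_log_card, mul_assoc, mul_assoc, ← Real.exp_add, ← Real.exp_add]
  refine mul_le_mul_of_nonneg_left (Real.exp_le_exp.2 ?_) hq.le
  rw [← mul_add, ← mul_add]
  exact mul_le_mul_of_nonneg_left (by linarith) (Nat.cast_nonneg n)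

/-- The factor `q²` accounts for the two ceilings. The choice of the auxiliary rate turns the size
of the linear code, relative to `qⁿ`, into the exponent `γ - (h - R log 2)`. -/
lemma card_pow_add_div_le {h γ R Q : ℝ} {n : ℕ} (hR0 : 0 ≤ R) (hQ0 : 0 ≤ Q)
    (hQ : Q * Real.log 2 = Real.log (Fintype.card F) - h + γ) :
    (Fintype.card F : ℝ) ^ (expansionLength F R n + expansionLength F Q n) /
      (Fintype.card F : ℝ) ^ n ≤
        (Fintype.card F : ℝ) ^ 2 * Real.exp (n * (γ - (h - R * Real.log 2))) := by
  have hq : (0 : ℝ) < Fintype.card F := by exact_mod_cast Fintype.card_pos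
  have h1 := mul_le_mul (card_pow_expansionLength_le (F := F) hR0 n)
    (card_pow_expansionLength_le (F := F) hQ0 n) (by positivity) (by positivity)
  rw [hQ] at h1
  rw [pow_add, div_le_iff₀ (by positivity)]
  refine h1.trans (le_of_eq ?_)
  rw [← exp_mul_log_card n]
  have e : Real.exp (n * (R * Real.log 2)) * Real.exp (n * (Real.log (Fintype.card F) - h + γ)) =
      Real.exp (n * (γ - (h - R * Real.log 2))) * Real.exp (n * Real.log (Fintype.card F)) := by
    rw [← Real.exp_add, ← Real.exp_add]
    congr 1
    ring
  linear_combination (Fintype.card F : ℝ) ^ 2 * e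

theorem achievableByNestedLinear_of_tests (P : Kernel (X₁ × X₂) Y) [IsMarkovKernel P]
    (a : Fin 2 → F) (p₁ p₂ : PMF F) (x₁ : F → X₁) (x₂ : F → X₂) {R₁ R₂ : ℝ}
    (hR₁ : 0 ≤ R₁) (hR₂ : 0 ≤ R₂) (hg₁ : 0 < pmfEntropy p₁ - R₁ * Real.log 2)
    (hg₂ : 0 < pmfEntropy p₂ - R₂ * Real.log 2)
    (A : ∀ n : ℕ, (Fin n → F) → (Fin n → F) → Set (Fin n → Y))
    (hA : ∀ n u₁ u₂, MeasurableSet (A n u₁ u₂)) {σ K c K' : ℝ} (hσ : 0 < σ) (hc : 0 < c)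
    (hK : 0 ≤ K) (hK' : 0 ≤ K')
    (hα : ∀ n : ℕ, ∑ u₁ : Fin n → F, ∑ u₂ : Fin n → F,
      seqProb p₁ u₁ * seqProb p₂ u₂ * (outputLaw P x₁ x₂ u₁ u₂).real (A n u₁ u₂)ᶜ ≤
        K * Real.exp (n * (-σ)))
    (hβ : ConfusionBound a A (pmfEntropy p₁ - R₁ * Real.log 2) (pmfEntropy p₂ - R₂ * Real.log 2)
      c K') :
    AchievableByNestedLinear P a p₁ p₂ x₁ x₂ R₁ R₂ := by
  set h₁ := pmfEntropy p₁ with hh₁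
  set h₂ := pmfEntropy p₂ with hh₂
  set g₁ := h₁ - R₁ * Real.log 2 with hgg₁
  set g₂ := h₂ - R₂ * Real.log 2 with hgg₂
  set lq := Real.log (Fintype.card F) with hlq
  set q : ℝ := (Fintype.card F : ℝ) with hqdef
  have hq : 0 < q := by simp only [hqdef]; exact_mod_cast Fintype.card_pos
  have hl2 := Real.log_pos one_lt_two
  have hh₁0 : 0 ≤ h₁ := pmfEntropy_nonneg p₁
  have hh₂0 : 0 ≤ h₂ := pmfEntropy_nonneg p₂
  have hh₁q : h₁ ≤ lq := pmfEntropy_le_log_card p₁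
  have hh₂q : h₂ ≤ lq := pmfEntropy_le_log_card p₂
  -- The sum over auxiliary indices costs `2γ` for each user, hence `4γ < σ` for the test; the
  -- confusion bound itself loses a further `2γ`, hence `6γ < c`. The last two inequalities keep
  -- `q^κ` small against `qⁿ`.
  obtain ⟨γ, hγ0, hγσ, hγc, hγ₁, hγ₂⟩ : ∃ γ, 0 < γ ∧ 4 * γ < σ ∧ 6 * γ < c ∧ γ < g₁ ∧ γ < g₂ := by
    have hm : 0 < min (min σ c) (min g₁ g₂) := lt_min (lt_min hσ hc) (lt_min hg₁ hg₂)
    set m := min (min σ c) (min g₁ g₂)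
    have e1 : m ≤ σ := (min_le_left _ _).trans (min_le_left _ _)
    have e2 : m ≤ c := (min_le_left _ _).trans (min_le_right _ _)
    have e3 : m ≤ g₁ := (min_le_right _ _).trans (min_le_left _ _)
    have e4 : m ≤ g₂ := (min_le_right _ _).trans (min_le_right _ _)
    exact ⟨m / 8, by linarith, by linarith, by linarith, by linarith, by linarith⟩
  -- Chosen so that `ε h_k ≤ γ / 2`; the summand `γ` in the denominator keeps `0 < ε < 1` even if
  -- both entropies vanish.
  set ε := γ / (2 * (γ + h₁ + h₂)) with hεdef
  have hden : 0 < γ + h₁ + h₂ := by linarith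
  have hε0 : 0 < ε := by positivity
  have hε1 : ε < 1 := by rw [hεdef, div_lt_one (by linarith)]; linarith
  have hεh : ∀ h, h ≤ γ + h₁ + h₂ → ε * h ≤ γ / 2 := by
    intro h hh
    calc ε * h ≤ ε * (γ + h₁ + h₂) := mul_le_mul_of_nonneg_left hh hε0.le
      _ = γ / 2 := by rw [hεdef]; field_simp
  have hε₁ : ε * h₁ ≤ γ / 2 := hεh h₁ (by linarith)
  have hε₂ : ε * h₂ ≤ γ / 2 := hεh h₂ (by linarith)
  set Q₁ := (lq - h₁ + γ) / Real.log 2 with hQ₁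
  set Q₂ := (lq - h₂ + γ) / Real.log 2 with hQ₂
  have hQ₁0 : 0 ≤ Q₁ := div_nonneg (by linarith) hl2.le
  have hQ₂0 : 0 ≤ Q₂ := div_nonneg (by linarith) hl2.le
  have hQ₁e : Q₁ * Real.log 2 = lq - h₁ + γ := div_mul_cancel₀ _ hl2.ne'
  have hQ₂e : Q₂ * Real.log 2 = lq - h₂ + γ := div_mul_cancel₀ _ hl2.ne'
  -- The summands bound, in order, the failures of the two encoders, the failure of the test,
  -- confusion, and a degenerate matrix.
  let δ : ℕ → ℝ := fun n => 2 * Real.exp (n * (-(γ / 2))) + 2 * Real.exp (n * (-(γ / 2))) +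
    q ^ 2 * (K * Real.exp (n * (4 * γ - σ)) + K' * Real.exp (n * (6 * γ - c))) +
    (q ^ 2 * Real.exp (n * (γ - g₁)) + q ^ 2 * Real.exp (n * (γ - g₂)))
  have hδlim : Tendsto δ atTop (𝓝 0) := by
    have t1 := (tendsto_exp_natCast_mul_zero (show -(γ / 2) < 0 by linarith)).const_mul 2
    have t2 := (tendsto_exp_natCast_mul_zero (show 4 * γ - σ < 0 by linarith)).const_mul K
    have t3 := (tendsto_exp_natCast_mul_zero (show 6 * γ - c < 0 by linarith)).const_mul K'
    have t4 := (tendsto_exp_natCast_mul_zero (show γ - g₁ < 0 by linarith)).const_mul (q ^ 2)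
    have t5 := (tendsto_exp_natCast_mul_zero (show γ - g₂ < 0 by linarith)).const_mul (q ^ 2)
    have t := ((t1.add t1).add ((t2.add t3).const_mul (q ^ 2))).add (t4.add t5)
    simp only [mul_zero, add_zero] at t
    exact t
  have hcode : ∀ᶠ n in atTop, ∃ c : Code F X₁ X₂ Y n (numMessages R₁ n) (numMessages R₂ n),
      c.IsNestedLinear R₁ R₂ Q₁ Q₂ ε p₁ p₂ x₁ x₂ ∧ c.errorProb P a ≤ δ n := by
    filter_upwards [hδlim.eventually_lt_const one_pos, eventually_gt_atTop 0,
      eventually_le_card_typicalFinset p₁ hε0, eventually_le_card_typicalFinset p₂ hε0]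
      with n hδ1 hn hT₁ hT₂
    have hne : ∀ {T : Finset (Fin n → F)} {x : ℝ}, Real.exp x / 2 ≤ (T.card : ℝ) → T.Nonempty := by
      intro T x hT
      have : (0 : ℝ) < T.card := lt_of_lt_of_le (by positivity) hT
      exact Finset.card_pos.1 (by exact_mod_cast this)
    have hL₁ := card_pow_add_div_le (F := F) (n := n) hR₁ hQ₁0 hQ₁e
    have hL₂ := card_pow_add_div_le (F := F) (n := n) hR₂ hQ₂0 hQ₂e
    refine exists_code_isNestedLinear P a p₁ p₂ x₁ x₂ (A n) (hA n) (hne hT₁) (hne hT₂)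
      (sum_typical_compl_le P p₁ p₂ x₁ x₂ hn ε (A n) (hα n))
      (hβ γ n _ _ _ _ hγ0.le hL₁ hL₂) ?_ hδ1
    refine add_le_add (add_le_add (add_le_add (card_pow_div_mul_le hε₁ hQ₁e hT₁)
      (card_pow_div_mul_le hε₂ hQ₂e hT₂)) ?_) ?_
    · have hc₁ := card_typicalFinset_le p₁ ε hn
      have hc₂ := card_typicalFinset_le p₂ ε hn
      have hb₁ := card_pow_div_mul_exp_le (F := F) (n := n) hε₁ hγ0.le hQ₁0 hQ₁e
      have hb₂ := card_pow_div_mul_exp_le (F := F) (n := n) hε₂ hγ0.le hQ₂0 hQ₂e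
      rw [← pmfEntropy] at hc₁ hc₂
      set e₁ := Real.exp (n * ((1 + ε) * h₁))
      set e₂ := Real.exp (n * ((1 + ε) * h₂))
      set w₁ := q ^ expansionLength F Q₁ n
      set w₂ := q ^ expansionLength F Q₂ n
      set B := K' * Real.exp (n * (2 * γ - c))
      set B' := K * Real.exp (n * (-σ))
      have hB0 : 0 ≤ B := by positivity
      have hB'0 : 0 ≤ B' := by positivity
      have hw₁ : 0 ≤ w₁ := by positivity
      have hw₂ : 0 ≤ w₂ := by positivity
      have he₁ : 0 ≤ e₁ := (Real.exp_pos _).le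
      have he₂ : 0 ≤ e₂ := (Real.exp_pos _).le
      have hcc := mul_le_mul hc₁ hc₂ (Nat.cast_nonneg _) he₁
      have hbb := mul_le_mul hb₁ hb₂ (by positivity) (by positivity)
      calc w₁ * w₂ / (q ^ n * q ^ n) * (e₁ * e₂ * B' +
            (typicalFinset p₁ ε n).card * (typicalFinset p₂ ε n).card * B)
          ≤ w₁ * w₂ / (q ^ n * q ^ n) * (e₁ * e₂ * B' + e₁ * e₂ * B) := by gcongr
        _ = w₁ / q ^ n * e₁ * (w₂ / q ^ n * e₂) * (B' + B) := by field_simp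
        _ ≤ q * Real.exp (n * (2 * γ)) * (q * Real.exp (n * (2 * γ))) * (B' + B) :=
          mul_le_mul_of_nonneg_right hbb (by positivity)
        _ = _ := by
          have e4 : Real.exp (n * (4 * γ - σ)) =
              Real.exp (n * (2 * γ)) * Real.exp (n * (2 * γ)) * Real.exp (n * (-σ)) := by
            rw [← Real.exp_add, ← Real.exp_add]; congr 1; ring
          have e6 : Real.exp (n * (6 * γ - c)) =
              Real.exp (n * (2 * γ)) * Real.exp (n * (2 * γ)) * Real.exp (n * (2 * γ - c)) := by
            rw [← Real.exp_add, ← Real.exp_add]; congr 1; ring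
          rw [e4, e6]
          ring
    · rcases max_choice (expansionLength F R₁ n + expansionLength F Q₁ n)
        (expansionLength F R₂ n + expansionLength F Q₂ n) with hm | hm <;> rw [hm]
      · exact hL₁.trans (le_add_of_nonneg_right (by positivity))
      · exact hL₂.trans (le_add_of_nonneg_left (by positivity))
  -- The implication makes a choice possible for every `n`; where no good code exists, the fallback
  -- satisfies it vacuously.
  have hall : ∀ n, ∃ c : Code F X₁ X₂ Y n (numMessages R₁ n) (numMessages R₂ n),
      (∃ c : Code F X₁ X₂ Y n (numMessages R₁ n) (numMessages R₂ n),
        c.IsNestedLinear R₁ R₂ Q₁ Q₂ ε p₁ p₂ x₁ x₂ ∧ c.errorProb P a ≤ δ n) →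
      c.IsNestedLinear R₁ R₂ Q₁ Q₂ ε p₁ p₂ x₁ x₂ ∧ c.errorProb P a ≤ δ n := by
    intro n
    obtain ⟨c₀⟩ := exists_code (Y := Y) x₁ x₂ (show R₁ * Real.log 2 ≤ lq by linarith)
      (show R₂ * Real.log 2 ≤ lq by linarith) n
    by_cases h : ∃ c : Code F X₁ X₂ Y n (numMessages R₁ n) (numMessages R₂ n),
        c.IsNestedLinear R₁ R₂ Q₁ Q₂ ε p₁ p₂ x₁ x₂ ∧ c.errorProb P a ≤ δ n
    · exact ⟨h.choose, fun _ => h.choose_spec⟩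
    · exact ⟨c₀, fun h' => absurd h' h⟩
  choose code hcd using hall
  have hev := hcode.mono fun n hn => hcd n hn
  refine ⟨Q₁, Q₂, ε, hQ₁0, hQ₂0, hε0, hε1, code, hev.mono fun n hn => hn.1, ?_⟩
  exact tendsto_of_tendsto_of_tendsto_of_le_of_le' tendsto_const_nhds hδlim
    (Eventually.of_forall fun n => (code n).errorProb_nonneg P a) (hev.mono fun n hn => hn.2)

lemma AchievableByNestedLinear.achievable {P : Kernel (X₁ × X₂) Y} {a : Fin 2 → F} {p₁ p₂ : PMF F}
    {x₁ : F → X₁} {x₂ : F → X₂} {R₁ R₂ : ℝ}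
    (h : AchievableByNestedLinear P a p₁ p₂ x₁ x₂ R₁ R₂) : Achievable P a R₁ R₂ := by
  obtain ⟨-, -, -, -, -, -, -, c, -, hc⟩ := h
  exact ⟨c, hc⟩

end Achievability

/-! ### The two achievability results: decoding the combination, decoding the pair. -/

section Regions

variable {F X₁ X₂ Y : Type*} [Field F] [Fintype F] [DecidableEq F] [MeasurableSpace F]
  [DiscreteMeasurableSpace F] [MeasurableSpace X₁] [MeasurableSpace X₂] [MeasurableSpace Y]

lemma classEntropy_of_const (μ : Measure ((F × F) × Y)) [IsProbabilityMeasure μ] {T : Type*}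
    {g : F × F → T} (h : ∀ u v, g u = g v) : classEntropy μ g = 0 := by
  have h1 : ∀ u y, classProb μ g u y = 1 := by
    intro u y
    have : g ⁻¹' {g u} = Set.univ := Set.eq_univ_of_forall fun v => h v u
    rw [classProb, this, probReal_univ]
  simp [classEntropy, h1]

lemma classEntropy_le_of_factor (μ : Measure ((F × F) × Y)) [IsProbabilityMeasure μ] {T T' : Type*}
    {g : F × F → T} {s : F × F → T'} (h : ∀ u v, g u = g v → s u = s v) :
    classEntropy μ s ≤ classEntropy μ g := by
  rw [← sub_nonneg, ← integral_infoDensity]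
  exact integral_nonneg_of_ae (ae_infoDensity_nonneg μ h)

lemma classEntropy_nonneg (μ : Measure ((F × F) × Y)) [IsProbabilityMeasure μ] {T : Type*}
    (g : F × F → T) : 0 ≤ classEntropy μ g := by
  rw [← classEntropy_of_const μ (g := fun _ => ()) fun _ _ => rfl]
  exact classEntropy_le_of_factor μ fun _ _ _ => rfl

lemma exists_pow_le_exp {ρ : ℝ} (h0 : 0 ≤ ρ) (h1 : ρ < 1) :
    ∃ σ : ℝ, 0 < σ ∧ ∀ n : ℕ, ρ ^ n ≤ Real.exp (n * (-σ)) := by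
  have hm : 0 < max ρ (1 / 2) := lt_max_of_lt_right (by norm_num)
  refine ⟨-Real.log (max ρ (1 / 2)),
    neg_pos.2 (Real.log_neg hm (max_lt h1 (by norm_num))), fun n => ?_⟩
  rw [neg_neg, Real.exp_nat_mul, Real.exp_log hm]
  exact pow_le_pow_left₀ h0 (le_max_left _ _) n

lemma exists_pos_le_of_finite {ι : Type*} [Finite ι] {f : ι → ℝ} (hf : ∀ i, 0 < f i) :
    ∃ m, 0 < m ∧ ∀ i, m ≤ f i := by
  cases isEmpty_or_nonempty ι
  · exact ⟨1, one_pos, isEmptyElim⟩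
  · obtain ⟨i, hi⟩ := Finite.exists_min f
    exact ⟨f i, hf i, hi⟩

lemma mul_exp_le_mul_exp {x C γ g θ c : ℝ} {n : ℕ} (hC : 0 ≤ C) (hγ : 0 ≤ γ)
    (hx : x ≤ C * Real.exp (n * (γ - g))) (hc : c ≤ g - θ) :
    x * Real.exp (n * θ) ≤ C * Real.exp (n * (2 * γ - c)) := by
  refine (mul_le_mul_of_nonneg_right hx (Real.exp_pos _).le).trans ?_
  rw [mul_assoc, ← Real.exp_add, ← mul_add]
  refine mul_le_mul_of_nonneg_left (Real.exp_le_exp.2 ?_) hC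
  exact mul_le_mul_of_nonneg_left (by linarith) (Nat.cast_nonneg n)

theorem achievableByNestedLinear_of_mem_regionCF (P : Kernel (X₁ × X₂) Y) [IsMarkovKernel P]
    (a : Fin 2 → F) (p₁ p₂ : PMF F) (x₁ : F → X₁) (x₂ : F → X₂) {R₁ R₂ : ℝ}
    (hR₁ : 0 ≤ R₁) (hR₂ : 0 ≤ R₂) (h : (R₁, R₂) ∈ regionCF (jointLaw P p₁ p₂ x₁ x₂) a) :
    AchievableByNestedLinear P a p₁ p₂ x₁ x₂ R₁ R₂ := by
  obtain ⟨h₁, h₂⟩ := nats_of_mem_regionCF h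
  set μ := jointLaw P p₁ p₂ x₁ x₂
  have hE0 := classEntropy_nonneg μ (pairComb a)
  set E := classEntropy μ (pairComb a) with hE
  set g₁ := pmfEntropy p₁ - R₁ * Real.log 2 with hg₁
  set g₂ := pmfEntropy p₂ - R₂ * Real.log 2 with hg₂
  -- The smaller of the two rate gaps is split in half: `m / 2` of slack lets the true combination
  -- pass the test and `m / 2` remains as confusion exponent.
  obtain ⟨m, hm0, hm⟩ := exists_pos_le_of_finite (ι := Bool)
    (f := fun i => (if i then g₁ else g₂) - E) (by intro i; cases i <;> simp <;> linarith)
  have hm₁ : m ≤ g₁ - E := by simpa using hm true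
  have hm₂ : m ≤ g₂ - E := by simpa using hm false
  obtain ⟨ρ, hρ0, hρ1, hρ⟩ := exists_sum_outputLaw_compl_testSet_le P p₁ p₂ x₁ x₂
    (g := pairComb a) (s := fun _ => ()) (θ := E + m / 2) (fun _ _ _ => rfl)
    (by rw [classEntropy_of_const (g := fun _ => ()) _ fun _ _ => rfl]; linarith)
  obtain ⟨σ, hσ, hσb⟩ := exists_pow_le_exp hρ0 hρ1
  have hq : (0 : ℝ) < Fintype.card F := by exact_mod_cast Fintype.card_pos
  refine achievableByNestedLinear_of_tests P a p₁ p₂ x₁ x₂ hR₁ hR₂ (by linarith) (by linarith)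
    (fun n => testSet μ (pairComb a) (fun _ => ()) (E + m / 2))
    (fun n => measurableSet_testSet μ _ _ _) (K := 1) (c := m / 2)
    (K' := (Fintype.card F : ℝ) ^ 2) hσ (by linarith) zero_le_one (by positivity)
    (fun n => by rw [one_mul]; exact (hρ n).trans (hσb n)) ?_
  intro γ n s₁ t₁ s₂ t₂ hγ hL₁ hL₂ u₁ u₂ y
  refine (sum_confusionSet_comb_le μ a s₁ t₁ s₂ t₂ _ (E + m / 2) u₁ u₂ y).trans
    (mul_le_mul_of_nonneg_left ?_ (Nat.cast_nonneg _))
  rcases max_choice (s₁ + t₁) (s₂ + t₂) with hmax | hmax <;> rw [hmax]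
  · exact mul_exp_le_mul_exp (by positivity) hγ hL₁ (by linarith)
  · exact mul_exp_le_mul_exp (by positivity) hγ hL₂ (by linarith)

lemma exists_sum_outputLaw_compl_pairTestSet_le (P : Kernel (X₁ × X₂) Y) [IsMarkovKernel P]
    (p₁ p₂ : PMF F) (x₁ : F → X₁) (x₂ : F → X₂) {θ : (Fin 2 → F) → ℝ}
    (hθ : ∀ b, classEntropy (jointLaw P p₁ p₂ x₁ x₂) id -
      classEntropy (jointLaw P p₁ p₂ x₁ x₂) (pairComb b) < θ b) :
    ∃ σ K : ℝ, 0 < σ ∧ 0 ≤ K ∧ ∀ n : ℕ, ∑ u₁ : Fin n → F, ∑ u₂ : Fin n → F,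
      seqProb p₁ u₁ * seqProb p₂ u₂ * (outputLaw P x₁ x₂ u₁ u₂).real
        (pairTestSet (jointLaw P p₁ p₂ x₁ x₂) θ u₁ u₂)ᶜ ≤ K * Real.exp (n * (-σ)) := by
  set μ := jointLaw P p₁ p₂ x₁ x₂ with hμ
  have key : ∀ b : Fin 2 → F, ∃ σ : ℝ, 0 < σ ∧ ∀ n : ℕ, ∑ u₁ : Fin n → F, ∑ u₂ : Fin n → F,
      seqProb p₁ u₁ * seqProb p₂ u₂ * (outputLaw P x₁ x₂ u₁ u₂).real
        (testSet μ id (pairComb b) (θ b) u₁ u₂)ᶜ ≤ Real.exp (n * (-σ)) := by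
    intro b
    obtain ⟨ρ, hρ0, hρ1, hρ⟩ := exists_sum_outputLaw_compl_testSet_le P p₁ p₂ x₁ x₂
      (g := id) (s := pairComb b) (fun u v huv => congrArg (pairComb b) huv) (hθ b)
    obtain ⟨σ, hσ, hσb⟩ := exists_pow_le_exp hρ0 hρ1
    exact ⟨σ, hσ, fun n => (hρ n).trans (hσb n)⟩
  choose σ hσ hb using key
  obtain ⟨m, hm0, hm⟩ := exists_pos_le_of_finite hσ
  refine ⟨m, Fintype.card (Fin 2 → F), hm0, Nat.cast_nonneg _, fun n => ?_⟩
  calc _ ≤ ∑ u₁ : Fin n → F, ∑ u₂ : Fin n → F, ∑ b : Fin 2 → F,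
        seqProb p₁ u₁ * seqProb p₂ u₂ * (outputLaw P x₁ x₂ u₁ u₂).real
          (testSet μ id (pairComb b) (θ b) u₁ u₂)ᶜ := by
        refine Finset.sum_le_sum fun u₁ _ => Finset.sum_le_sum fun u₂ _ => ?_
        rw [← Finset.mul_sum]
        refine mul_le_mul_of_nonneg_left ?_ (mul_nonneg (seqProb_nonneg _ _) (seqProb_nonneg _ _))
        rw [pairTestSet, Set.compl_iInter]
        exact measureReal_iUnion_fintype_le _
    _ = ∑ b : Fin 2 → F, ∑ u₁ : Fin n → F, ∑ u₂ : Fin n → F,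
        seqProb p₁ u₁ * seqProb p₂ u₂ * (outputLaw P x₁ x₂ u₁ u₂).real
          (testSet μ id (pairComb b) (θ b) u₁ u₂)ᶜ := by
        rw [Finset.sum_comm]
        rw [Finset.sum_congr rfl fun u₁ _ => Finset.sum_comm]
        rw [Finset.sum_comm]
        exact Finset.sum_congr rfl fun b _ => Finset.sum_comm
    _ ≤ ∑ _b : Fin 2 → F, Real.exp (n * (-m)) := by
        refine Finset.sum_le_sum fun b _ => (hb b n).trans (Real.exp_le_exp.2 ?_)
        exact mul_le_mul_of_nonneg_left (neg_le_neg (hm b)) (Nat.cast_nonneg n)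
    _ = _ := by rw [Finset.sum_const, nsmul_eq_mul, Finset.card_univ]

theorem achievableByNestedLinear_of_decodablePair (P : Kernel (X₁ × X₂) Y) [IsMarkovKernel P]
    (a : Fin 2 → F) (p₁ p₂ : PMF F) (x₁ : F → X₁) (x₂ : F → X₂) {R₁ R₂ : ℝ}
    (hR₁ : 0 ≤ R₁) (hR₂ : 0 ≤ R₂)
    (h : DecodablePair (jointLaw P p₁ p₂ x₁ x₂) (pmfEntropy p₁) (pmfEntropy p₂)
      (R₁ * Real.log 2) (R₂ * Real.log 2)) :
    AchievableByNestedLinear P a p₁ p₂ x₁ x₂ R₁ R₂ := by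
  classical
  obtain ⟨hs, hb⟩ := h
  set μ := jointLaw P p₁ p₂ x₁ x₂ with hμ
  set E := classEntropy μ id with hE
  set g₁ := pmfEntropy p₁ - R₁ * Real.log 2 with hg₁
  set g₂ := pmfEntropy p₂ - R₂ * Real.log 2 with hg₂
  have hle : ∀ b : Fin 2 → F, classEntropy μ (pairComb b) ≤ E := fun b =>
    classEntropy_le_of_factor μ fun u v huv => congrArg (pairComb b) huv
  -- For `b = (0, 1)` the condition can only concern the first rate, and `H(W_b|Y) ≤ H(U₁,U₂|Y)`
  -- then gives `R₁ log 2 < H(U₁)`.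
  have hg₁0 : 0 < g₁ := by
    rcases hb ![0, 1] (fun h => one_ne_zero (congrFun h 1)) with h | h
    · linarith [hle ![0, 1], h.2]
    · exact absurd rfl h.1
  have hg₂0 : 0 < g₂ := by
    rcases hb ![1, 0] (fun h => one_ne_zero (congrFun h 0)) with h | h
    · exact absurd rfl h.1
    · linarith [hle ![1, 0], h.2]
  let side : (Fin 2 → F) → Prop := fun b =>
    b 1 ≠ 0 ∧ R₁ * Real.log 2 < pmfEntropy p₁ - E + classEntropy μ (pairComb b)
  have hside : ∀ b, b ≠ 0 → ¬ side b →
      b 0 ≠ 0 ∧ R₂ * Real.log 2 < pmfEntropy p₂ - E + classEntropy μ (pairComb b) :=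
    fun b hb0 hn => (hb b hb0).resolve_left hn
  -- Up to terms in `γ`, the exponent by which the differences counted for `b` fall short of the
  -- space in which they are uniform. Both differences are free when `b = 0`; otherwise only that of
  -- the user chosen by `side` is.
  let gap : (Fin 2 → F) → ℝ := fun b => if b = 0 then g₁ + g₂ else if side b then g₁ else g₂
  have hgap : ∀ b, 0 < gap b - (E - classEntropy μ (pairComb b)) := by
    intro b
    simp only [gap]
    split_ifs with h0 h1
    · have : classEntropy μ (pairComb b) = 0 := classEntropy_of_const μ fun u v => by
        simp [h0, pairComb, linComb]
      linarith
    · linarith [h1.2]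
    · linarith [(hside b h0 h1).2]
  obtain ⟨m, hm0, hm⟩ := exists_pos_le_of_finite hgap
  -- The conditional entropy of the pair given `Y` and `W_b`, plus half of the smallest margin.
  let θ : (Fin 2 → F) → ℝ := fun b => E - classEntropy μ (pairComb b) + m / 2
  obtain ⟨σ, K, hσ, hK, hα⟩ := exists_sum_outputLaw_compl_pairTestSet_le P p₁ p₂ x₁ x₂ (θ := θ)
    (fun b => by simp only [θ]; linarith)
  have hq : (0 : ℝ) < Fintype.card F := by exact_mod_cast Fintype.card_pos
  set q : ℝ := (Fintype.card F : ℝ) with hqdef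
  refine achievableByNestedLinear_of_tests P a p₁ p₂ x₁ x₂ hR₁ hR₂ hg₁0 hg₂0
    (fun n => pairTestSet μ θ)
    (fun n u₁ u₂ => MeasurableSet.iInter fun b => measurableSet_testSet μ _ _ _ _ _) (c := m / 2)
    (K' := q ^ 4 + Fintype.card (Fin 2 → F) * q ^ 2) hσ (by linarith) hK (by positivity) hα ?_
  intro γ n s₁ t₁ s₂ t₂ hγ hL₁ hL₂ u₁ u₂ y
  -- The value at `b = 0` is zero, since that case is carried by the separate term for independent
  -- differences.
  let D : (Fin 2 → F) → ℝ := fun b =>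
    if b = 0 then 0 else if side b then q ^ (s₁ + t₁) else q ^ (s₂ + t₂)
  refine (sum_confusionSet_pair_le μ a s₁ t₁ s₂ t₂ _ θ D (fun b => ?_) (fun b hb0 => ?_)
    u₁ u₂ y).trans (mul_le_mul_of_nonneg_left ?_ (Nat.cast_nonneg _))
  · simp only [D]; split_ifs <;> positivity
  · by_cases h1 : side b
    · exact Or.inl ⟨h1.1, by simp only [D, if_neg hb0, if_pos h1, hqdef]⟩
    · exact Or.inr ⟨(hside b hb0 h1).1, by simp only [D, if_neg hb0, if_neg h1, hqdef]⟩
  rw [add_mul]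
  refine add_le_add ?_ ?_
  · have hm' := hm 0
    simp only [gap, if_true] at hm'
    have hmul := mul_le_mul hL₁ hL₂ (by positivity) (by positivity)
    rw [mul_mul_mul_comm, ← Real.exp_add, ← mul_add, ← pow_add] at hmul
    rw [mul_div_mul_comm]
    refine (mul_le_mul_of_nonneg_right hmul (Real.exp_pos _).le).trans ?_
    rw [mul_assoc, ← Real.exp_add, ← mul_add]
    refine mul_le_mul_of_nonneg_left (Real.exp_le_exp.2 ?_) (by positivity)
    refine mul_le_mul_of_nonneg_left ?_ (Nat.cast_nonneg n)
    simp only [θ]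
    linarith
  · have hsum : Fintype.card (Fin 2 → F) * q ^ 2 * Real.exp (n * (2 * γ - m / 2)) =
        ∑ _b : Fin 2 → F, q ^ 2 * Real.exp (n * (2 * γ - m / 2)) := by
      rw [Finset.sum_const, nsmul_eq_mul, Finset.card_univ, mul_assoc]
    rw [hsum]
    refine Finset.sum_le_sum fun b _ => ?_
    by_cases h0 : b = 0
    · simp only [D, if_pos h0, zero_div, zero_mul]
      positivity
    have hm' := hm b
    by_cases h1 : side b
    · simp only [gap, if_neg h0, if_pos h1] at hm'
      simp only [D, if_neg h0, if_pos h1]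
      exact mul_exp_le_mul_exp (by positivity) hγ hL₁ (by simp only [θ]; linarith)
    · simp only [gap, if_neg h0, if_neg h1] at hm'
      simp only [D, if_neg h0, if_neg h1]
      exact mul_exp_le_mul_exp (by positivity) hγ hL₂ (by simp only [θ]; linarith)

end Regions

end ComputeForward

end

theorem theorem1 {F X₁ X₂ Y : Type*} [Field F] [Fintype F] [DecidableEq F]
    [MeasurableSpace F] [DiscreteMeasurableSpace F]
    [MeasurableSpace X₁] [StandardBorelSpace X₁] [MeasurableSpace X₂] [StandardBorelSpace X₂]
    [MeasurableSpace Y] [StandardBorelSpace Y]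
    (P : ProbabilityTheory.Kernel (X₁ × X₂) Y) [ProbabilityTheory.IsMarkovKernel P]
    (a : Fin 2 → F) (p₁ p₂ : PMF F) (x₁ : F → X₁) (x₂ : F → X₂)
    (R₁ R₂ : ℝ) (hR₁ : 0 ≤ R₁) (hR₂ : 0 ≤ R₂)
    (hR : (R₁, R₂) ∈
      ComputeForward.regionCF (ComputeForward.jointLaw P p₁ p₂ x₁ x₂) a ∪
        ComputeForward.regionLMAC (ComputeForward.jointLaw P p₁ p₂ x₁ x₂) x₁ x₂) :
    ComputeForward.Achievable P a R₁ R₂ ∧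
      ComputeForward.AchievableByNestedLinear P a p₁ p₂ x₁ x₂ R₁ R₂ := by
  have h : ComputeForward.AchievableByNestedLinear P a p₁ p₂ x₁ x₂ R₁ R₂ := by
    rcases hR with h | h
    · exact ComputeForward.achievableByNestedLinear_of_mem_regionCF P a p₁ p₂ x₁ x₂ hR₁ hR₂ h
    · exact ComputeForward.achievableByNestedLinear_of_decodablePair P a p₁ p₂ x₁ x₂ hR₁ hR₂
        (ComputeForward.decodablePair_of_mem_regionLMAC h)
  exact ⟨h.achievable, h⟩
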